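/- **Frames and pea pods.** Let $a\neq b$ be points of $\mathbb R^3$. A pea pod frame $\Sigma$ with longitudinal beam $ab$ consists of a plane $H\ni a,b$, a line (the axis) $L\subset H$ perpendicular to $ab$, and two circles in $H$ through $a$ and $b$ with centres on $L$. One circle is called principal, with centre $c_\Sigma$ and radius $r_\Sigma$; the other is called secondary. Let $m$ be the midpoint of $ab$. The frame is of one of three types: * *elliptic*: $m$ does not lie strictly between the two centres, and the principal centre is strictly closer to $m$ than the secondary one; * *hyperbolic*: $m$ lies strictly between the two centres, and the principal circle is strictly smaller than the secondary one; * *parabolic*: the second circle is replaced by the line $ab$, and $c_\Sigma\notin ab$. The *peas* of $\Sigma$ are the disks in $H$ (of radius $\ge 0$) that lie inside the principal circle, are tangent to it, and, respectively, * lie outside the secondary circle and are tangent to it (elliptic); * lie inside the secondary circle and are tangent to it (hyperbolic); * are tangent to the line $ab$ and lie on the side of it opposite to $c_\Sigma$ (parabolic). Let $E(\Sigma)$ be the set of centres of peas, and for $x\in E(\Sigma)$ let $R_\Sigma(x)=r_\Sigma-|x-c_\Sigma|$ be the radius of the pea at $x$. The centres of the peas lie on a conic in $H$, the *pea string*: an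 ellipse or a hyperbola whose foci are the two centres, or a parabola with focus $c_\Sigma$. The *bulb* is the pea whose centre lies on $L$. **Convex confocal pairs.** Two pea pods are *confocal* if they have the same axis and orthogonal planes, and the foci of each pea string lie on the other pea string. They are *convex confocal* if, in addition, the principal centre of one of them is the centre of the bulb of the other. **Wedge-pod surfaces and boundary curves.** For $x\in E(\Sigma)$ and $y\neq x$ put $$\varphi_\Sigma(x,y)=x+R_\Sigma(x)\,\frac{x-y}{|x-y|}.$$ The wedge-pod surface of $\Sigma$ relative to $\Sigma'$ is $\{\varphi_\Sigma(x,y): x\in E(\Sigma),\ y\in E(\Sigma')\}$. **The surface $\Im$.** Let $abcd$ be a regular tetrahedron of side $2$. For each of the three pairs of opposite edges choose a pair of convex confocal pea pods having these edges as longitudinal beams, and let $(AB),(CD),(AC),(BD),(AD),(BC)$ be the six resulting wedge-pod surfaces, each taken relative to the pea pod on the opposite edge. For a vertex $v$ and an edge $e\not\ni v$ with pea pod $\Sigma_e$, let $\Gamma_{v,e}=\{\varphi_{\Sigma_e}(x,v): x\in E(\Sigma_e)\}$, and let $\Gamma_v$ be the union of the three curves $\Gamma_{v,e}$ over the edges $e\not\ni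 v$. Let $(V)$ be the cap of the sphere $\mathbb S(v,2)$ bounded by $\Gamma_v$ and contained in the boundary of the Reuleaux tetrahedron $T$ (the intersection of the four closed balls of radius $2$ centred at $a,b,c,d$); that is, $\Gamma_v$ together with the component of $\mathbb S(v,2)\setminus\Gamma_v$ contained in $\partial T$. Let $\Im$ be the union of the six wedge-pod surfaces and the four caps. **Theorem.** $\Im$ is the boundary of a convex body $K$ (compact, convex, with non-empty interior) of constant width $2$. The surface $\Im$ is smooth except at the four vertices: at every point of $\Im\setminus\{a,b,c,d\}$ the body $K$ has exactly one supporting plane, and near that point $\Im$ is a regular $C^1$ surface. Each of $a,b,c,d$ is a vertex singularity of $\Im$: a boundary point of $K$ at which the cone of outward normals of $K$ has non-empty interior. -/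

import Mathlib

noncomputable section

namespace Peabody

/-- Euclidean three-space. -/
abbrev E3 : Type := EuclideanSpace ℝ (Fin 3)

/-- The type of a pea pod frame together with its second circle: in the elliptic and hyperbolic
cases the centre of the secondary circle; in the parabolic case the second circle is the line
through the longitudinal beam, so there is no further datum. -/
inductive SecondCircle where
  | elliptic (c' : E3)
  | hyperbolic (c' : E3)
  | parabolic

/-- A (frame of a) pea pod whose longitudinal beam is the chord `ab`. The circles of the frame lie
in `plane`, have their centres on the line `axis`, which is perpendicular to the beam, and pass
through `a` and `b`. `center` is the centre of the principal circle. -/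
structure PeaPod (a b : E3) where
  plane : AffineSubspace ℝ E3
  axis : AffineSubspace ℝ E3
  center : E3
  second : SecondCircle
  finrank_plane : Module.finrank ℝ plane.direction = 2
  finrank_axis : Module.finrank ℝ axis.direction = 1
  axis_le_plane : axis ≤ plane
  ne : a ≠ b
  left_mem : a ∈ plane
  right_mem : b ∈ plane
  perp : ∀ v ∈ axis.direction, inner ℝ v (b - a) = 0
  center_mem : center ∈ axis
  dist_center : dist center a = dist center b
  second_spec : match second with
    | .elliptic c' =>
        c' ∈ axis ∧ dist c' a = dist c' b ∧
        -- `m` is not between the centres, and the principal centre is the one closer to `m`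
        ¬ Sbtw ℝ center (midpoint ℝ a b) c' ∧
        dist center (midpoint ℝ a b) < dist c' (midpoint ℝ a b)
    | .hyperbolic c' =>
        c' ∈ axis ∧ dist c' a = dist c' b ∧
        -- `m` is between the centres, and the principal circle is the smaller one
        Sbtw ℝ center (midpoint ℝ a b) c' ∧ dist center a < dist c' a
    | .parabolic => center ∉ line[ℝ, a, b]

namespace PeaPod

variable {a b c d : E3}

/-- Radius of the principal circle. -/
def radius (S : PeaPod a b) : ℝ := dist S.center a

/-- The disk of centre `x` and radius `ρ ≥ 0` in the plane of the frame is one of the disks of the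
pea pod.  In all cases it is inside the principal circle and (internally) tangent to it.
Elliptic: it is outside the secondary circle and tangent to it.
Hyperbolic: it is inside the secondary circle and tangent to it.
Parabolic: it is tangent to the line of the beam, on the side opposite to the principal centre. -/
def IsPea (S : PeaPod a b) (x : E3) (ρ : ℝ) : Prop :=
  x ∈ S.plane ∧ 0 ≤ ρ ∧ dist x S.center + ρ = S.radius ∧
    match S.second with
    | .elliptic c' => dist x c' = dist c' a + ρ
    | .hyperbolic c' => dist x c' + ρ = dist c' a
    | .parabolic => Metric.infDist x (line[ℝ, a, b] : Set E3) = ρ ∧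
        (line[ℝ, a, b]).WOppSide x S.center

/-- The arc `E(Σ)` of the centres of the peas. -/
def arc (S : PeaPod a b) : Set E3 := {x | ∃ ρ, S.IsPea x ρ}

/-- The radius `R(x)` of the pea with centre `x ∈ E(Σ)`; indeed `S.IsPea x ρ` forces
`ρ = S.peaRadius x`. -/
def peaRadius (S : PeaPod a b) (x : E3) : ℝ := S.radius - dist x S.center

/-- `x` is the centre of the bulb, the pea whose centre lies on the axis. -/
def IsBulbCenter (S : PeaPod a b) (x : E3) : Prop := x ∈ S.arc ∧ x ∈ S.axis

/-- Directrix of the parabolic pea string: the line parallel to the beam `ab`, at distance `radius`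
from it, on the side of it opposite to the principal centre. -/
def directrix (S : PeaPod a b) : AffineSubspace ℝ E3 :=
  AffineSubspace.mk'
    (midpoint ℝ a b +
      (S.radius / dist (midpoint ℝ a b) S.center) • (midpoint ℝ a b - S.center))
    (Submodule.span ℝ {b - a})

/-- The pea string: the full conic (ellipse, hyperbola with both branches, or parabola) that
contains the centres of the peas. -/
def string (S : PeaPod a b) : Set E3 :=
  {x | x ∈ S.plane ∧
    match S.second with
    | .elliptic c' => dist x S.center + dist x c' = S.radius + dist c' a
    | .hyperbolic c' => |dist x c' - dist x S.center| = dist c' a - S.radius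
    | .parabolic => dist x S.center = Metric.infDist x (S.directrix : Set E3)}

/-- The foci of the pea string. -/
def foci (S : PeaPod a b) : Set E3 :=
  match S.second with
  | .elliptic c' => {S.center, c'}
  | .hyperbolic c' => {S.center, c'}
  | .parabolic => {S.center}

/-- Confocal pea pods: same axis, orthogonal planes, and the foci of each pea string lie on the
other one. -/
structure Confocal (S : PeaPod a b) (S' : PeaPod c d) : Prop where
  axis_eq : S.axis = S'.axis
  ortho : S.plane.directionᗮ ⟂ S'.plane.directionᗮ
  foci_left : S.foci ⊆ S'.string
  foci_right : S'.foci ⊆ S.string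

/-- Convex confocal pea pods: moreover the principal centre of one of them is the centre of the
bulb of the other. -/
structure ConvexConfocal (S : PeaPod a b) (S' : PeaPod c d) : Prop extends Confocal S S' where
  bulb : S'.IsBulbCenter S.center ∨ S.IsBulbCenter S'.center

/-- The point on the line through `x` and `y` at distance `R(x)` from `x`, with `x` between it
and `y`. -/
def phi (S : PeaPod a b) (x y : E3) : E3 := x + (S.peaRadius x / dist x y) • (x - y)

/-- The wedge-pod surface of `S` with respect to the other device `S'`. -/
def wedge (S : PeaPod a b) (S' : PeaPod c d) : Set E3 :=
  {p | ∃ x ∈ S.arc, ∃ y ∈ S'.arc, p = S.phi x y}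

/-- The boundary curve of the wedge-pod surface of `S` obtained from the end `v` of the opposite
beam; it joins `a` to `b` on the sphere with centre `v`. -/
def edgeCurve (S : PeaPod a b) (v : E3) : Set E3 := {p | ∃ x ∈ S.arc, p = S.phi x v}

end PeaPod

/-- `abcd` is a regular tetrahedron of side `s`. -/
def IsRegularTetrahedron (s : ℝ) (a b c d : E3) : Prop :=
  dist a b = s ∧ dist a c = s ∧ dist a d = s ∧ dist b c = s ∧ dist b d = s ∧ dist c d = s

/-- The Reuleaux tetrahedron over the regular tetrahedron `abcd` of side `2`. -/
def reuleaux (a b c d : E3) : Set E3 :=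
  Metric.closedBall a 2 ∩ Metric.closedBall b 2 ∩ Metric.closedBall c 2 ∩ Metric.closedBall d 2

/-- The cap of the sphere `𝕊(v,2)` bounded by the curve `Γ` and contained in the boundary of `T`:
the curve, together with the component of its complement in the sphere that lies in the boundary
of `T`. -/
def cap (T : Set E3) (v : E3) (Γ : Set E3) : Set E3 :=
  Γ ∪ {x | x ∈ Metric.sphere v 2 \ Γ ∧
    connectedComponentIn (Metric.sphere v 2 \ Γ) x ⊆ frontier T}

/-- The surface obtained by gluing six wedge-pod surfaces and four spherical caps. -/
def surface {a b c d : E3} (AB : PeaPod a b) (CD : PeaPod c d) (AC : PeaPod a c)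
    (BD : PeaPod b d) (AD : PeaPod a d) (BC : PeaPod b c) : Set E3 :=
  (AB.wedge CD ∪ CD.wedge AB ∪ AC.wedge BD ∪ BD.wedge AC ∪ AD.wedge BC ∪ BC.wedge AD) ∪
  (cap (reuleaux a b c d) a (BC.edgeCurve a ∪ CD.edgeCurve a ∪ BD.edgeCurve a) ∪
   cap (reuleaux a b c d) b (CD.edgeCurve b ∪ AD.edgeCurve b ∪ AC.edgeCurve b) ∪
   cap (reuleaux a b c d) c (AB.edgeCurve c ∪ BD.edgeCurve c ∪ AD.edgeCurve c) ∪
   cap (reuleaux a b c d) d (AB.edgeCurve d ∪ BC.edgeCurve d ∪ AC.edgeCurve d))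

/-- Width of `K` in the direction of the unit vector `u`: the distance between the two supporting
planes of `K` orthogonal to `u`. -/
def width (K : Set E3) (u : E3) : ℝ :=
  sSup ((fun x => inner ℝ u x) '' K) - sInf ((fun x => inner ℝ u x) '' K)

/-- `K` has the same width `w` in every direction. -/
def HasConstantWidth (K : Set E3) (w : ℝ) : Prop := ∀ u : E3, ‖u‖ = 1 → width K u = w

/-- The cone of outward normal vectors of `K` at `p`. -/
def normalCone (K : Set E3) (p : E3) : Set E3 := {u | ∀ x ∈ K, inner ℝ u (x - p) ≤ 0}

/-- There is exactly one supporting plane of `K` at `p`, that is, one outward unit normal. -/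
def HasUniqueSupportPlane (K : Set E3) (p : E3) : Prop := ∃! u : E3, ‖u‖ = 1 ∧ u ∈ normalCone K p

/-- Near `p` the set `M` is a regular surface of class `C¹`. -/
def IsRegularSurfaceAt (M : Set E3) (p : E3) : Prop :=
  ∃ (U : Set E3) (f : E3 → ℝ), IsOpen U ∧ p ∈ U ∧ ContDiffOn ℝ 1 f U ∧
    (∀ x ∈ U, fderiv ℝ f x ≠ 0) ∧ M ∩ U = {x ∈ U | f x = 0}

/-- `p` is a vertex singularity of the boundary of `K`: a boundary point at which the normal cone is
three-dimensional. -/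
def IsVertexSingularity (K : Set E3) (p : E3) : Prop :=
  p ∈ frontier K ∧ (interior (normalCone K p)).Nonempty

end Peabody

end

/-! Let K be `peaBody`, the set of points at distance at most 2 from every point of every pea. It is
the intersection of the balls of radius 2 - R(x) about the pea centres x, and the surface turns out
to be its boundary.

Everything rests on a focal property of confocal conics, `Regular.dist_arcPt_opp`: for pea centres x
and y on opposite edges, |x - y| = 2 - R(x) - R'(y). Hence φ(x, y), at distance R(x) beyond x, lies
on the sphere of radius 2 - R'(y) about y. By the triangle inequality it satisfies every constraint
coming from the edge of y. The segment from φ(x, y) to φ'(y, x) has length 2.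

In barycentric coordinates the constraints of one edge on a fixed point say that an affine function,
`gap`, is nonpositive on a strictly convex planar arc. Outside the region `InWedge` the two ends of
the arc, which are vertices of the tetrahedron, give the strongest constraints (`gap_nonpos`).
Inside it at most one point of the arc is active for a point of K (`gap_zero_unique`). By Lagrange
multipliers the point then lies on the wedge-pod surface of the opposite edge
(`Regular.eq_tip_of_active`). Two different wedges never meet in the Reuleaux tetrahedron, because
three nonpositive coordinates force a vertex. So at a boundary point other than a vertex exactly one
ball is active (`Regular.active_unique`). It is centred at a vertex, on the caps, or at an inner
point of an arc, on the wedge-pod surfaces.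

A single active ball gives a single normal. Unique normals vary continuously, so the gauge of K is
C¹ where it matters (`isRegularSurfaceAt_frontier`). For constant width it suffices that every
double normal has length 2 (`hasConstantWidth_of_doubleNormal`), which follows from the segments of
length 2 above and an analysis of the ends at vertices and on caps.

It remains to bring the frames to this form. With heights along the axis measured in units of √8, a
pea at height s has radius k * s in all three types. Confocality and convexity then give k * k' = 8
with k, k' > 0 and the arc equation `OnArc` (`confocal_central`, `confocal_parabolic`,
`confocal_signs`). -/

noncomputable section

namespace Peabody

open Metric Set Filter Topology

/-! ### Convex bodies: normals of ball intersections, constant width, C¹ boundary. -/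

section ConvexGeometry

/-- The intersection of the balls with centre `c.1` and radius `2 - c.2`, for `c ∈ C`. -/
def ballHull (C : Set (E3 × ℝ)) : Set E3 := {z | ∀ c ∈ C, dist z c.1 + c.2 ≤ 2}

lemma mem_ballHull {C : Set (E3 × ℝ)} {z : E3} :
    z ∈ ballHull C ↔ ∀ c ∈ C, dist z c.1 + c.2 ≤ 2 := Iff.rfl

lemma isClosed_ballHull (C : Set (E3 × ℝ)) : IsClosed (ballHull C) := by
  have : ballHull C = ⋂ c ∈ C, {z | dist z c.1 + c.2 ≤ 2} := by
    ext z; simp [ballHull]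
  rw [this]
  exact isClosed_biInter fun c _ => isClosed_le (by fun_prop) continuous_const

lemma convex_ballHull (C : Set (E3 × ℝ)) : Convex ℝ (ballHull C) := by
  have : ballHull C = ⋂ c ∈ C, closedBall c.1 (2 - c.2) := by
    ext z; simp [ballHull, le_sub_iff_add_le]
  rw [this]
  exact convex_iInter₂ fun c _ => convex_closedBall _ _

/-- By compactness the largest value of distance plus radius is attained, hence is below 2. The
slack is uniform, so a whole ball about `p` satisfies the constraints. -/
lemma mem_interior_ballHull {C : Set (E3 × ℝ)} (hC : IsCompact C) {p : E3}
    (hp : p ∈ ballHull C) (h : ∀ c ∈ C, dist p c.1 + c.2 ≠ 2) : p ∈ interior (ballHull C) := by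
  rcases C.eq_empty_or_nonempty with rfl | hne
  · have : ballHull ∅ = univ := by ext; simp [ballHull]
    simp [this]
  obtain ⟨c, hc, hmax⟩ := hC.exists_isMaxOn hne
    (f := fun c : E3 × ℝ => dist p c.1 + c.2) (by fun_prop)
  have hlt : dist p c.1 + c.2 < 2 := lt_of_le_of_ne (hp c hc) (h c hc)
  rw [mem_interior]
  refine ⟨ball p (2 - (dist p c.1 + c.2)), fun z hz c' hc' => ?_, isOpen_ball,
    mem_ball_self (by linarith)⟩
  have h1 := dist_triangle z p c'.1
  have h2 : dist p c'.1 + c'.2 ≤ dist p c.1 + c.2 := hmax hc'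
  have h3 := mem_ball.1 hz
  linarith

lemma normalCone_of_active {C : Set (E3 × ℝ)} {p : E3} {c : E3 × ℝ} (hc : c ∈ C)
    (h : dist p c.1 + c.2 = 2) : p - c.1 ∈ normalCone (ballHull C) p := by
  intro z hz
  have h1 : ‖z - c.1‖ ≤ ‖p - c.1‖ := by
    have := hz c hc
    rw [← dist_eq_norm, ← dist_eq_norm]; linarith
  have h2 : inner ℝ (p - c.1) (z - p) = inner ℝ (p - c.1) (z - c.1) - ‖p - c.1‖ ^ 2 := by
    rw [← real_inner_self_eq_norm_sq, ← inner_sub_right]; congr 1; abel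
  have h3 := real_inner_le_norm (p - c.1) (z - c.1)
  rw [h2]
  nlinarith [norm_nonneg (p - c.1)]

lemma notMem_interior_of_normal {K : Set E3} {p u : E3} (hu : u ≠ 0) (h : u ∈ normalCone K p) :
    p ∉ interior K := by
  intro hp
  have hlim : Tendsto (fun t : ℝ => p + t • u) (𝓝[>] 0) (𝓝 p) := by
    have : Continuous fun t : ℝ => p + t • u := by fun_prop
    simpa using (this.tendsto 0).mono_left nhdsWithin_le_nhds
  obtain ⟨t, ht, ht0⟩ := ((hlim.eventually (mem_interior_iff_mem_nhds.1 hp)).and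
    self_mem_nhdsWithin).exists
  have h1 := h _ ht
  rw [add_sub_cancel_left, inner_smul_right, real_inner_self_eq_norm_sq] at h1
  have : 0 < ‖u‖ ^ 2 := by positivity
  have : (0 : ℝ) < t := ht0
  nlinarith [mul_pos this ‹0 < ‖u‖ ^ 2›]

/-- At a point with only one active ball, the normal of that ball is the only normal. -/
lemma normal_eq_of_active_unique {C : Set (E3 × ℝ)} (hC : IsCompact C) {p : E3}
    (hp : p ∈ ballHull C) {c : E3 × ℝ} (hpc : p ≠ c.1)
    (huniq : ∀ c' ∈ C, dist p c'.1 + c'.2 = 2 → c' = c)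
    {u : E3} (hu : ‖u‖ = 1) (hN : u ∈ normalCone (ballHull C) p) :
    u = (dist p c.1)⁻¹ • (p - c.1) := by
  have hd : 0 < dist p c.1 := dist_pos.2 hpc
  set n : E3 := (dist p c.1)⁻¹ • (p - c.1) with hn
  have hn1 : ‖n‖ = 1 := by
    rw [hn, norm_smul, norm_inv, ← dist_eq_norm, Real.norm_of_nonneg hd.le,
      inv_mul_cancel₀ hd.ne']
  by_contra hne
  have hlt : inner ℝ u n < 1 := (inner_lt_one_iff_real_of_norm_eq_one hu hn1).2 hne
  -- The direction `w` makes an acute angle with `u` and an obtuse one with `n`. Moving along it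
  -- leaves the body, because `u` is a normal, yet moves towards the centre of the only active ball.
  set w := u - n with hw
  have huw : 0 < inner ℝ u w := by
    rw [hw, inner_sub_right, real_inner_self_eq_norm_sq, hu]; linarith
  have hnw : inner ℝ n w < 0 := by
    rw [hw, inner_sub_right, real_inner_self_eq_norm_sq, hn1, real_inner_comm]; linarith
  have hex : ∀ k : ℕ, ∃ c' ∈ C, 2 < dist (p + (1 / ((k : ℝ) + 1)) • w) c'.1 + c'.2 := by
    intro k
    by_contra! hcon
    have h1 := hN _ hcon
    rw [add_sub_cancel_left, inner_smul_right] at h1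
    have : (0 : ℝ) < 1 / ((k : ℝ) + 1) := by positivity
    nlinarith [mul_pos this huw]
  choose f hfC hf using hex
  obtain ⟨c', hc', φ, hφ, hlim⟩ := hC.tendsto_subseq hfC
  have hε : Tendsto (fun k : ℕ => 1 / ((φ k : ℝ) + 1)) atTop (𝓝 0) :=
    tendsto_one_div_add_atTop_nhds_zero_nat.comp hφ.tendsto_atTop
  have hpt : Tendsto (fun k : ℕ => p + (1 / ((φ k : ℝ) + 1)) • w) atTop (𝓝 p) := by
    simpa using tendsto_const_nhds.add (hε.smul_const w)
  have hf1 : Tendsto (fun k => (f (φ k)).1) atTop (𝓝 c'.1) :=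
    (continuous_fst.tendsto _).comp hlim
  have hf2 : Tendsto (fun k => (f (φ k)).2) atTop (𝓝 c'.2) :=
    (continuous_snd.tendsto _).comp hlim
  -- The constraints violated by the displaced points accumulate at a constraint active at `p`, and
  -- this can only be `c`.
  have hge : 2 ≤ dist p c'.1 + c'.2 :=
    ge_of_tendsto' ((hpt.dist hf1).add hf2) fun k => (hf (φ k)).le
  have hcc : c' = c := huniq c' hc' (le_antisymm (hp c' hc') hge)
  subst hcc
  have hinner : ∀ k, 0 ≤ inner ℝ (p + (1 / ((φ k : ℝ) + 1)) • w - (f (φ k)).1) w := by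
    intro k
    have hk : (0 : ℝ) < 1 / ((φ k : ℝ) + 1) := by positivity
    set ε : ℝ := 1 / ((φ k : ℝ) + 1)
    have h1 := hf (φ k)
    have h2 := hp _ (hfC (φ k))
    have h3 : ‖p - (f (φ k)).1‖ < ‖p + ε • w - (f (φ k)).1‖ := by
      rw [← dist_eq_norm, ← dist_eq_norm]; linarith
    have h4 : p - (f (φ k)).1 = (p + ε • w - (f (φ k)).1) - ε • w := by abel
    have h5 : ‖p - (f (φ k)).1‖ ^ 2 < ‖p + ε • w - (f (φ k)).1‖ ^ 2 :=
      pow_lt_pow_left₀ h3 (norm_nonneg _) two_ne_zero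
    rw [h4, norm_sub_sq_real, inner_smul_right] at h5
    have h6 : 0 ≤ ‖ε • w‖ ^ 2 := by positivity
    by_contra! hneg
    nlinarith [mul_neg_of_pos_of_neg hk hneg]
  have hfin : 0 ≤ inner ℝ (p - c'.1) w :=
    ge_of_tendsto' ((hpt.sub hf1).inner tendsto_const_nhds) hinner
  rw [hn, inner_smul_left] at hnw
  simp only [conj_trivial] at hnw
  have : 0 ≤ (dist p c'.1)⁻¹ * inner ℝ (p - c'.1) w := by positivity
  linarith

/-- A convex body all of whose double normals have length `2` has constant width `2`. -/
theorem hasConstantWidth_of_doubleNormal {K : Set E3} (hK : IsCompact K) (hconv : Convex ℝ K)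
    (hnon : (interior K).Nonempty)
    (h : ∀ p ∈ K, ∀ q ∈ K, ∀ (u : E3) (w : ℝ), ‖u‖ = 1 → 0 < w → p - q = w • u →
      u ∈ normalCone K p → -u ∈ normalCone K q → w = 2) : HasConstantWidth K 2 := by
  obtain ⟨o, ho⟩ := hnon
  set D : Set E3 := (fun z : E3 × E3 => z.1 - z.2) '' (K ×ˢ K) with hD
  have hDc : IsCompact D := (hK.prod hK).image (by fun_prop)
  have hDconv : Convex ℝ D := by
    have := (hconv.prod hconv).is_linear_image
      (f := fun z : E3 × E3 => z.1 - z.2) ⟨fun x y => by simp; abel, fun c x => by simp [smul_sub]⟩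
    exact this
  have hmem : ∀ {p q : E3}, p ∈ K → q ∈ K → p - q ∈ D := fun hp hq => ⟨(_, _), ⟨hp, hq⟩, rfl⟩
  have hoK := interior_subset ho
  have h0 : D ∈ 𝓝 (0 : E3) := by
    have h1 : Tendsto (fun z : E3 => z + o) (𝓝 0) (𝓝 o) := by
      have : Continuous fun z : E3 => z + o := by fun_prop
      simpa using this.tendsto 0
    filter_upwards [h1 (mem_interior_iff_mem_nhds.1 ho)] with z hz
    have := hmem (show z + o ∈ K from hz) hoK
    simpa using this
  -- If the vector `p - q` of the difference body is also a normal of that body there, then `p` and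
  -- `q` are the ends of a double normal of `K`. This applies to a longest vector of `D` and to a
  -- shortest one in its boundary, so that `D` is the ball of radius 2.
  have key : ∀ p ∈ K, ∀ q ∈ K, p ≠ q → (∀ z ∈ D, inner ℝ (p - q) z ≤ ‖p - q‖ ^ 2) →
      ‖p - q‖ = 2 := by
    intro p hp q hq hpq hz
    have hpos : 0 < ‖p - q‖ := norm_pos_iff.2 (sub_ne_zero.2 hpq)
    refine h p hp q hq (‖p - q‖⁻¹ • (p - q)) ‖p - q‖ ?_ hpos ?_ ?_ ?_
    · rw [norm_smul, norm_inv, norm_norm, inv_mul_cancel₀ hpos.ne']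
    · rw [smul_smul, mul_inv_cancel₀ hpos.ne', one_smul]
    · intro x hx
      have h1 := hz _ (hmem hx hq)
      have h2 : inner ℝ (p - q) (x - p) = inner ℝ (p - q) (x - q) - ‖p - q‖ ^ 2 := by
        rw [← real_inner_self_eq_norm_sq, ← inner_sub_right]; congr 1; abel
      rw [inner_smul_left, h2]
      exact mul_nonpos_of_nonneg_of_nonpos (by simp) (by linarith)
    · intro x hx
      have h1 := hz _ (hmem hp hx)
      have h2 : inner ℝ (p - q) (x - q) = ‖p - q‖ ^ 2 - inner ℝ (p - q) (p - x) := by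
        rw [← real_inner_self_eq_norm_sq, ← inner_sub_right]; congr 1; abel
      rw [inner_neg_left, inner_smul_left, h2]
      simp only [conj_trivial, Left.neg_nonpos_iff]
      exact mul_nonneg (by simp) (by linarith)
  -- the longest vector of `D`
  have hfar : ∀ z ∈ D, ‖z‖ ≤ 2 := by
    obtain ⟨w, hw, hmax⟩ := hDc.exists_isMaxOn ⟨0, mem_of_mem_nhds h0⟩ continuous_norm.continuousOn
    obtain ⟨⟨p, q⟩, ⟨hp, hq⟩, rfl⟩ := hw
    have hpq : p ≠ q := by
      rintro rfl
      have h1 : D ⊆ {0} := by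
        intro z hz
        have : ‖z‖ ≤ ‖p - p‖ := hmax hz
        simpa using this
      have h2 : ({0} : Set E3) ∈ 𝓝 (0 : E3) := mem_of_superset h0 h1
      have := (isOpen_singleton_iff_nhds_eq_pure (0 : E3)).2 (le_antisymm
        (le_pure_iff.2 h2) (pure_le_nhds _))
      exact not_isOpen_singleton (0 : E3) this
    have h2 := key p hp q hq hpq fun z hz => by
      have h3 : ‖z‖ ≤ ‖p - q‖ := hmax hz
      have h4 := real_inner_le_norm (p - q) z
      nlinarith [norm_nonneg (p - q)]
    intro z hz
    have h3 : ‖z‖ ≤ ‖p - q‖ := hmax hz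
    linarith
  -- the shortest vector in the boundary of `D`
  have hball : ball (0 : E3) 2 ⊆ D := by
    have hDne : (Dᶜ).Nonempty := by
      obtain ⟨z, hz⟩ := NormedSpace.exists_lt_norm ℝ E3 2
      exact ⟨z, fun hzD => not_le.2 hz (hfar z hzD)⟩
    set r := infDist (0 : E3) Dᶜ with hr
    have hsub : ball (0 : E3) r ⊆ D := ball_infDist_compl_subset
    obtain ⟨w, hwc, hw⟩ := isClosed_closure.exists_infDist_eq_dist
      (closure_nonempty_iff.2 hDne) (0 : E3)
    rw [infDist_closure, ← hr, dist_zero_left] at hw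
    have hw0 : w ∉ interior D := by
      rwa [closure_compl] at hwc
    have hwne : w ≠ 0 := by
      rintro rfl
      exact hw0 (mem_interior_iff_mem_nhds.2 h0)
    have hrpos : 0 < r := by rw [hw]; exact norm_pos_iff.2 hwne
    have hcl : closedBall (0 : E3) r ⊆ D := by
      rw [← closure_ball _ hrpos.ne']
      exact closure_minimal hsub hDc.isClosed
    have hwD : w ∈ D := hcl (by simp [hw])
    obtain ⟨f, hf⟩ := geometric_hahn_banach_open_point hDconv.interior isOpen_interior hw0
    obtain ⟨v, hv⟩ := (InnerProductSpace.toDual ℝ E3).surjective f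
    have hfv : ∀ z, f z = inner ℝ v z := fun z => by
      rw [← hv]; rfl
    have hle : ∀ z ∈ D, inner ℝ v z ≤ inner ℝ v w := by
      intro z hz
      have h1 : z ∈ closure (interior D) := by
        rw [hDconv.closure_interior_eq_closure_of_nonempty_interior
          ⟨0, mem_interior_iff_mem_nhds.2 h0⟩]
        exact subset_closure hz
      have h2 : IsClosed {z : E3 | inner ℝ v z ≤ inner ℝ v w} :=
        isClosed_le (by fun_prop) continuous_const
      exact closure_minimal (fun y hy => by
        have := hf y hy
        rw [hfv, hfv] at this
        exact this.le) h2 h1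
    have hv0 : v ≠ 0 := by
      rintro rfl
      have := hf 0 (mem_interior_iff_mem_nhds.2 h0)
      simp [hfv] at this
    have hvpos : 0 < ‖v‖ := norm_pos_iff.2 hv0
    -- The ball of radius `r = ‖w‖` lies in `D`, so the supporting functional may be tested on its
    -- point in direction `v`. This gives equality in Cauchy–Schwarz, hence the supporting normal at
    -- `w` is parallel to `w`.
    have hin : inner ℝ v w = ‖v‖ * ‖w‖ := by
      apply le_antisymm (real_inner_le_norm v w)
      have h1 := hle ((r / ‖v‖) • v) (hcl (by
        rw [mem_closedBall_zero_iff, norm_smul, Real.norm_of_nonneg (by positivity),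
          div_mul_cancel₀ _ hvpos.ne']))
      rw [inner_smul_right, real_inner_self_eq_norm_sq, hw] at h1
      calc ‖v‖ * ‖w‖ = ‖w‖ / ‖v‖ * ‖v‖ ^ 2 := by field_simp
        _ ≤ _ := h1
    have hpar : ‖v‖ • w = ‖w‖ • v := (inner_eq_norm_mul_iff_real.1 hin).symm
    obtain ⟨⟨p, q⟩, ⟨hp, hq⟩, hpq⟩ := hwD
    simp only at hpq
    have h2 := key p hp q hq (by rintro rfl; simp at hpq; exact hwne hpq.symm) fun z hz => by
      rw [hpq]
      have h3 := hle z hz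
      rw [hin] at h3
      have h4 : ‖v‖ * inner ℝ w z = ‖w‖ * inner ℝ v z := by
        rw [← real_inner_smul_left, ← real_inner_smul_left, hpar]
      have h5 : ‖v‖ * inner ℝ w z ≤ ‖v‖ * ‖w‖ ^ 2 := by
        rw [h4]; nlinarith [norm_nonneg w]
      exact le_of_mul_le_mul_left h5 hvpos
    rw [hpq] at h2
    rw [hw, h2] at hsub
    exact hsub
  have hcb : closedBall (0 : E3) 2 ⊆ D := by
    rw [← closure_ball _ two_ne_zero]
    exact closure_minimal hball hDc.isClosed
  intro u hu
  obtain ⟨⟨p, q⟩, ⟨hp, hq⟩, hpq⟩ := hcb (show (2 : ℝ) • u ∈ closedBall (0 : E3) 2 by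
    simp [norm_smul, hu])
  simp only at hpq
  have hval : inner ℝ u p - inner ℝ u q = 2 := by
    rw [← inner_sub_right, hpq, inner_smul_right, real_inner_self_eq_norm_sq, hu]; norm_num
  have hdiff : ∀ x ∈ K, ∀ y ∈ K, inner ℝ u x - inner ℝ u y ≤ 2 := by
    intro x hx y hy
    rw [← inner_sub_right]
    have h1 := real_inner_le_norm u (x - y)
    have h2 := hfar _ (hmem hx hy)
    rw [hu] at h1; linarith
  have hmaxp : IsGreatest ((fun x => inner ℝ u x) '' K) (inner ℝ u p) :=
    ⟨⟨p, hp, rfl⟩, by rintro _ ⟨x, hx, rfl⟩; have := hdiff x hx q hq; simp only; linarith⟩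
  have hminq : IsLeast ((fun x => inner ℝ u x) '' K) (inner ℝ u q) :=
    ⟨⟨q, hq, rfl⟩, by rintro _ ⟨x, hx, rfl⟩; have := hdiff p hp x hx; simp only; linarith⟩
  rw [width, hmaxp.csSup_eq, hminq.csInf_eq, hval]


/-- The boundary of a convex body is a regular `C¹` surface away from a closed set off which the
supporting planes are unique. -/
theorem isRegularSurfaceAt_frontier {K V : Set E3} (hK : IsCompact K) (hconv : Convex ℝ K)
    (hnon : (interior K).Nonempty) (hV : IsClosed V)
    (huniq : ∀ p ∈ frontier K, p ∉ V → HasUniqueSupportPlane K p) {p : E3}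
    (hp : p ∈ frontier K) (hpV : p ∉ V) : IsRegularSurfaceAt (frontier K) p := by
  obtain ⟨o, ho⟩ := hnon
  set K₀ : Set E3 := Homeomorph.addLeft o ⁻¹' K with hK₀
  have hK₀c : Convex ℝ K₀ := hconv.translate_preimage_right o
  have hK₀n : K₀ ∈ 𝓝 (0 : E3) := by
    have h1 : Tendsto (Homeomorph.addLeft o) (𝓝 0) (𝓝 o) := by
      simpa using (Homeomorph.addLeft o).continuous.tendsto 0
    exact h1 (mem_interior_iff_mem_nhds.1 ho)
  have hK₀b : Bornology.IsVonNBounded ℝ K₀ := by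
    have : IsCompact K₀ := (Homeomorph.addLeft o).isCompact_preimage.2 hK
    exact this.isVonNBounded ℝ
  set g : E3 → ℝ := fun x => gauge K₀ (x - o) with hg
  have hgc : Continuous g := (continuous_gauge hK₀c hK₀n).comp (by fun_prop)
  have hgpos : ∀ {x}, x ≠ o → 0 < g x := fun hx =>
    (gauge_pos (absorbent_nhds_zero hK₀n) hK₀b).2 (sub_ne_zero.2 hx)
  have hfr : ∀ x, g x = 1 ↔ x ∈ frontier K := by
    intro x
    rw [hg, gauge_eq_one_iff_mem_frontier hK₀c hK₀n, hK₀, ← Homeomorph.preimage_frontier]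
    simp
  set π : E3 → E3 := fun x => o + (g x)⁻¹ • (x - o) with hπ
  have hgπ : ∀ {x}, x ≠ o → g (π x) = 1 := by
    intro x hx
    have h1 : π x - o = (g x)⁻¹ • (x - o) := by simp [hπ]
    change gauge K₀ (π x - o) = 1
    rw [h1, gauge_smul_of_nonneg (inv_nonneg.2 (hgpos hx).le), smul_eq_mul]
    exact inv_mul_cancel₀ (hgpos hx).ne'
  have hπc : ContinuousOn π {o}ᶜ := by
    apply continuousOn_const.add
    exact (hgc.continuousOn.inv₀ fun x hx => (hgpos hx).ne').smul (by fun_prop)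
  set U : Set E3 := {o}ᶜ ∩ π ⁻¹' Vᶜ with hU
  have hUo : IsOpen U := hπc.isOpen_inter_preimage isOpen_compl_singleton hV.isOpen_compl
  have hπfr : ∀ {x}, x ∈ U → π x ∈ frontier K := fun hx => (hfr _).1 (hgπ hx.1)
  have hex : ∀ x, ∃ u : E3, x ∈ U → ‖u‖ = 1 ∧ u ∈ normalCone K (π x) ∧
      ∀ u', ‖u'‖ = 1 → u' ∈ normalCone K (π x) → u' = u := by
    intro x
    by_cases hx : x ∈ U
    · obtain ⟨u, hu, huu⟩ := huniq _ (hπfr hx) hx.2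
      exact ⟨u, fun _ => ⟨hu.1, hu.2, fun u' h1 h2 => huu u' ⟨h1, h2⟩⟩⟩
    · exact ⟨0, fun h => absurd h hx⟩
  choose n hn using hex
  -- Limits of normals are normals. As the unit sphere is compact and the normal at the limit point
  -- is unique, the unit normal is continuous.
  have hnc : ∀ x ∈ U, Tendsto n (𝓝 x) (𝓝 (n x)) := by
    intro x hx
    have hUx : U ∈ 𝓝 x := hUo.mem_nhds hx
    refine (isCompact_sphere (0 : E3) 1).tendsto_nhds_of_unique_mapClusterPt ?_ ?_
    · filter_upwards [hUx] with y hy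
      simpa using (hn y hy).1
    · intro u hu hcl
      obtain ⟨F, hF, hlim⟩ := mapClusterPt_iff_ultrafilter.1 hcl
      refine (hn x hx).2.2 u (by simpa using hu) fun z hz => ?_
      have hπx : Tendsto π F (𝓝 (π x)) :=
        (hπc.continuousAt (isOpen_compl_singleton.mem_nhds hx.1)).tendsto.mono_left hF
      have h1 : Tendsto (fun y => inner ℝ (n y) (z - π y)) F (𝓝 (inner ℝ u (z - π x))) :=
        hlim.inner (tendsto_const_nhds.sub hπx)
      refine le_of_tendsto h1 ?_
      filter_upwards [hF hUx] with y hy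
      exact (hn y hy).2.1 z hz
  have hpos : ∀ x ∈ U, 0 < inner ℝ (n x) (π x - o) := by
    intro x hx
    have h1 : n x ∈ normalCone K (π x) := (hn x hx).2.1
    have h2 := h1 o (interior_subset ho)
    have h3 : inner ℝ (n x) (π x - o) = - inner ℝ (n x) (o - π x) := by
      rw [← inner_neg_right, neg_sub]
    rcases lt_or_eq_of_le h2 with h4 | h4
    · linarith
    -- Otherwise the supporting plane would pass through `o`, and `n x` would be a normal at an
    -- interior point.
    · exfalso
      refine notMem_interior_of_normal (u := n x) (p := o) (K := K) ?_ ?_ ho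
      · intro h5; have := (hn x hx).1; simp [h5] at this
      · intro z hz
        have h6 := h1 z hz
        have h7 : inner ℝ (n x) (z - o) = inner ℝ (n x) (z - π x) - inner ℝ (n x) (o - π x) := by
          rw [← inner_sub_right]; congr 1; abel
        rw [h7, h4]; linarith
  -- The normal, scaled to take the value 1 at the boundary point in the direction of `x`: a
  -- subgradient of the gauge, and its gradient once continuity is known.
  set ν : E3 → E3 := fun x => (inner ℝ (n x) (π x - o))⁻¹ • n x with hν
  have hνc : ∀ x ∈ U, Tendsto ν (𝓝 x) (𝓝 (ν x)) := by
    intro x hx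
    have hπx : Tendsto π (𝓝 x) (𝓝 (π x)) :=
      (hπc.continuousAt (isOpen_compl_singleton.mem_nhds hx.1)).tendsto
    exact (((hnc x hx).inner (hπx.sub tendsto_const_nhds)).inv₀ (hpos x hx).ne').smul (hnc x hx)
  have hνle : ∀ x ∈ U, ∀ y, inner ℝ (ν x) (y - o) ≤ g y := by
    intro x hx y
    rcases eq_or_ne y o with rfl | hy
    · simpa using gauge_nonneg _
    · have h1 : π y ∈ K := hK.isClosed.frontier_subset ((hfr _).1 (hgπ hy))
      have h2 := (hn x hx).2.1 _ h1
      have h3 : inner ℝ (n x) (π y - o) ≤ inner ℝ (n x) (π x - o) := by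
        have : inner ℝ (n x) (π y - π x) = inner ℝ (n x) (π y - o) - inner ℝ (n x) (π x - o) := by
          rw [← inner_sub_right]; congr 1; abel
        linarith
      have h4 : π y - o = (g y)⁻¹ • (y - o) := by simp [hπ]
      have h5 : y - o = g y • (π y - o) := by
        rw [h4, smul_smul, mul_inv_cancel₀ (hgpos hy).ne', one_smul]
      rw [h5, inner_smul_right, hν, inner_smul_left]
      simp only [conj_trivial]
      have h6 : (inner ℝ (n x) (π x - o))⁻¹ * inner ℝ (n x) (π y - o) ≤ 1 := by
        rw [inv_mul_le_iff₀ (hpos x hx)]; linarith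
      nlinarith [hgpos hy]
  have hνeq : ∀ x ∈ U, inner ℝ (ν x) (x - o) = g x := by
    intro x hx
    have h4 : π x - o = (g x)⁻¹ • (x - o) := by simp [hπ]
    have h5 : x - o = g x • (π x - o) := by
      rw [h4, smul_smul, mul_inv_cancel₀ (hgpos hx.1).ne', one_smul]
    rw [h5, inner_smul_right, hν, inner_smul_left]
    simp only [conj_trivial]
    rw [inv_mul_cancel₀ (hpos x hx).ne', mul_one]
  -- The subgradient inequalities at `x` and at `y` squeeze g y - g x between the values of ν x and
  -- ν y on y - x, and `ν` is continuous.
  have hderiv : ∀ x ∈ U, HasFDerivAt (fun y => g y - 1) (innerSL ℝ (ν x)) x := by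
    intro x hx
    rw [hasFDerivAt_iff_isLittleO, Asymptotics.isLittleO_iff]
    intro ε hε
    have h1 : ∀ᶠ y in 𝓝 x, ‖ν y - ν x‖ < ε := by
      have := (hνc x hx).eventually (ball_mem_nhds (ν x) hε)
      filter_upwards [this] with y hy
      rwa [← dist_eq_norm]
    filter_upwards [h1, hUo.mem_nhds hx] with y hy hyU
    have e1 := hνle x hx y
    have e2 := hνle y hyU x
    have e3 := hνeq x hx
    have e4 := hνeq y hyU
    have e5 : inner ℝ (ν x) (y - x) = inner ℝ (ν x) (y - o) - inner ℝ (ν x) (x - o) := by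
      rw [← inner_sub_right]; congr 1; abel
    have e6 : inner ℝ (ν y - ν x) (y - x) = inner ℝ (ν y) (y - o) - inner ℝ (ν y) (x - o)
        - inner ℝ (ν x) (y - x) := by
      simp only [inner_sub_left, inner_sub_right]; ring
    have e7 := real_inner_le_norm (ν y - ν x) (y - x)
    have e8 : ‖ν y - ν x‖ * ‖y - x‖ ≤ ε * ‖y - x‖ :=
      mul_le_mul_of_nonneg_right hy.le (norm_nonneg _)
    rw [innerSL_apply_apply, Real.norm_eq_abs, abs_le]
    constructor
    · have : 0 ≤ ε * ‖y - x‖ := by positivity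
      linarith
    · linarith
  refine ⟨U, fun y => g y - 1, hUo, ⟨?_, ?_⟩, ?_, ?_, ?_⟩
  · rintro rfl
    exact hp.2 ho
  · have h1 : g p = 1 := (hfr p).2 hp
    have : π p = p := by simp [hπ, h1]
    simpa [this] using hpV
  · have h1 : ContDiffOn ℝ (0 + 1) (fun y => g y - 1) U := by
      rw [contDiffOn_succ_iff_fderiv_of_isOpen hUo]
      refine ⟨fun x hx => (hderiv x hx).differentiableAt.differentiableWithinAt, by simp, ?_⟩
      rw [contDiffOn_zero]
      have h2 : ContinuousOn (fun x => innerSL ℝ (ν x)) U := fun x hx =>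
        (((innerSL ℝ).continuous.tendsto _).comp (hνc x hx)).mono_left nhdsWithin_le_nhds
      exact h2.congr fun x hx => (hderiv x hx).fderiv
    simpa using h1
  · intro x hx h0
    rw [(hderiv x hx).fderiv] at h0
    have h1 : (innerSL ℝ (ν x)) (x - o) = 0 := by rw [h0]; rfl
    rw [innerSL_apply_apply, hνeq x hx] at h1
    exact (hgpos hx.1).ne' h1
  · ext x
    simp only [mem_inter_iff, mem_ofPred_eq, sub_eq_zero, hfr]
    exact and_comm

end ConvexGeometry

/-! ### Barycentric coordinates of a regular tetrahedron. -/

section Coordinates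

/-- The vertices of a regular tetrahedron of side `2`. -/
def Regular (v : Fin 4 → E3) : Prop := ∀ i j, i ≠ j → dist (v i) (v j) = 2

/-- `i, j, l, m` are the four indices, in some order. -/
def Quad (i j l m : Fin 4) : Prop := i ≠ j ∧ i ≠ l ∧ i ≠ m ∧ j ≠ l ∧ j ≠ m ∧ l ≠ m

instance (i j l m : Fin 4) : Decidable (Quad i j l m) := by unfold Quad; infer_instance

lemma Quad.swap {i j l m : Fin 4} (h : Quad i j l m) : Quad j i l m := by
  unfold Quad at *; tauto

lemma Quad.opp {i j l m : Fin 4} (h : Quad i j l m) : Quad l m i j := by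
  unfold Quad at *; tauto

lemma Quad.swap' {i j l m : Fin 4} (h : Quad i j l m) : Quad i j m l := by
  unfold Quad at *; tauto

lemma Quad.sum {i j l m : Fin 4} (h : Quad i j l m) {M : Type*} [AddCommMonoid M]
    (f : Fin 4 → M) : ∑ x, f x = f i + f j + f l + f m := by
  have h1 : ∀ i j l m : Fin 4, Quad i j l m → (Finset.univ : Finset (Fin 4)) = {i, j, l, m} := by
    decide
  obtain ⟨a, b, c, d, e, g⟩ := id h
  rw [h1 i j l m h, Finset.sum_insert (by simp [a, b, c]), Finset.sum_insert (by simp [d, e]),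
    Finset.sum_insert (by simp [g]), Finset.sum_singleton, ← add_assoc, ← add_assoc]

lemma Quad.cases {i j l m : Fin 4} (h : Quad i j l m) (t : Fin 4) :
    t = i ∨ t = j ∨ t = l ∨ t = m := by
  revert i j l m t; decide

lemma exists_quad {i j : Fin 4} (h : i ≠ j) : ∃ l m, Quad i j l m := by
  revert i j; decide

/-- The centroid. -/
def centroid4 (v : Fin 4 → E3) : E3 := (1 / 4 : ℝ) • ∑ i, v i

/-- The barycentric coordinates with respect to a regular tetrahedron of side `2`. -/
def bary (v : Fin 4 → E3) (i : Fin 4) (z : E3) : ℝ :=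
  1 / 4 + inner ℝ (z - centroid4 v) (v i - centroid4 v) / 2

lemma continuous_bary (v : Fin 4 → E3) (i : Fin 4) : Continuous (bary v i) := by
  unfold bary; fun_prop

variable {v : Fin 4 → E3}

lemma sum_sub_centroid (v : Fin 4 → E3) : ∑ i, (v i - centroid4 v) = 0 := by
  rw [Finset.sum_sub_distrib, Finset.sum_const, Finset.card_univ, Fintype.card_fin, centroid4,
    ← Nat.cast_smul_eq_nsmul ℝ, smul_smul]
  norm_num

/-- The six squared edge lengths and the vanishing of the sum of the four vectors give ten linear
equations, which determine the ten entries of the Gram matrix. -/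
lemma Regular.inner_sub_centroid (hv : Regular v) (i j : Fin 4) :
    inner ℝ (v i - centroid4 v) (v j - centroid4 v) = if i = j then (3 / 2 : ℝ) else -1 / 2 := by
  set u : Fin 4 → E3 := fun i => v i - centroid4 v with hu
  have hs : ∑ i, u i = 0 := sum_sub_centroid v
  have h1 : ∀ i j, i ≠ j → inner ℝ (u i) (u i) + inner ℝ (u j) (u j) - 2 * inner ℝ (u i) (u j)
      = (4 : ℝ) := by
    intro i j hij
    have h2 : u i - u j = v i - v j := by simp [hu]
    have h3 : ‖u i - u j‖ ^ 2 = 4 := by rw [h2, ← dist_eq_norm, hv i j hij]; norm_num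
    rw [norm_sub_sq_real] at h3
    simp only [real_inner_self_eq_norm_sq]
    linarith
  have h2 : ∀ i, inner ℝ (u i) (u 0) + inner ℝ (u i) (u 1) + inner ℝ (u i) (u 2)
      + inner ℝ (u i) (u 3) = (0 : ℝ) := by
    intro i
    rw [← inner_add_right, ← inner_add_right, ← inner_add_right, ← Fin.sum_univ_four, hs,
      inner_zero_right]
  have c1 := real_inner_comm (u 0) (u 1)
  have c2 := real_inner_comm (u 0) (u 2)
  have c3 := real_inner_comm (u 0) (u 3)
  have c4 := real_inner_comm (u 1) (u 2)
  have c5 := real_inner_comm (u 1) (u 3)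
  have c6 := real_inner_comm (u 2) (u 3)
  have e1 := h1 0 1 (by decide)
  have e2 := h1 0 2 (by decide)
  have e3 := h1 0 3 (by decide)
  have e4 := h1 1 2 (by decide)
  have e5 := h1 1 3 (by decide)
  have e6 := h1 2 3 (by decide)
  have f0 := h2 0
  have f1 := h2 1
  have f2 := h2 2
  have f3 := h2 3
  simp only [real_inner_self_eq_norm_sq] at e1 e2 e3 e4 e5 e6 f0 f1 f2 f3
  change inner ℝ (u i) (u j) = _
  fin_cases i <;> fin_cases j <;> simp <;> linarith

/-- The four vectors from the centroid form a tight frame. Three of them are a basis, and in it the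
identity is read off the Gram matrix. -/
lemma Regular.norm_sq_eq (hv : Regular v) (u : E3) :
    ‖u‖ ^ 2 = (∑ i, inner ℝ u (v i - centroid4 v) ^ 2) / 2 := by
  set w : Fin 4 → E3 := fun i => v i - centroid4 v with hw
  have hs : ∑ i, w i = 0 := sum_sub_centroid v
  have hg : ∀ i j, inner ℝ (w i) (w j) = if i = j then (3 / 2 : ℝ) else -1 / 2 :=
    hv.inner_sub_centroid
  have hli : LinearIndependent ℝ (fun i : Fin 3 => w i.castSucc) := by
    rw [Fintype.linearIndependent_iff]
    intro c hc
    have h1 : ∀ j, inner ℝ (∑ i : Fin 3, c i • w i.castSucc) (w j) = (0 : ℝ) := by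
      intro j; rw [hc, inner_zero_left]
    have e0 := h1 0
    have e1 := h1 1
    have e2 := h1 2
    simp only [Fin.sum_univ_three, inner_add_left, inner_smul_left, hg] at e0 e1 e2
    simp [Fin.ext_iff] at e0 e1 e2
    intro i
    fin_cases i <;> simp <;> linarith
  let B := basisOfLinearIndependentOfCardEqFinrank hli (by simp)
  have hB : u = ∑ i : Fin 3, B.repr u i • w i.castSucc := by
    have := B.sum_repr u
    simpa [B] using this.symm
  set c := B.repr u
  rw [← real_inner_self_eq_norm_sq, hB]
  change _ = (∑ i, inner ℝ _ (w i) ^ 2) / 2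
  simp only [Fin.sum_univ_three, Fin.sum_univ_four, inner_add_left, inner_add_right,
    inner_smul_left, inner_smul_right, hg]
  simp [Fin.ext_iff]
  ring

lemma Regular.inner_eq (hv : Regular v) (u w : E3) :
    inner ℝ u w = (∑ i, inner ℝ u (v i - centroid4 v) * inner ℝ w (v i - centroid4 v)) / 2 := by
  have h1 := hv.norm_sq_eq (u + w)
  rw [norm_add_sq_real, hv.norm_sq_eq u, hv.norm_sq_eq w] at h1
  simp only [Fin.sum_univ_four, inner_add_left] at h1 ⊢
  linarith

lemma sum_bary (v : Fin 4 → E3) (z : E3) : ∑ i, bary v i z = 1 := by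
  simp only [bary, Finset.sum_add_distrib, ← Finset.sum_div, ← inner_sum, sum_sub_centroid]
  simp

lemma bary_sub (i : Fin 4) (z w : E3) :
    bary v i z - bary v i w = inner ℝ (z - w) (v i - centroid4 v) / 2 := by
  simp only [bary, inner_sub_left]; ring

lemma bary_add_smul_sub (i : Fin 4) (z x y : E3) (t : ℝ) :
    bary v i (z + t • (x - y)) = bary v i z + t * (bary v i x - bary v i y) := by
  have h := bary_sub (v := v) i (z + t • (x - y)) z
  rw [add_sub_cancel_left, inner_smul_left, conj_trivial] at h
  rw [bary_sub]; linarith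

lemma Regular.dist_sq (hv : Regular v) (z w : E3) :
    dist z w ^ 2 = 2 * ∑ i, (bary v i z - bary v i w) ^ 2 := by
  rw [dist_eq_norm, hv.norm_sq_eq]
  simp only [bary_sub, div_pow, ← Finset.sum_div]
  ring

lemma Regular.dist_sq_quad (hv : Regular v) {i j l m : Fin 4} (h : Quad i j l m) (z w : E3) :
    dist z w ^ 2 = 2 * ((bary v i z - bary v i w) ^ 2 + (bary v j z - bary v j w) ^ 2 +
      (bary v l z - bary v l w) ^ 2 + (bary v m z - bary v m w) ^ 2) := by
  rw [hv.dist_sq, h.sum]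

lemma sum_bary_quad {i j l m : Fin 4} (h : Quad i j l m) (z : E3) :
    bary v i z + bary v j z + bary v l z + bary v m z = 1 := by
  rw [← h.sum (fun i => bary v i z), sum_bary]

lemma Regular.bary_ext (hv : Regular v) {z w : E3} (h : ∀ i, bary v i z = bary v i w) : z = w := by
  have := hv.dist_sq z w
  simp only [h, sub_self] at this
  simpa using this

lemma Regular.bary_vertex (hv : Regular v) (i j : Fin 4) :
    bary v i (v j) = if i = j then 1 else 0 := by
  rw [bary, real_inner_comm, hv.inner_sub_centroid]
  split_ifs <;> norm_num

/-- The point with given barycentric coordinates. -/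
def comb (v : Fin 4 → E3) (β : Fin 4 → ℝ) : E3 := ∑ i, β i • v i

lemma Regular.bary_comb (hv : Regular v) {β : Fin 4 → ℝ} (hβ : ∑ i, β i = 1) (i : Fin 4) :
    bary v i (comb v β) = β i := by
  have h1 : comb v β - centroid4 v = ∑ j, β j • (v j - centroid4 v) := by
    simp only [comb, smul_sub, Finset.sum_sub_distrib, ← Finset.sum_smul, hβ, one_smul]
  rw [bary, h1, sum_inner]
  simp only [inner_smul_left, hv.inner_sub_centroid, conj_trivial]
  have h2 : ∀ x, β x * (if x = i then (3 / 2 : ℝ) else -1 / 2)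
      = (-1 / 2) * β x + 2 * (if x = i then β x else 0) := by
    intro x; split_ifs <;> ring
  simp only [h2, Finset.sum_add_distrib, ← Finset.mul_sum, hβ, Finset.sum_ite_eq',
    Finset.mem_univ, if_true]
  ring

lemma Regular.bary_comb_quad (hv : Regular v) {i j l m : Fin 4} (h : Quad i j l m)
    {p q r t : ℝ} (hs : p + q + r + t = 1) :
    bary v i (p • v i + q • v j + r • v l + t • v m) = p ∧
    bary v j (p • v i + q • v j + r • v l + t • v m) = q ∧
    bary v l (p • v i + q • v j + r • v l + t • v m) = r ∧
    bary v m (p • v i + q • v j + r • v l + t • v m) = t := by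
  obtain ⟨a, b, c, d, e, g⟩ := id h
  set β : Fin 4 → ℝ := fun x => if x = i then p else if x = j then q else if x = l then r else t
    with hβd
  have b1 : β i = p := by simp [hβd]
  have b2 : β j = q := by simp [hβd, a.symm]
  have b3 : β l = r := by simp [hβd, b.symm, d.symm]
  have b4 : β m = t := by simp [hβd, c.symm, e.symm, g.symm]
  have hβ : ∑ x, β x = 1 := by rw [h.sum, b1, b2, b3, b4, hs]
  have hc : comb v β = p • v i + q • v j + r • v l + t • v m := by
    rw [comb, h.sum (fun x => β x • v x), b1, b2, b3, b4]
  rw [← hc]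
  simp only [hv.bary_comb hβ, b1, b2, b3, b4, and_self]

/-- `Σ αᵢ² - 1` in barycentric coordinates. -/
def quadForm (v : Fin 4 → E3) (z : E3) : ℝ := ∑ i, bary v i z ^ 2 - 1

lemma quadForm_quad {i j l m : Fin 4} (h : Quad i j l m) (z : E3) :
    quadForm v z = bary v i z ^ 2 + bary v j z ^ 2 + bary v l z ^ 2 + bary v m z ^ 2 - 1 := by
  rw [quadForm, h.sum (fun i => bary v i z ^ 2)]

lemma Regular.dist_vertex_sq (hv : Regular v) (z : E3) (i : Fin 4) :
    dist z (v i) ^ 2 = 2 * quadForm v z - 4 * bary v i z + 4 := by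
  obtain ⟨j, hj⟩ : ∃ j, i ≠ j := by revert i; decide
  obtain ⟨l, m, h⟩ := exists_quad hj
  obtain ⟨a, b, c, -⟩ := id h
  rw [hv.dist_sq_quad h, quadForm_quad h]
  simp only [hv.bary_vertex, a.symm, b.symm, c.symm, if_true, if_false]
  ring

lemma Regular.dist_vertex_le (hv : Regular v) (z : E3) (i : Fin 4) :
    dist z (v i) ≤ 2 ↔ quadForm v z ≤ 2 * bary v i z := by
  rw [← abs_of_nonneg (dist_nonneg (x := z) (y := v i)), ← abs_two (α := ℝ), ← sq_le_sq,
    hv.dist_vertex_sq, abs_two]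
  constructor <;> intro h <;> linarith

lemma Regular.dist_vertex_eq (hv : Regular v) (z : E3) (i : Fin 4) :
    dist z (v i) = 2 ↔ quadForm v z = 2 * bary v i z := by
  rw [← sq_eq_sq₀ dist_nonneg zero_le_two, hv.dist_vertex_sq]
  constructor <;> intro h <;> linarith

/-- A point of the Reuleaux tetrahedron beyond three of the faces is a vertex. -/
lemma Regular.eq_vertex_of_three_nonpos (hv : Regular v) {i j l m : Fin 4} (h : Quad i j l m)
    {z : E3} (hT : ∀ t, quadForm v z ≤ 2 * bary v t z) (hi : bary v i z ≤ 0)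
    (hj : bary v j z ≤ 0) (hl : bary v l z ≤ 0) : z = v m := by
  have hs := sum_bary_quad (v := v) h z
  have hq := quadForm_quad (v := v) h z
  have h1 : (1 : ℝ) ≤ bary v m z := by linarith
  have h2 : 0 ≤ quadForm v z := by
    rw [hq]; nlinarith [sq_nonneg (bary v i z), sq_nonneg (bary v j z), sq_nonneg (bary v l z)]
  have ei := hT i
  have ej := hT j
  have el := hT l
  obtain ⟨a, b, c, d, e, g⟩ := id h
  apply hv.bary_ext
  intro t
  rw [hv.bary_vertex]
  rcases h.cases t with rfl | rfl | rfl | rfl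
  · rw [if_neg c]; linarith
  · rw [if_neg e]; linarith
  · rw [if_neg g]; linarith
  · rw [if_pos rfl]; linarith

end Coordinates

/-! ### The normalized arc: convexity, tangents, and the strongest constraint. -/

section ArcAlgebra

/-- The arc of pea centres in normalized coordinates: `ξ` along the beam, `s` along the axis;
the pea has radius `k * s`. -/
def OnArc (k ξ s : ℝ) : Prop := 0 ≤ s ∧ k * s ≤ 2 ∧ ξ ^ 2 + 3 + 8 * s + 8 * s ^ 2 = (2 - k * s) ^ 2

/-- Half of the difference of the squares of the two sides of the constraint imposed by the pea
`(ξ, s)` on a point with barycentric coordinates `x, y` at the ends of the beam. -/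
def gap (Q x y ξ s : ℝ) : ℝ := Q - (1 + 4 * s) * (x + y) - ξ * (x - y)

lemma onArc_one (k : ℝ) : OnArc k 1 0 := by
  refine ⟨le_rfl, by simp, by norm_num⟩

lemma onArc_neg {k ξ s : ℝ} (h : OnArc k ξ s) : OnArc k (-ξ) s := by
  refine ⟨h.1, h.2.1, by rw [← h.2.2]; ring⟩

lemma gap_neg (Q x y ξ s : ℝ) : gap Q x y (-ξ) s = gap Q y x ξ s := by
  unfold gap; ring

/-- From 0 ≤ k * s ≤ 2 comes (k * s)² ≤ 2 * (k * s), which turns the arc equation into a linear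
bound. In particular all radii k * s are at most 1/2. -/
lemma OnArc.eight_mul_le {k ξ s : ℝ} (hk : 0 < k) (h : OnArc k ξ s) : 8 * s + 2 * (k * s) ≤ 1 := by
  obtain ⟨h0, h1, h2⟩ := h
  have h3 : 0 ≤ k * s := by positivity
  nlinarith [sq_nonneg ξ, sq_nonneg s, mul_nonneg h3 (sub_nonneg.2 h1)]

/-- The two lines bounding this region are the tangents of the arc at its ends ξ = ±1, and a convex
arc stays on one side of them. The slope 4 + 2 * k is the source of the factor 2 + k in the
definition of the wedge. -/
lemma OnArc.abs_le {k ξ s : ℝ} (hk : 0 < k) (h : OnArc k ξ s) : |ξ| ≤ 1 - (4 + 2 * k) * s := by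
  have h1 := h.eight_mul_le hk
  have h0 := h.1
  apply abs_le_of_sq_le_sq _ (by nlinarith)
  nlinarith [h.2.2, sq_nonneg s, mul_nonneg hk.le (sq_nonneg s), sq_nonneg (k * s)]

lemma OnArc.abs_lt {k ξ s : ℝ} (hk : 0 < k) (h : OnArc k ξ s) (hs : 0 < s) :
    |ξ| < 1 - (4 + 2 * k) * s := by
  have h1 := h.eight_mul_le hk
  have h0 := h.1
  apply abs_lt_of_sq_lt_sq _ (by nlinarith)
  nlinarith [h.2.2, pow_pos hs 2, mul_nonneg hk.le (sq_nonneg s), sq_nonneg (k * s)]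

lemma OnArc.abs_le_one {k ξ s : ℝ} (hk : 0 < k) (h : OnArc k ξ s) : |ξ| ≤ 1 := by
  have h1 := h.abs_le hk
  have : 0 ≤ (4 + 2 * k) * s := mul_nonneg (by linarith) h.1
  linarith

lemma OnArc.eq_one_or {k ξ : ℝ} (h : OnArc k ξ 0) : ξ = 1 ∨ ξ = -1 := by
  have := h.2.2
  have h1 : (ξ - 1) * (ξ + 1) = 0 := by nlinarith
  rcases mul_eq_zero.1 h1 with h2 | h2
  · left; linarith
  · right; linarith

/-- Outside the wedge, the constraints of the arc follow from those at its ends. -/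
lemma gap_nonpos {k ξ s Q x y : ℝ} (hk : 0 < k) (h : OnArc k ξ s) (hx : Q ≤ 2 * x)
    (hy : Q ≤ 2 * y) (hw : -(2 * (x + y)) ≤ (2 + k) * |x - y|) : gap Q x y ξ s ≤ 0 := by
  have h1 := h.abs_le hk
  have h2 : Q ≤ x + y - |x - y| := by
    rcases abs_cases (x - y) with ⟨h, _⟩ | ⟨h, _⟩ <;> linarith
  have h3 : -(ξ * (x - y)) ≤ |ξ| * |x - y| := by rw [← abs_mul]; exact neg_le_abs _
  have h4 : |ξ| * |x - y| ≤ (1 - (4 + 2 * k) * s) * |x - y| :=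
    mul_le_mul_of_nonneg_right h1 (abs_nonneg _)
  have h5 : -(2 * (x + y)) * s ≤ (2 + k) * |x - y| * s := mul_le_mul_of_nonneg_right hw h.1
  unfold gap
  nlinarith

/-- An active inner point of the arc forces a point into the wedge. -/
lemma wedge_of_gap_eq_zero {k ξ s Q x y : ℝ} (hk : 0 < k) (h : OnArc k ξ s) (hs : 0 < s)
    (hx : Q ≤ 2 * x) (hy : Q ≤ 2 * y) (hg : gap Q x y ξ s = 0) :
    (2 + k) * |x - y| < -(2 * (x + y)) ∨ (x = 0 ∧ y = 0) := by
  by_contra! hcon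
  obtain ⟨hw, hne⟩ := hcon
  have h1 := h.abs_lt hk hs
  have h2 : Q ≤ x + y - |x - y| := by
    rcases abs_cases (x - y) with ⟨h, _⟩ | ⟨h, _⟩ <;> linarith
  have h3 : -(ξ * (x - y)) ≤ |ξ| * |x - y| := by rw [← abs_mul]; exact neg_le_abs _
  have h5 : -(2 * (x + y)) * s ≤ (2 + k) * |x - y| * s := mul_le_mul_of_nonneg_right hw h.1
  unfold gap at hg
  rcases eq_or_ne x y with rfl | hxy
  · simp only [sub_self, abs_zero, mul_zero] at h2 h3 hw h5 hg
    have : x * s ≤ 0 := by nlinarith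
    have h6 : x ≤ 0 := by nlinarith
    have : x = 0 := by linarith
    exact hne this this
  · have h4 : |ξ| * |x - y| < (1 - (4 + 2 * k) * s) * |x - y| :=
      mul_lt_mul_of_pos_right h1 (abs_pos.2 (sub_ne_zero.2 hxy))
    nlinarith

/-- From a point inside the convex region bounded by the arc one reaches the arc along the axis. -/
lemma exists_onArc_ge {k ξ s : ℝ} (hk : 0 < k) (h0 : 0 ≤ s) (h1 : k * s ≤ 2)
    (h2 : ξ ^ 2 + 3 + 8 * s + 8 * s ^ 2 ≤ (2 - k * s) ^ 2) : ∃ s', s ≤ s' ∧ OnArc k ξ s' := by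
  have hs : s ≤ 2 / k := by rw [le_div_iff₀ hk]; linarith
  -- At the height 2 / k the right-hand side of the arc equation vanishes while the left-hand side
  -- is positive, so the intermediate value theorem applies.
  have hcont : ContinuousOn (fun t : ℝ => (2 - k * t) ^ 2 - (ξ ^ 2 + 3 + 8 * t + 8 * t ^ 2))
      (Icc s (2 / k)) := by fun_prop
  have hk2 : k * (2 / k) = 2 := by field_simp
  have hpos : 0 < 2 / k := by positivity
  obtain ⟨t, ht, ht0⟩ := intermediate_value_Icc' hs hcont
    (show (0 : ℝ) ∈ _ from ⟨by
      rw [hk2]; nlinarith [sq_nonneg ξ, sq_nonneg (2 / k)], by linarith⟩)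
  simp only at ht0
  refine ⟨t, ht.1, h0.trans ht.1, ?_, by linarith⟩
  calc k * t ≤ k * (2 / k) := mul_le_mul_of_nonneg_left ht.2 hk.le
    _ = 2 := hk2

lemma exists_onArc_axis {k : ℝ} (hk : 0 < k) : ∃ s, 0 < s ∧ OnArc k 0 s := by
  obtain ⟨s, hs, h⟩ := exists_onArc_ge (k := k) (ξ := 0) (s := 0) hk le_rfl (by simp) (by norm_num)
  refine ⟨s, lt_of_le_of_ne hs ?_, h⟩
  rintro rfl
  have := h.2.2
  norm_num at this

/-- The arc is strictly convex. -/
lemma onArc_midpoint_lt {k ξ s ξ' s' : ℝ} (h : OnArc k ξ s) (h' : OnArc k ξ' s')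
    (hne : ξ ≠ ξ' ∨ s ≠ s') :
    ((ξ + ξ') / 2) ^ 2 + 3 + 8 * ((s + s') / 2) + 8 * ((s + s') / 2) ^ 2
      < (2 - k * ((s + s') / 2)) ^ 2 := by
  obtain ⟨h0, h1, h2⟩ := h
  obtain ⟨h0', h1', h2'⟩ := h'
  set N := 2 - k * s with hN
  set N' := 2 - k * s' with hN'
  have hN0 : 0 ≤ N := by linarith
  have hN0' : 0 ≤ N' := by linarith
  have hpos : 0 < (ξ - ξ') ^ 2 + 8 * (s - s') ^ 2 := by
    rcases hne with h | h
    · have := sq_pos_of_ne_zero (sub_ne_zero.2 h)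
      positivity
    · have := sq_pos_of_ne_zero (sub_ne_zero.2 h)
      positivity
  -- The arc equation says that N = 2 - k * s is the length of the vector (ξ, 1, √2 (1 + 2s)), and
  -- `d` is the scalar product of two such vectors. Cauchy–Schwarz is strict, since by Lagrange's
  -- identity the defect is at least (ξ - ξ')² + 8 (s - s')².
  set d := ξ * ξ' + 1 + 2 * ((1 + 2 * s) * (1 + 2 * s')) with hd
  have hlt : d < N * N' := by
    have hsq : d ^ 2 < (N * N') ^ 2 := by
      have : (N * N') ^ 2 = (ξ ^ 2 + 1 + 2 * (1 + 2 * s) ^ 2) * (ξ' ^ 2 + 1 + 2 * (1 + 2 * s') ^ 2) := by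
        rw [mul_pow, ← h2, ← h2']; ring
      rw [this, hd]
      nlinarith [sq_nonneg (ξ * (1 + 2 * s') - ξ' * (1 + 2 * s))]
    exact lt_of_pow_lt_pow_left₀ 2 (by positivity) hsq
  have e1 : 2 - k * ((s + s') / 2) = (N + N') / 2 := by rw [hN, hN']; ring
  rw [e1]
  nlinarith

/-- In the wedge, at most one point of the arc is active. -/
lemma gap_zero_unique {k ξ s ξ' s' Q x y : ℝ} (hk : 0 < k) (h : OnArc k ξ s) (h' : OnArc k ξ' s')
    (hxy : x + y < 0) (hall : ∀ ξ s, OnArc k ξ s → gap Q x y ξ s ≤ 0)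
    (hg : gap Q x y ξ s = 0) (hg' : gap Q x y ξ' s' = 0) : ξ = ξ' ∧ s = s' := by
  by_contra hcon
  have hne : ξ ≠ ξ' ∨ s ≠ s' := by
    by_contra! h1; exact hcon h1
  have hm := onArc_midpoint_lt h h' hne
  -- The gap is affine, so it vanishes at the midpoint, which is strictly inside the arc. Since x +
  -- y < 0 it increases with the height, so the point of the arc above the midpoint would violate
  -- its constraint.
  obtain ⟨t, ht, hta⟩ := exists_onArc_ge (ξ := (ξ + ξ') / 2) (s := (s + s') / 2) hk
    (by linarith [h.1, h'.1]) (by linarith [h.2.1, h'.2.1]) hm.le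
  have hlt : (s + s') / 2 < t := by
    refine lt_of_le_of_ne ht ?_
    rintro rfl
    exact hm.ne hta.2.2
  have := hall _ _ hta
  unfold gap at *
  nlinarith

/-- Strictly inside the wedge the end of the arc is not the strongest constraint. -/
lemma exists_gap_pos_of_wedge {k Q x y : ℝ} (hk : 0 < k) (hx : Q = 2 * x) (hxy : x ≤ y)
    (hw : (2 + k) * |x - y| < -(2 * (x + y))) : ∃ ξ s, OnArc k ξ s ∧ 0 < gap Q x y ξ s := by
  rw [abs_of_nonpos (by linarith)] at hw
  set z := y - x with hz
  have hz0 : 0 ≤ z := by linarith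
  set M := 4 + 2 * k with hM
  set δ := -(4 * (x + y)) - M * z with hδ
  have hδ0 : 0 < δ := by rw [hδ, hM]; linarith
  have hM0 : 4 < M := by linarith
  -- Near the end ξ = 1 the arc is ξ = 1 - M s up to an error of at most 2 (M s)², valid for M s ≤
  -- 1/8. The second bound makes the first-order gain δ s of the gap exceed the error 2 M² z s².
  obtain ⟨s, hs0, hs1, hs2⟩ : ∃ s : ℝ, 0 < s ∧ M * s ≤ 1 / 8 ∧ 2 * M ^ 2 * z * s < δ := by
    refine ⟨min (1 / (8 * M)) (δ / (2 * (2 * M ^ 2 * z + 1))), by positivity, ?_, ?_⟩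
    · calc M * _ ≤ M * (1 / (8 * M)) := mul_le_mul_of_nonneg_left (min_le_left _ _) (by linarith)
        _ = 1 / 8 := by field_simp
    · have hp : 0 ≤ 2 * M ^ 2 * z := by positivity
      calc 2 * M ^ 2 * z * _ ≤ 2 * M ^ 2 * z * (δ / (2 * (2 * M ^ 2 * z + 1))) :=
            mul_le_mul_of_nonneg_left (min_le_right _ _) hp
        _ < δ := by
          rw [mul_div_assoc', div_lt_iff₀ (by positivity)]
          nlinarith [mul_nonneg hp hδ0.le]
  set q := (2 - k * s) ^ 2 - (3 + 8 * s + 8 * s ^ 2) with hq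
  have hb : 0 ≤ 1 - M * s - 2 * (M * s) ^ 2 := by
    have : 0 ≤ M * s := by positivity
    nlinarith
  have hqb : (1 - M * s - 2 * (M * s) ^ 2) ^ 2 ≤ q := by
    have e1 : q = 1 - 2 * (M * s) + (k * s) ^ 2 - 8 * s ^ 2 := by rw [hq, hM]; ring
    have e2 : 16 * s ^ 2 ≤ (M * s) ^ 2 := by
      rw [mul_pow]; exact mul_le_mul_of_nonneg_right (by nlinarith) (sq_nonneg s)
    have e3 : 0 ≤ M * s := by positivity
    rw [e1]
    have e4 : (M * s) ^ 3 ≤ (M * s) ^ 2 * (1 / 8) := by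
      rw [pow_succ]; exact mul_le_mul_of_nonneg_left hs1 (sq_nonneg _)
    have e5 : (M * s) ^ 4 ≤ (M * s) ^ 2 * (1 / 8) := by
      have : (M * s) ^ 4 = (M * s) ^ 3 * (M * s) := by ring
      rw [this]
      nlinarith [pow_nonneg e3 3, pow_nonneg e3 2]
    nlinarith [sq_nonneg (k * s), sq_nonneg s]
  have hq0 : 0 ≤ q := le_trans (sq_nonneg _) hqb
  refine ⟨√q, s, ⟨hs0.le, ?_, ?_⟩, ?_⟩
  · have : k * s ≤ M * s := mul_le_mul_of_nonneg_right (by linarith) hs0.le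
    linarith
  · rw [Real.sq_sqrt hq0, hq]; ring
  · have h1 : 1 - M * s - 2 * (M * s) ^ 2 ≤ √q := Real.le_sqrt_of_sq_le hqb
    have h2 : z * (1 - M * s - 2 * (M * s) ^ 2) ≤ z * √q := mul_le_mul_of_nonneg_left h1 hz0
    have h3 : gap Q x y (√q) s = - z + z * √q - 4 * (x + y) * s := by
      unfold gap; rw [hx, hz]; ring
    have h4 : 0 < s * (δ - 2 * M ^ 2 * z * s) := mul_pos hs0 (by linarith)
    rw [h3]
    have h5 : s * (δ - 2 * M ^ 2 * z * s) = -(4 * (x + y)) * s - M * z * s - 2 * (M * s) ^ 2 * z := by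
      rw [hδ]; ring
    nlinarith

/-- Tangency at an active inner point of the arc. -/
lemma tangent_of_gap_eq_zero {k ξ s Q x y : ℝ} (hk : 0 < k) (h : OnArc k ξ s) (hs : 0 < s)
    (hall : ∀ ξ s, OnArc k ξ s → gap Q x y ξ s ≤ 0) (hg : gap Q x y ξ s = 0) :
    (x - y) * (4 + 8 * s + k * (2 - k * s)) = 4 * (x + y) * ξ := by
  set G : ℝ × ℝ → ℝ := fun w => w.1 ^ 2 + 3 + 8 * w.2 + 8 * w.2 ^ 2 - (2 - k * w.2) ^ 2 with hG
  set F : ℝ × ℝ → ℝ := fun w => gap Q x y w.1 w.2 with hF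
  have hks := h.eight_mul_le hk
  have hG0 : G (ξ, s) = 0 := by simp only [hG]; linarith [h.2.2]
  -- For 0 < s and k * s < 2 the inequalities in `OnArc` are not binding, so nearby points of the
  -- level set of `G` are on the arc and the gap has a local maximum there.
  have hext : IsLocalExtrOn F {w | G w = G (ξ, s)} (ξ, s) := by
    right
    have h1 : ∀ᶠ w : ℝ × ℝ in 𝓝 (ξ, s), 0 < w.2 :=
      (continuous_snd.tendsto (ξ, s)).eventually (lt_mem_nhds hs)
    have h2 : ∀ᶠ w : ℝ × ℝ in 𝓝 (ξ, s), k * w.2 < 2 := by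
      have : Continuous fun w : ℝ × ℝ => k * w.2 := by fun_prop
      exact (this.tendsto (ξ, s)).eventually (gt_mem_nhds (show k * s < 2 by linarith))
    filter_upwards [self_mem_nhdsWithin, nhdsWithin_le_nhds h1, nhdsWithin_le_nhds h2]
      with w hw hw1 hw2
    have hw' : G w = 0 := by rw [← hG0]; exact hw
    have : gap Q x y w.1 w.2 ≤ 0 := hall _ _ ⟨hw1.le, hw2.le, by simp only [hG] at hw'; linarith⟩
    simp only [hF]
    rw [hg]; exact this
  set L1 : ℝ × ℝ →L[ℝ] ℝ := ContinuousLinearMap.fst ℝ ℝ ℝ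
  set L2 : ℝ × ℝ →L[ℝ] ℝ := ContinuousLinearMap.snd ℝ ℝ ℝ
  have d1 : HasStrictFDerivAt (fun w : ℝ × ℝ => w.1) L1 (ξ, s) := hasStrictFDerivAt_fst
  have d2 : HasStrictFDerivAt (fun w : ℝ × ℝ => w.2) L2 (ξ, s) := hasStrictFDerivAt_snd
  have hGd := ((((d1.pow 2).add_const 3).add (d2.const_mul 8)).add ((d2.pow 2).const_mul 8)).sub
    (((d2.const_mul k).const_sub 2).pow 2)
  have hFd := (((d2.const_mul 4).const_add 1).mul_const (x + y)).const_sub Q |>.sub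
    (d1.mul_const (x - y))
  obtain ⟨a, b, hab, hlin⟩ := IsLocalExtrOn.exists_multipliers_of_hasStrictFDerivAt_1d
    (f := G) (φ := F) hext hGd hFd
  have e1 := congrArg (fun f : ℝ × ℝ →L[ℝ] ℝ => f (1, 0)) hlin
  have e2 := congrArg (fun f : ℝ × ℝ →L[ℝ] ℝ => f (0, 1)) hlin
  simp [L1, L2] at e1 e2
  have hg0 : 0 < 4 + 8 * s + k * (2 - k * s) := by
    have : 0 ≤ k * (2 - k * s) := mul_nonneg hk.le (by linarith)
    linarith
  -- The derivative of `G` in the direction of the axis is 2 (4 + 8 s + k (2 - k s)) > 0, so the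
  -- multiplier of `F` cannot vanish.
  have hb : b ≠ 0 := by
    rintro rfl
    have ha : a ≠ 0 := fun h => hab (by simp [h])
    have : a * (2 * (4 + 8 * s + k * (2 - k * s))) = 0 := by linarith
    rcases mul_eq_zero.1 this with h | h
    · exact ha h
    · linarith
  have e3 : b * (x - y) = 2 * a * ξ := by linarith
  have e4 : b * (4 * (x + y)) = a * (2 * (4 + 8 * s + k * (2 - k * s))) := by linarith
  apply mul_left_cancel₀ hb
  calc b * ((x - y) * (4 + 8 * s + k * (2 - k * s)))
      = b * (x - y) * (4 + 8 * s + k * (2 - k * s)) := by ring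
    _ = a * (2 * (4 + 8 * s + k * (2 - k * s))) * ξ := by rw [e3]; ring
    _ = b * (4 * (x + y) * ξ) := by rw [← e4]; ring

end ArcAlgebra

/-! ### The pea body: membership, active peas and wedge surfaces. -/

section PeaBody

variable {v : Fin 4 → E3} {κ : Fin 4 → Fin 4 → ℝ} {i j l m : Fin 4}

/-- The ratios between the radius of a pea and the height of its centre, for the pea pods on the
six edges. -/
structure Weights (κ : Fin 4 → Fin 4 → ℝ) : Prop where
  symm : ∀ i j, κ i j = κ j i
  pos : ∀ i j, i ≠ j → 0 < κ i j
  prod : ∀ i j l m, Quad i j l m → κ i j * κ l m = 8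

/-- The centre of a pea on the edge `i, j`. -/
def arcPt (v : Fin 4 → E3) (i j l m : Fin 4) (ξ s : ℝ) : E3 :=
  (1 / 2 + ξ / 2 + s) • v i + (1 / 2 - ξ / 2 + s) • v j + (-s) • v l + (-s) • v m

lemma arcPt_one (v : Fin 4 → E3) (i j l m : Fin 4) : arcPt v i j l m 1 0 = v i := by
  simp only [arcPt]; norm_num

lemma arcPt_neg_one (v : Fin 4 → E3) (i j l m : Fin 4) : arcPt v i j l m (-1) 0 = v j := by
  simp only [arcPt]; norm_num

lemma arcPt_comm_left (v : Fin 4 → E3) (i j l m : Fin 4) (ξ s : ℝ) :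
    arcPt v j i l m ξ s = arcPt v i j l m (-ξ) s := by
  simp only [arcPt]; module

lemma arcPt_comm_right (v : Fin 4 → E3) (i j l m : Fin 4) (ξ s : ℝ) :
    arcPt v i j m l ξ s = arcPt v i j l m ξ s := by
  simp only [arcPt]; module

lemma Regular.bary_arcPt (hv : Regular v) (h : Quad i j l m) (ξ s : ℝ) :
    bary v i (arcPt v i j l m ξ s) = 1 / 2 + ξ / 2 + s ∧
    bary v j (arcPt v i j l m ξ s) = 1 / 2 - ξ / 2 + s ∧
    bary v l (arcPt v i j l m ξ s) = -s ∧ bary v m (arcPt v i j l m ξ s) = -s :=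
  hv.bary_comb_quad h (by ring)

/-- The arc equation cancels the terms quadratic in the centre of the pea. For fixed `z` what is
left is affine in (ξ, s), so an edge imposes a linear optimization over a planar arc. -/
lemma Regular.dist_arcPt_sq (hv : Regular v) (h : Quad i j l m) {k ξ s : ℝ} (ha : OnArc k ξ s)
    (z : E3) : dist z (arcPt v i j l m ξ s) ^ 2 - (2 - k * s) ^ 2 =
      2 * gap (quadForm v z) (bary v i z) (bary v j z) ξ s := by
  obtain ⟨b1, b2, b3, b4⟩ := hv.bary_arcPt h ξ s
  have hs := sum_bary_quad (v := v) h z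
  rw [hv.dist_sq_quad h, b1, b2, b3, b4, quadForm_quad h, ← ha.2.2, gap]
  linear_combination 4 * s * hs

lemma Regular.dist_arcPt_le (hv : Regular v) (h : Quad i j l m) {k ξ s : ℝ} (ha : OnArc k ξ s)
    (z : E3) : dist z (arcPt v i j l m ξ s) + k * s ≤ 2 ↔
      gap (quadForm v z) (bary v i z) (bary v j z) ξ s ≤ 0 := by
  have h1 := hv.dist_arcPt_sq h ha z
  have h2 : 0 ≤ 2 - k * s := by linarith [ha.2.1]
  rw [← le_sub_iff_add_le, ← pow_le_pow_iff_left₀ dist_nonneg h2 two_ne_zero]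
  constructor <;> intro h <;> linarith

lemma Regular.dist_arcPt_eq (hv : Regular v) (h : Quad i j l m) {k ξ s : ℝ} (ha : OnArc k ξ s)
    (z : E3) : dist z (arcPt v i j l m ξ s) + k * s = 2 ↔
      gap (quadForm v z) (bary v i z) (bary v j z) ξ s = 0 := by
  have h1 := hv.dist_arcPt_sq h ha z
  have h2 : 0 ≤ 2 - k * s := by linarith [ha.2.1]
  rw [← eq_sub_iff_add_eq, ← sq_eq_sq₀ dist_nonneg h2]
  constructor <;> intro h <;> linarith

/-- The focal property of confocal conics. -/
lemma Regular.dist_arcPt_opp (hv : Regular v) (h : Quad i j l m) {k k' ξ s ξ' s' : ℝ}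
    (hk : 0 < k) (hk' : 0 < k') (hkk : k * k' = 8) (ha : OnArc k ξ s) (ha' : OnArc k' ξ' s') :
    dist (arcPt v i j l m ξ s) (arcPt v l m i j ξ' s') = 2 - k * s - k' * s' := by
  obtain ⟨b1, b2, b3, b4⟩ := hv.bary_arcPt h ξ s
  obtain ⟨c1, c2, c3, c4⟩ := hv.bary_arcPt h.opp ξ' s'
  have e1 := ha.eight_mul_le hk
  have e2 := ha'.eight_mul_le hk'
  have e3 := ha.1
  have e4 := ha'.1
  rw [← sq_eq_sq₀ dist_nonneg (by linarith), hv.dist_sq_quad h, b1, b2, b3, b4, c1, c2, c3, c4]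
  -- The only term mixing the two arcs is 16 s s' on the left and 2 k k' s s' on the right; the
  -- relation k k' = 8 makes them agree.
  linear_combination ha.2.2 + ha'.2.2 - 2 * s * s' * hkk

/-- The tangent bound on |ξ| gives 1 - ξ ≤ (2 - k s) - 4 s, which leaves room for the contribution 8
s² of the height. This places wedge points in the balls about the ends of their own beam. -/
lemma Regular.dist_arcPt_end (hv : Regular v) (h : Quad i j l m) {k ξ s : ℝ} (hk : 0 < k)
    (ha : OnArc k ξ s) : dist (arcPt v i j l m ξ s) (v i) + k * s ≤ 2 := by
  obtain ⟨b1, b2, b3, b4⟩ := hv.bary_arcPt h ξ s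
  obtain ⟨a, b, c, -⟩ := id h
  have e1 := ha.eight_mul_le hk
  have e2 := ha.abs_le hk
  have e3 := ha.1
  have e5 : 0 ≤ k * s := by positivity
  have e4 := neg_le_abs ξ
  rw [← le_sub_iff_add_le, ← pow_le_pow_iff_left₀ dist_nonneg (by linarith) two_ne_zero,
    hv.dist_sq_quad h, b1, b2, b3, b4]
  simp only [hv.bary_vertex, a.symm, b.symm, c.symm, if_true, if_false]
  have e6 : 1 - ξ ≤ 2 - k * s - 4 * s := by linarith
  have e7 : 0 ≤ 1 - ξ := by linarith [le_abs_self ξ]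
  nlinarith [mul_nonneg e3 e3, mul_nonneg e3 e5]

/-- The centres and radii of all peas on the six edges. -/
def peas (v : Fin 4 → E3) (κ : Fin 4 → Fin 4 → ℝ) : Set (E3 × ℝ) :=
  {c | ∃ i j l m ξ s, Quad i j l m ∧ OnArc (κ i j) ξ s ∧ c = (arcPt v i j l m ξ s, κ i j * s)}

/-- The points at distance at most `2` from all points of all peas. -/
def peaBody (v : Fin 4 → E3) (κ : Fin 4 → Fin 4 → ℝ) : Set E3 := ballHull (peas v κ)

lemma isCompact_onArc {k : ℝ} (hk : 0 < k) : IsCompact {w : ℝ × ℝ | OnArc k w.1 w.2} := by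
  apply (isCompact_Icc.prod isCompact_Icc :
    IsCompact (Icc (-1 : ℝ) 1 ×ˢ Icc (0 : ℝ) 1)).of_isClosed_subset
  · have : {w : ℝ × ℝ | OnArc k w.1 w.2} = {w | 0 ≤ w.2} ∩ ({w | k * w.2 ≤ 2} ∩
        {w | w.1 ^ 2 + 3 + 8 * w.2 + 8 * w.2 ^ 2 = (2 - k * w.2) ^ 2}) := by
      ext w; simp [OnArc]
    rw [this]
    exact (isClosed_le (by fun_prop) (by fun_prop)).inter
      ((isClosed_le (by fun_prop) (by fun_prop)).inter (isClosed_eq (by fun_prop) (by fun_prop)))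
  · rintro ⟨ξ, s⟩ h
    have h' : OnArc k ξ s := h
    have h1 := abs_le.1 (h'.abs_le_one hk)
    have h2 := h'.eight_mul_le hk
    have h3 := h'.1
    have : 0 ≤ k * s := by positivity
    exact ⟨h1, h3, by linarith⟩

lemma isCompact_peas (hκ : Weights κ) : IsCompact (peas v κ) := by
  have : peas v κ = ⋃ q ∈ {q : Fin 4 × Fin 4 × Fin 4 × Fin 4 | Quad q.1 q.2.1 q.2.2.1 q.2.2.2},
      (fun w : ℝ × ℝ => ((arcPt v q.1 q.2.1 q.2.2.1 q.2.2.2 w.1 w.2, κ q.1 q.2.1 * w.2) : E3 × ℝ)) ''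
        {w | OnArc (κ q.1 q.2.1) w.1 w.2} := by
    ext c
    simp only [peas, mem_ofPred_eq, mem_iUnion, mem_image, Prod.exists, exists_prop]
    constructor
    · rintro ⟨i, j, l, m, ξ, s, h1, h2, rfl⟩
      exact ⟨i, j, l, m, h1, ξ, s, h2, rfl⟩
    · rintro ⟨i, j, l, m, h1, ξ, s, h2, rfl⟩
      exact ⟨i, j, l, m, ξ, s, h1, h2, rfl⟩
  rw [this]
  refine (toFinite _).isCompact_biUnion fun q hq => ?_
  have hq' : Quad q.1 q.2.1 q.2.2.1 q.2.2.2 := hq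
  apply (isCompact_onArc (hκ.pos _ _ hq'.1)).image
  unfold arcPt
  fun_prop

/-- The constraints on `z` coming from the arc on the edge `i, j`. -/
def ArcOK (v : Fin 4 → E3) (κ : Fin 4 → Fin 4 → ℝ) (z : E3) (i j : Fin 4) : Prop :=
  ∀ ξ s, OnArc (κ i j) ξ s → gap (quadForm v z) (bary v i z) (bary v j z) ξ s ≤ 0

lemma ArcOK.symm (hκ : Weights κ) {z : E3} (h : ArcOK v κ z i j) : ArcOK v κ z j i := by
  intro ξ s ha
  rw [hκ.symm] at ha
  have := h (-ξ) s (onArc_neg ha)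
  rwa [gap_neg] at this

lemma Regular.mem_peaBody (hv : Regular v) {z : E3} :
    z ∈ peaBody v κ ↔ ∀ i j, i ≠ j → ArcOK v κ z i j := by
  constructor
  · intro h i j hij ξ s ha
    obtain ⟨l, m, hq⟩ := exists_quad hij
    have hc : ((arcPt v i j l m ξ s, κ i j * s) : E3 × ℝ) ∈ peas v κ :=
      ⟨i, j, l, m, ξ, s, hq, ha, rfl⟩
    have h1 := mem_ballHull.1 h _ hc
    exact (hv.dist_arcPt_le hq ha z).1 h1
  · intro h c hc
    obtain ⟨i, j, l, m, ξ, s, hq, ha, rfl⟩ := hc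
    exact (hv.dist_arcPt_le hq ha z).2 (h i j hq.1 ξ s ha)

/-- `z` lies in the Reuleaux tetrahedron. -/
def InReuleaux (v : Fin 4 → E3) (z : E3) : Prop := ∀ t, quadForm v z ≤ 2 * bary v t z

lemma Regular.inReuleaux_of_mem (hv : Regular v) {z : E3} (h : z ∈ peaBody v κ) :
    InReuleaux v z := by
  intro t
  obtain ⟨j, hj⟩ : ∃ j, t ≠ j := by revert t; decide
  have := hv.mem_peaBody.1 h t j hj 1 0 (onArc_one _)
  unfold gap at this
  linarith

/-- The wedge beyond the edge opposite to `i, j` in which the arc on `i, j` is relevant. -/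
def InWedge (v : Fin 4 → E3) (κ : Fin 4 → Fin 4 → ℝ) (z : E3) (i j : Fin 4) : Prop :=
  (2 + κ i j) * |bary v i z - bary v j z| < -(2 * (bary v i z + bary v j z))

lemma InWedge.neg (hκ : Weights κ) (hij : i ≠ j) {z : E3} (h : InWedge v κ z i j) :
    bary v i z < 0 ∧ bary v j z < 0 := by
  unfold InWedge at h
  have hk := hκ.pos i j hij
  have h0 := abs_nonneg (bary v i z - bary v j z)
  have h1 := le_abs_self (bary v i z - bary v j z)
  have h2 := neg_le_abs (bary v i z - bary v j z)
  have h3 : 0 ≤ κ i j * |bary v i z - bary v j z| := by positivity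
  constructor <;> nlinarith

lemma arcOK_of_not_inWedge (hκ : Weights κ) {z : E3} (hij : i ≠ j) (hT : InReuleaux v z)
    (h : ¬ InWedge v κ z i j) : ArcOK v κ z i j := fun _ _ ha =>
  gap_nonpos (hκ.pos i j hij) ha (hT i) (hT j) (not_lt.1 h)

lemma Regular.ne_vertex_of_neg (hv : Regular v) {z : E3} {t : Fin 4} (h : bary v t z < 0)
    (r : Fin 4) : z ≠ v r := by
  rintro rfl
  rw [hv.bary_vertex] at h
  split_ifs at h <;> linarith

lemma Regular.inReuleaux_vertex (hv : Regular v) (t : Fin 4) : InReuleaux v (v t) := by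
  intro r
  rw [← hv.dist_vertex_le]
  rcases eq_or_ne t r with rfl | h
  · simp
  · rw [hv t r h]

lemma Regular.vertex_mem (hv : Regular v) (hκ : Weights κ) (t : Fin 4) : v t ∈ peaBody v κ := by
  rw [hv.mem_peaBody]
  intro i j hij
  apply arcOK_of_not_inWedge hκ hij (hv.inReuleaux_vertex t)
  intro h
  exact hv.ne_vertex_of_neg (h.neg hκ hij).1 t rfl

/-- A point beyond an edge of the tetrahedron need only be checked against the arc on the opposite
edge. -/
lemma Regular.mem_peaBody_of_opp (hv : Regular v) (hκ : Weights κ) (h : Quad i j l m) {z : E3}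
    (hT : InReuleaux v z) (hl : bary v l z ≤ 0) (hm : bary v m z ≤ 0)
    (hok : ArcOK v κ z l m) : z ∈ peaBody v κ := by
  -- A third nonpositive coordinate would make `z` a vertex, and vertices have no negative
  -- coordinate. Hence the only wedge that can contain `z` is that of `l, m`.
  have key : ∀ t, (t = i ∨ t = j) → ¬ bary v t z < 0 := by
    rintro t (rfl | rfl) ht
    · exact hv.ne_vertex_of_neg ht _
        (hv.eq_vertex_of_three_nonpos (i := l) (j := m) (l := t) (m := j) h.opp hT hl hm ht.le)
    · exact hv.ne_vertex_of_neg ht _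
        (hv.eq_vertex_of_three_nonpos (i := l) (j := m) (l := t) (m := i) h.opp.swap' hT hl hm ht.le)
  rw [hv.mem_peaBody]
  intro p q hpq
  by_cases hw : InWedge v κ z p q
  · obtain ⟨hp, hq⟩ := hw.neg hκ hpq
    have hp' : p = l ∨ p = m := by
      rcases h.cases p with r | r | r | r
      · exact absurd hp (key p (Or.inl r))
      · exact absurd hp (key p (Or.inr r))
      · exact Or.inl r
      · exact Or.inr r
    have hq' : q = l ∨ q = m := by
      rcases h.cases q with r | r | r | r
      · exact absurd hq (key q (Or.inl r))
      · exact absurd hq (key q (Or.inr r))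
      · exact Or.inl r
      · exact Or.inr r
    rcases hp' with rfl | rfl <;> rcases hq' with rfl | rfl
    · exact absurd rfl hpq
    · exact hok
    · exact hok.symm hκ
    · exact absurd rfl hpq
  · exact arcOK_of_not_inWedge hκ hpq hT hw

/-- The point at distance `R` from `x` on the ray from `y` through `x`, beyond `x`. -/
def tip (x y : E3) (R : ℝ) : E3 := x + (R / dist x y) • (x - y)

lemma dist_tip {x y : E3} {R : ℝ} (hxy : x ≠ y) (hR : 0 ≤ R) : dist (tip x y R) x = R := by
  have : 0 < ‖x - y‖ := norm_pos_iff.2 (sub_ne_zero.2 hxy)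
  rw [tip, dist_eq_norm, add_sub_cancel_left, norm_smul, dist_eq_norm, Real.norm_of_nonneg
    (by positivity), div_mul_cancel₀ _ this.ne']

lemma dist_tip' {x y : E3} {R : ℝ} (hxy : x ≠ y) (hR : 0 ≤ R) :
    dist (tip x y R) y = dist x y + R := by
  have : 0 < ‖x - y‖ := norm_pos_iff.2 (sub_ne_zero.2 hxy)
  have h1 : tip x y R - y = (1 + R / dist x y) • (x - y) := by rw [tip]; module
  rw [dist_eq_norm, h1, norm_smul, dist_eq_norm, Real.norm_of_nonneg (by positivity)]
  field_simp

lemma Regular.arcPt_ne (hv : Regular v) (hκ : Weights κ) (h : Quad i j l m) {ξ s ξ' s' : ℝ}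
    (ha : OnArc (κ i j) ξ s) (ha' : OnArc (κ l m) ξ' s') :
    arcPt v i j l m ξ s ≠ arcPt v l m i j ξ' s' := by
  have hk := hκ.pos i j h.1
  have hk' := hκ.pos l m h.opp.1
  rw [← dist_pos, hv.dist_arcPt_opp h hk hk' (hκ.prod _ _ _ _ h) ha ha']
  have e1 := ha.eight_mul_le hk
  have e2 := ha'.eight_mul_le hk'
  have e3 := ha.1
  have e4 := ha'.1
  linarith

/-- The wedge surfaces lie in the body. -/
lemma Regular.tip_mem (hv : Regular v) (hκ : Weights κ) (h : Quad i j l m) {ξ s ξ' s' : ℝ}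
    (ha : OnArc (κ i j) ξ s) (ha' : OnArc (κ l m) ξ' s') :
    tip (arcPt v i j l m ξ s) (arcPt v l m i j ξ' s') (κ i j * s) ∈ peaBody v κ := by
  have hk := hκ.pos i j h.1
  have hk' := hκ.pos l m h.opp.1
  have hkk := hκ.prod _ _ _ _ h
  have hne := hv.arcPt_ne hκ h ha ha'
  obtain ⟨b1, b2, b3, b4⟩ := hv.bary_arcPt h ξ s
  obtain ⟨c1, c2, c3, c4⟩ := hv.bary_arcPt h.opp ξ' s'
  set x := arcPt v i j l m ξ s with hx
  set y := arcPt v l m i j ξ' s' with hy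
  have hs0 : 0 ≤ κ i j * s := mul_nonneg hk.le ha.1
  set p := tip x y (κ i j * s) with hp
  have hpx : dist p x = κ i j * s := dist_tip hne hs0
  have hμ : 0 ≤ κ i j * s / dist x y := div_nonneg hs0 dist_nonneg
  have hξ' := abs_le.1 (ha'.abs_le_one hk')
  have hpl : bary v l p ≤ 0 := by
    rw [hp, tip, bary_add_smul_sub, b3, c1]
    nlinarith [mul_nonneg hμ (show 0 ≤ 1 / 2 + ξ' / 2 + s' + s by linarith [ha.1, ha'.1]), ha.1]
  have hpm : bary v m p ≤ 0 := by
    rw [hp, tip, bary_add_smul_sub, b4, c2]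
    nlinarith [mul_nonneg hμ (show 0 ≤ 1 / 2 - ξ' / 2 + s' + s by linarith [ha.1, ha'.1]), ha.1]
  -- Triangle inequality through `x`: by the focal property, the radius of the pea at `x`, the
  -- distance from `x` and the opposite radius always add up to 2.
  have hopp : ∀ ξ₁ s₁, OnArc (κ l m) ξ₁ s₁ → dist p (arcPt v l m i j ξ₁ s₁) + κ l m * s₁ ≤ 2 := by
    intro ξ₁ s₁ h₁
    have e1 := hv.dist_arcPt_opp h hk hk' hkk ha h₁
    have e2 := dist_triangle p x (arcPt v l m i j ξ₁ s₁)
    linarith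
  have hT : InReuleaux v p := by
    intro t
    rw [← hv.dist_vertex_le]
    have e2 := dist_triangle p x (v t)
    rcases h.cases t with rfl | rfl | rfl | rfl
    · have e1 := hv.dist_arcPt_end h hk ha
      linarith
    · have e1 := hv.dist_arcPt_end h.swap (hκ.symm i t ▸ hk) (onArc_neg (hκ.symm i t ▸ ha))
      rw [arcPt_comm_left, neg_neg, ← hx, hκ.symm t i] at e1
      linarith
    · have := hopp 1 0 (onArc_one _)
      rwa [arcPt_one, mul_zero, add_zero] at this
    · have := hopp (-1) 0 (onArc_neg (onArc_one _))
      rwa [arcPt_neg_one, mul_zero, add_zero] at this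
  exact hv.mem_peaBody_of_opp hκ h hT hpl hpm fun ξ₁ s₁ h₁ =>
    (hv.dist_arcPt_le h.opp h₁ p).1 (hopp ξ₁ s₁ h₁)

lemma Regular.interior_peaBody_nonempty (hv : Regular v) (hκ : Weights κ) :
    (interior (peaBody v κ)).Nonempty := by
  have hopen : IsOpen {z : E3 | ∀ t, 0 < bary v t z} := by
    have : {z : E3 | ∀ t, 0 < bary v t z} = ⋂ t, {z | 0 < bary v t z} := by ext; simp
    rw [this]
    exact isOpen_iInter_of_finite fun t => isOpen_lt continuous_const (continuous_bary v t)
  refine ⟨centroid4 v, mem_interior.2 ⟨_, ?_, hopen, fun t => by simp [bary]⟩⟩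
  intro z hz
  have hq : Quad 0 1 2 3 := by decide
  have hs := sum_bary_quad (v := v) hq z
  -- With positive coordinates of sum 1 the sum of the squares is less than 1, so the quadratic form
  -- is negative.
  have hT : InReuleaux v z := by
    intro t
    rw [quadForm_quad hq]
    nlinarith [hz 0, hz 1, hz 2, hz 3, hz t, mul_pos (hz 0) (hz 1), mul_pos (hz 0) (hz 2),
      mul_pos (hz 0) (hz 3), mul_pos (hz 1) (hz 2), mul_pos (hz 1) (hz 3), mul_pos (hz 2) (hz 3)]
  rw [hv.mem_peaBody]
  intro i j hij
  apply arcOK_of_not_inWedge hκ hij hT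
  intro h
  exact absurd (h.neg hκ hij).1 (not_lt.2 (hz i).le)

lemma Regular.isCompact_peaBody (hv : Regular v) : IsCompact (peaBody v κ) := by
  refine (isCompact_closedBall (v 0) 2).of_isClosed_subset (isClosed_ballHull _) fun z hz => ?_
  rw [mem_closedBall, hv.dist_vertex_le]
  exact hv.inReuleaux_of_mem hz 0

/-- At a point which is not a vertex, an active inner point of an arc forces the point into the
wedge. -/
lemma Regular.inWedge_of_active (hv : Regular v) (hκ : Weights κ) (h : Quad i j l m) {p : E3}
    (hp : InReuleaux v p) (hpv : p ∉ range v) {ξ s : ℝ} (ha : OnArc (κ i j) ξ s) (hs : 0 < s)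
    (hg : gap (quadForm v p) (bary v i p) (bary v j p) ξ s = 0) : InWedge v κ p i j := by
  rcases wedge_of_gap_eq_zero (hκ.pos i j h.1) ha hs (hp i) (hp j) hg with h1 | ⟨h1, h2⟩
  · exact h1
  · exfalso
    have hQ : quadForm v p = 0 := by simpa [gap, h1, h2] using hg
    have hsum := sum_bary_quad (v := v) h p
    have hq := quadForm_quad (v := v) h p
    have : bary v l p * bary v m p = 0 := by
      rw [hQ, h1, h2] at hq
      rw [h1, h2] at hsum
      nlinarith
    rcases mul_eq_zero.1 this with h3 | h3
    · exact hpv ⟨m, (hv.eq_vertex_of_three_nonpos h hp h1.le h2.le h3.le).symm⟩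
    · exact hpv ⟨l, (hv.eq_vertex_of_three_nonpos h.swap' hp h1.le h2.le h3.le).symm⟩

/-- The two coordinates coincide. If they are positive, the Reuleaux inequalities contradict the
formula for the quadratic form. If they are zero, the point is a vertex. If they are negative, the
pea on the axis cuts the point off: the circular edges of the Reuleaux tetrahedron are not in the
body. -/
lemma Regular.not_two_vertices_active (hv : Regular v) (hκ : Weights κ) (h : Quad i j l m) {p : E3}
    (hp : p ∈ peaBody v κ) (hpv : p ∉ range v) (h1 : quadForm v p = 2 * bary v i p)
    (h2 : quadForm v p = 2 * bary v j p) : False := by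
  have hT := hv.inReuleaux_of_mem hp
  have hsum := sum_bary_quad (v := v) h p
  have hq := quadForm_quad (v := v) h p
  rcases le_or_gt 0 (bary v i p) with h3 | h3
  · have el := hT l
    have em := hT m
    have h5 : bary v i p = 0 := by
      by_contra h6
      have h7 : 0 < bary v i p := lt_of_le_of_ne h3 (Ne.symm h6)
      have h8 : bary v j p = bary v i p := by linarith
      nlinarith [mul_pos h7 h7, mul_nonneg (show 0 ≤ bary v l p by linarith)
        (show 0 ≤ bary v m p by linarith), mul_nonneg h7.le (show 0 ≤ bary v l p by linarith),
        mul_nonneg h7.le (show 0 ≤ bary v m p by linarith)]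
    have h6 : bary v j p = 0 := by linarith
    have : bary v l p * bary v m p = 0 := by
      rw [h1, h5, h6] at hq
      rw [h5, h6] at hsum
      nlinarith
    rcases mul_eq_zero.1 this with h3 | h3
    · exact hpv ⟨m, (hv.eq_vertex_of_three_nonpos h hT h5.le h6.le h3.le).symm⟩
    · exact hpv ⟨l, (hv.eq_vertex_of_three_nonpos h.swap' hT h5.le h6.le h3.le).symm⟩
  · obtain ⟨s, hs, ha⟩ := exists_onArc_axis (hκ.pos i j h.1)
    have := hv.mem_peaBody.1 hp i j h.1 0 s ha
    unfold gap at this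
    nlinarith [mul_pos hs (neg_pos.2 h3)]

/-- Active peas at a point of the body: a vertex, or an inner point of an arc. -/
lemma Regular.active_cases (hv : Regular v) {p : E3} {c : E3 × ℝ} (hc : c ∈ peas v κ)
    (h : dist p c.1 + c.2 = 2) :
    (∃ t, c = (v t, 0) ∧ quadForm v p = 2 * bary v t p) ∨
    ∃ i j l m ξ s, Quad i j l m ∧ OnArc (κ i j) ξ s ∧ 0 < s ∧
      c = (arcPt v i j l m ξ s, κ i j * s) ∧
      gap (quadForm v p) (bary v i p) (bary v j p) ξ s = 0 := by
  obtain ⟨i, j, l, m, ξ, s, hq, ha, rfl⟩ := hc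
  have hg := (hv.dist_arcPt_eq hq ha p).1 h
  rcases ha.1.eq_or_lt with h0 | h0
  · subst h0
    left
    rcases ha.eq_one_or with rfl | rfl
    · refine ⟨i, by rw [arcPt_one, mul_zero], ?_⟩
      unfold gap at hg; linarith
    · refine ⟨j, by rw [arcPt_neg_one, mul_zero], ?_⟩
      unfold gap at hg; linarith
  · right
    exact ⟨i, j, l, m, ξ, s, hq, ha, h0, rfl, hg⟩

/-- An active inner point of an arc is the only active point. -/
lemma Regular.active_unique_of_inner (hv : Regular v) (hκ : Weights κ) (h : Quad i j l m) {p : E3}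
    (hp : p ∈ peaBody v κ) (hpv : p ∉ range v) {ξ s : ℝ} (ha : OnArc (κ i j) ξ s) (hs : 0 < s)
    (hg : gap (quadForm v p) (bary v i p) (bary v j p) ξ s = 0) {c : E3 × ℝ}
    (hc : c ∈ peas v κ) (hcp : dist p c.1 + c.2 = 2) :
    c = (arcPt v i j l m ξ s, κ i j * s) := by
  have hT := hv.inReuleaux_of_mem hp
  have hk := hκ.pos i j h.1
  obtain ⟨hi, hj⟩ := (hv.inWedge_of_active hκ h hT hpv ha hs hg).neg hκ h.1
  have hl : 0 < bary v l p := by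
    by_contra! h1
    exact hpv ⟨m, (hv.eq_vertex_of_three_nonpos h hT hi.le hj.le h1).symm⟩
  have hm : 0 < bary v m p := by
    by_contra! h1
    exact hpv ⟨l, (hv.eq_vertex_of_three_nonpos h.swap' hT hi.le hj.le h1).symm⟩
  have huniq : ∀ ξ' s', OnArc (κ i j) ξ' s' →
      gap (quadForm v p) (bary v i p) (bary v j p) ξ' s' = 0 → ξ' = ξ ∧ s' = s :=
    fun ξ' s' h1 h2 => gap_zero_unique hk h1 ha (by linarith)
      (hv.mem_peaBody.1 hp i j h.1) h2 hg
  rcases hv.active_cases hc hcp with ⟨t, rfl, ht⟩ | ⟨i', j', l', m', ξ', s', hq, ha', hs', rfl, hg'⟩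
  · exfalso
    have hti := hT i
    rcases h.cases t with rfl | rfl | rfl | rfl
    · exact hs.ne (huniq 1 0 (onArc_one _) (by unfold gap; linarith)).2
    · exact hs.ne (huniq (-1) 0 (onArc_neg (onArc_one _)) (by unfold gap; linarith)).2
    · linarith
    · linarith
  · obtain ⟨hi', hj'⟩ := (hv.inWedge_of_active hκ hq hT hpv ha' hs' hg').neg hκ hq.1
    have key : ∀ t, bary v t p < 0 → t = i ∨ t = j := by
      intro t ht
      rcases h.cases t with r | r | rfl | rfl
      · exact Or.inl r
      · exact Or.inr r
      · linarith
      · linarith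
    -- The same edge may be presented with its indices in another order. Exchanging `l` and `m` does
    -- not move the centre, and exchanging `i` and `j` changes the sign of ξ.
    have hlm : ∀ ξ s, arcPt v i j l' m' ξ s = arcPt v i j l m ξ s ∨
        ¬ ((i' = i ∧ j' = j) ∨ (i' = j ∧ j' = i)) := by
      intro ξ s
      by_cases hij : (i' = i ∧ j' = j) ∨ (i' = j ∧ j' = i)
      · left
        have : (l' = l ∧ m' = m) ∨ (l' = m ∧ m' = l) := by
          clear * - hij hq h
          revert i j l m i' j' l' m'
          decide
        rcases this with ⟨rfl, rfl⟩ | ⟨rfl, rfl⟩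
        · rfl
        · exact arcPt_comm_right _ _ _ _ _ _ _
      · exact Or.inr hij
    rcases key i' hi' with rfl | rfl <;> rcases key j' hj' with rfl | rfl
    · exact absurd rfl hq.1
    · obtain ⟨rfl, rfl⟩ := huniq ξ' s' ha' hg'
      rcases hlm ξ' s' with h1 | h1
      · rw [h1]
      · exact absurd (Or.inl ⟨rfl, rfl⟩) h1
    · rw [hκ.symm] at ha'
      have hg2 := hg'
      rw [← gap_neg] at hg2
      obtain ⟨rfl, rfl⟩ := huniq (-ξ') s' (onArc_neg ha') hg2
      rcases hlm (-ξ') s' with h1 | h1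
      · rw [arcPt_comm_left, h1, hκ.symm]
      · exact absurd (Or.inr ⟨rfl, rfl⟩) h1
    · exact absurd rfl hq.1

/-- At a point of the body which is not a vertex at most one pea is active. -/
lemma Regular.active_unique (hv : Regular v) (hκ : Weights κ) {p : E3}
    (hp : p ∈ peaBody v κ) (hpv : p ∉ range v) {c c' : E3 × ℝ} (hc : c ∈ peas v κ)
    (hc' : c' ∈ peas v κ) (h : dist p c.1 + c.2 = 2) (h' : dist p c'.1 + c'.2 = 2) : c' = c := by
  rcases hv.active_cases hc h with ⟨t, rfl, ht⟩ | ⟨i, j, l, m, ξ, s, hq, ha, hs, rfl, hg⟩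
  · rcases hv.active_cases hc' h' with ⟨t', rfl, ht'⟩ | ⟨i, j, l, m, ξ, s, hq, ha, hs, rfl, hg⟩
    · rcases eq_or_ne t t' with rfl | hne
      · rfl
      · obtain ⟨l, m, hq⟩ := exists_quad hne
        exact (hv.not_two_vertices_active hκ hq hp hpv ht ht').elim
    · exact (hv.active_unique_of_inner hκ hq hp hpv ha hs hg hc h).symm
  · exact hv.active_unique_of_inner hκ hq hp hpv ha hs hg hc' h'

/-- A point at which the constraint of the arc on `i, j` is tangent lies on the wedge surface of the
opposite edge. -/
lemma Regular.eq_tip_of_tangent (hv : Regular v) (hκ : Weights κ) (h : Quad i j l m) {p : E3}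
    {ξ s : ℝ} (ha : OnArc (κ i j) ξ s) (hsum : bary v i p + bary v j p ≤ 0)
    (hg : gap (quadForm v p) (bary v i p) (bary v j p) ξ s = 0)
    (htan : (bary v i p - bary v j p) * (4 + 8 * s + κ i j * (2 - κ i j * s)) =
      4 * (bary v i p + bary v j p) * ξ) :
    ∃ ξ' s', OnArc (κ l m) ξ' s' ∧
      p = tip (arcPt v l m i j ξ' s') (arcPt v i j l m ξ s) (κ l m * s') := by
  have hk := hκ.pos i j h.1
  have hk' := hκ.pos l m h.opp.1
  have hkk := hκ.prod _ _ _ _ h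
  have hks := ha.eight_mul_le hk
  have hs0 := ha.1
  have hdist : dist p (arcPt v i j l m ξ s) = 2 - κ i j * s := by
    have := (hv.dist_arcPt_eq h ha p).2 hg
    linarith
  have hS := sum_bary_quad (v := v) h p
  obtain ⟨b1, b2, b3, b4⟩ := hv.bary_arcPt h ξ s
  set k := κ i j with hkdef
  set k' := κ l m with hkdef'
  set N := 2 - k * s with hN
  have hN0 : 0 < N := by linarith
  set g := 4 + 8 * s + k * N with hgdef
  have hg0 : 0 < g := by positivity
  clear_value g
  -- The centre `y` on the opposite arc is sought with p = y + μ (y - x). The sum of the coordinates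
  -- `i, j` determines μ, and the tangency equation is what makes their difference agree as well.
  set μ := -(4 * (bary v i p + bary v j p)) / g with hμ
  have hμ0 : 0 ≤ μ := div_nonneg (by linarith) hg0.le
  have hμ1 : 0 < 1 + μ := by linarith
  have hμg : μ * g = -(4 * (bary v i p + bary v j p)) := by rw [hμ]; field_simp
  clear_value μ
  have hdiff : bary v i p - bary v j p = -(μ * ξ) := by
    apply mul_right_cancel₀ hg0.ne'
    rw [htan]
    linear_combination ξ * hμg
  -- Forced by |p - x| = N, which gives |y - x| = N / (1 + μ), and by the requirement that the
  -- radius k' s' be μ |y - x|.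
  set s' := μ * k * N / (8 * (1 + μ)) with hs'
  have hks' : k' * s' = μ * N / (1 + μ) := by
    rw [hs']
    field_simp
    linear_combination μ * hkk
  set ξ' := (bary v l p - bary v m p) / (1 + μ) with hξ'
  have e1 : (1 + μ) * s' = μ * k * N / 8 := by rw [hs']; field_simp
  have e2 : (1 + μ) * ξ' = bary v l p - bary v m p := by rw [hξ']; field_simp
  have hs'0 : 0 ≤ s' := by positivity
  clear_value s' ξ'
  rw [hgdef] at hμg
  obtain ⟨c1, c2, c3, c4⟩ := hv.bary_arcPt h.opp ξ' s'
  set x := arcPt v i j l m ξ s with hx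
  set y := arcPt v l m i j ξ' s' with hy
  have hpy : p = y + μ • (y - x) := by
    apply hv.bary_ext
    intro t
    rw [bary_add_smul_sub]
    rcases h.cases t with rfl | rfl | rfl | rfl
    · rw [c3, b1]; linear_combination e1 + (1 / 2) * hdiff + (1 / 8) * hμg
    · rw [c4, b2]; linear_combination e1 - (1 / 2) * hdiff + (1 / 8) * hμg
    · rw [c1, b3]; linear_combination (-1 / 2) * e2 - e1 + (1 / 2) * hS - (1 / 8) * hμg
    · rw [c2, b4]; linear_combination (1 / 2) * e2 - e1 + (1 / 2) * hS - (1 / 8) * hμg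
  have hdyx : dist y x = N / (1 + μ) := by
    have h1 : p - x = (1 + μ) • (y - x) := by rw [hpy]; module
    rw [dist_eq_norm, h1, norm_smul, Real.norm_of_nonneg hμ1.le, ← dist_eq_norm] at hdist
    field_simp
    linarith
  have hdyx' : dist y x = N - k' * s' := by
    rw [hdyx, hks']; field_simp; ring
  have hdsq := hv.dist_sq_quad h y x
  rw [b1, b2, b3, b4, c1, c2, c3, c4, hdyx'] at hdsq
  -- The focal property read backwards: |y - x| = 2 - k s - k' s' and the arc equation of `x` give
  -- the arc equation of `y`.
  have harc : OnArc k' ξ' s' := by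
    refine ⟨hs'0, ?_, ?_⟩
    · have : 0 ≤ N / (1 + μ) := by positivity
      have : 0 ≤ k * s := by positivity
      linarith [hdyx.symm.trans hdyx']
    · linear_combination (-1) * hdsq + (-1) * ha.2.2 + 2 * s * s' * hkk
  refine ⟨ξ', s', harc, ?_⟩
  have hcoef : k' * s' / dist y x = μ := by
    rw [hks', hdyx]; field_simp
  rw [tip, hcoef, ← hpy]

/-- A point with an active inner point `x` of the arc on `i, j` lies on the wedge surface of the
opposite edge. -/
lemma Regular.eq_tip_of_active (hv : Regular v) (hκ : Weights κ) (h : Quad i j l m) {p : E3}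
    (hp : p ∈ peaBody v κ) (hpv : p ∉ range v) {ξ s : ℝ} (ha : OnArc (κ i j) ξ s) (hs : 0 < s)
    (hg : gap (quadForm v p) (bary v i p) (bary v j p) ξ s = 0) :
    ∃ ξ' s', OnArc (κ l m) ξ' s' ∧
      p = tip (arcPt v l m i j ξ' s') (arcPt v i j l m ξ s) (κ l m * s') := by
  obtain ⟨hi, hj⟩ := (hv.inWedge_of_active hκ h (hv.inReuleaux_of_mem hp) hpv ha hs hg).neg hκ h.1
  exact hv.eq_tip_of_tangent hκ h ha (by linarith) hg
    (tangent_of_gap_eq_zero (hκ.pos i j h.1) ha hs (hv.mem_peaBody.1 hp i j h.1) hg)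

end PeaBody

/-! ### Constant width, the caps, the boundary and its vertices. -/

section Boundary

variable {v : Fin 4 → E3} {κ : Fin 4 → Fin 4 → ℝ} {i j l m : Fin 4}

lemma peas_radius (hκ : Weights κ) {c : E3 × ℝ} (hc : c ∈ peas v κ) : 0 ≤ c.2 ∧ c.2 ≤ 1 / 2 := by
  obtain ⟨i, j, l, m, ξ, s, hq, ha, rfl⟩ := hc
  have hk := hκ.pos i j hq.1
  have h1 := ha.eight_mul_le hk
  have h2 := ha.1
  exact ⟨by positivity, by simp only; linarith⟩

lemma ne_of_active (hκ : Weights κ) {p : E3} {c : E3 × ℝ} (hc : c ∈ peas v κ)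
    (h : dist p c.1 + c.2 = 2) : p ≠ c.1 := by
  intro h1
  have := (peas_radius hκ hc).2
  rw [h1, dist_self] at h
  linarith

lemma mem_frontier_peaBody (hκ : Weights κ) {p : E3} :
    p ∈ frontier (peaBody v κ) ↔ p ∈ peaBody v κ ∧ ∃ c ∈ peas v κ, dist p c.1 + c.2 = 2 := by
  have hcl : IsClosed (peaBody v κ) := isClosed_ballHull _
  constructor
  · intro h
    have hp := hcl.frontier_subset h
    refine ⟨hp, ?_⟩
    by_contra! hcon
    exact h.2 (mem_interior_ballHull (isCompact_peas hκ) hp hcon)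
  · rintro ⟨hp, c, hc, h⟩
    refine ⟨subset_closure hp, notMem_interior_of_normal ?_ (normalCone_of_active hc h)⟩
    exact sub_ne_zero.2 (ne_of_active hκ hc h)

lemma Regular.normal_eq (hv : Regular v) (hκ : Weights κ) {p : E3} (hp : p ∈ peaBody v κ)
    (hpv : p ∉ range v) {c : E3 × ℝ} (hc : c ∈ peas v κ) (h : dist p c.1 + c.2 = 2) {u : E3}
    (hu : ‖u‖ = 1) (hN : u ∈ normalCone (peaBody v κ) p) : u = (dist p c.1)⁻¹ • (p - c.1) :=
  normal_eq_of_active_unique (isCompact_peas hκ) hp (ne_of_active hκ hc h)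
    (fun _ hc' h' => hv.active_unique hκ hp hpv hc hc' h h') hu hN

lemma Regular.hasUniqueSupportPlane (hv : Regular v) (hκ : Weights κ) {p : E3}
    (hp : p ∈ frontier (peaBody v κ)) (hpv : p ∉ range v) :
    HasUniqueSupportPlane (peaBody v κ) p := by
  obtain ⟨hpK, c, hc, h⟩ := (mem_frontier_peaBody hκ).1 hp
  have hd : 0 < dist p c.1 := dist_pos.2 (ne_of_active hκ hc h)
  refine ⟨(dist p c.1)⁻¹ • (p - c.1), ⟨?_, fun z hz => ?_⟩,
    fun u hu => hv.normal_eq hκ hpK hpv hc h hu.1 hu.2⟩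
  · rw [norm_smul, norm_inv, ← dist_eq_norm, Real.norm_of_nonneg hd.le, inv_mul_cancel₀ hd.ne']
  · rw [inner_smul_left]
    exact mul_nonpos_of_nonneg_of_nonpos (by simp) (normalCone_of_active hc h z hz)

/-- A normal at a point which is not a vertex points away from a vertex at distance `2`, or from a
point at distance `2` of the body, whose points are all at distance at most `2`. -/
lemma Regular.normal_cases (hv : Regular v) (hκ : Weights κ) {p : E3} (hp : p ∈ peaBody v κ)
    (hpv : p ∉ range v) {u : E3} (hu : ‖u‖ = 1) (hN : u ∈ normalCone (peaBody v κ) p) :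
    (∃ t, p - v t = (2 : ℝ) • u) ∨
    ((∃ q ∈ peaBody v κ, p - q = (2 : ℝ) • u) ∧ ∀ q ∈ peaBody v κ, dist p q ≤ 2) := by
  have hfr : p ∈ frontier (peaBody v κ) := ⟨subset_closure hp,
    notMem_interior_of_normal (by rintro rfl; simp at hu) hN⟩
  obtain ⟨-, c, hc, h⟩ := (mem_frontier_peaBody hκ).1 hfr
  have hnu := hv.normal_eq hκ hp hpv hc h hu hN
  have hd : 0 < dist p c.1 := dist_pos.2 (ne_of_active hκ hc h)
  have hpc : p - c.1 = dist p c.1 • u := by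
    rw [hnu, smul_smul, mul_inv_cancel₀ hd.ne', one_smul]
  rcases hv.active_cases hc h with ⟨t, rfl, -⟩ | ⟨i, j, l, m, ξ, s, hq, ha, hs, rfl, hg⟩
  · left
    refine ⟨t, ?_⟩
    simp only [add_zero] at h hpc
    rw [hpc, h]
  · right
    simp only at hpc h
    obtain ⟨ξ', s', ha', hpt⟩ := hv.eq_tip_of_active hκ hq hp hpv ha hs hg
    have hk := hκ.pos i j hq.1
    have hk' := hκ.pos l m hq.opp.1
    have hkk := hκ.prod _ _ _ _ hq
    have hne := hv.arcPt_ne hκ hq ha ha'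
    have hopp := hv.dist_arcPt_opp hq hk hk' hkk ha ha'
    have hmem := hv.tip_mem hκ hq ha ha'
    have hyp : ((arcPt v l m i j ξ' s', κ l m * s') : E3 × ℝ) ∈ peas v κ :=
      ⟨l, m, i, j, ξ', s', hq.opp, ha', rfl⟩
    set x := arcPt v i j l m ξ s
    set y := arcPt v l m i j ξ' s'
    have hs0 : 0 ≤ κ i j * s := mul_nonneg hk.le ha.1
    have hs0' : 0 ≤ κ l m * s' := mul_nonneg hk'.le ha'.1
    have hdpy : dist p y = κ l m * s' := by rw [hpt]; exact dist_tip hne.symm hs0'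
    have hdpx : dist p x = dist x y + κ l m * s' := by
      rw [hpt, dist_tip' hne.symm hs0', dist_comm]
    have hdxy : 0 < dist x y := dist_pos.2 hne
    have hyx : y - x = dist x y • u := by
      have h1 : p - x = (1 + κ l m * s' / dist x y) • (y - x) := by
        rw [hpt, tip, dist_comm y x]; module
      have hpos : 0 < 1 + κ l m * s' / dist x y := by positivity
      have h2 : (1 + κ l m * s' / dist x y) • (y - x) =
          (1 + κ l m * s' / dist x y) • (dist x y • u) := by
        rw [← h1, hpc, hdpx, smul_smul]
        congr 1
        field_simp
      exact smul_right_injective _ hpos.ne' h2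
    refine ⟨⟨_, hmem, ?_⟩, fun q hq' => ?_⟩
    · have h1 : p - tip x y (κ i j * s) =
          (1 + κ l m * s' / dist x y + κ i j * s / dist x y) • (y - x) := by
        rw [hpt, tip, tip, dist_comm y x]; module
      rw [h1, hyx, smul_smul]
      congr 1
      field_simp
      linarith
    -- The point `p` is at distance k' s' from `y`, and the body lies in the ball of radius 2 - k'
    -- s' about `y`.
    · have h1 := mem_ballHull.1 hq' _ hyp
      have h2 := dist_triangle p y q
      rw [dist_comm] at h1
      simp only at h1
      linarith

lemma Regular.dist_vertex_le_two (hv : Regular v) {p : E3} (hp : p ∈ peaBody v κ) (t : Fin 4) :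
    dist p (v t) ≤ 2 := (hv.dist_vertex_le p t).2 (hv.inReuleaux_of_mem hp t)

theorem Regular.hasConstantWidth (hv : Regular v) (hκ : Weights κ) :
    HasConstantWidth (peaBody v κ) 2 := by
  refine hasConstantWidth_of_doubleNormal hv.isCompact_peaBody (convex_ballHull _)
    (hv.interior_peaBody_nonempty hκ) ?_
  -- a double normal with a smooth end on a wedge surface
  have key : ∀ p ∈ peaBody v κ, ∀ q ∈ peaBody v κ, ∀ (u : E3) (w : ℝ), ‖u‖ = 1 → 0 < w →
      p - q = w • u → -u ∈ normalCone (peaBody v κ) q →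
      (∃ p' ∈ peaBody v κ, p - p' = (2 : ℝ) • u) → 2 ≤ w := by
    rintro p hp q hq u w hu hw hpq hNq ⟨p', hp', hpp'⟩
    have h1 := hNq p' hp'
    have h2 : p' - q = (w - 2) • u := by
      rw [sub_smul, ← hpq, ← hpp']; abel
    rw [h2, inner_neg_left, inner_smul_right, real_inner_self_eq_norm_sq, hu] at h1
    linarith
  intro p hp q hq u w hu hw hpq hNp hNq
  have hw' : dist p q = w := by
    rw [dist_eq_norm, hpq, norm_smul, hu, Real.norm_of_nonneg hw.le, mul_one]
  have hqp : q - p = w • (-u) := by rw [smul_neg, ← hpq]; abel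
  have hu' : ‖-u‖ = 1 := by rw [norm_neg, hu]
  have hNp' : -(-u) ∈ normalCone (peaBody v κ) p := by rwa [neg_neg]
  have hP : (∃ t, p = v t) ∨ (∃ t, p - v t = (2 : ℝ) • u) ∨ w = 2 := by
    by_cases h : p ∈ range v
    · obtain ⟨t, rfl⟩ := h
      exact Or.inl ⟨t, rfl⟩
    · rcases hv.normal_cases hκ hp h hu hNp with h1 | ⟨h1, h2⟩
      · exact Or.inr (Or.inl h1)
      · refine Or.inr (Or.inr (le_antisymm ?_ (key p hp q hq u w hu hw hpq hNq h1)))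
        rw [← hw']; exact h2 q hq
  have hQ : (∃ t, q = v t) ∨ (∃ t, q - v t = (2 : ℝ) • (-u)) ∨ w = 2 := by
    by_cases h : q ∈ range v
    · obtain ⟨t, rfl⟩ := h
      exact Or.inl ⟨t, rfl⟩
    · rcases hv.normal_cases hκ hq h hu' hNq with h1 | ⟨h1, h2⟩
      · exact Or.inr (Or.inl h1)
      · refine Or.inr (Or.inr (le_antisymm ?_ (key q hq p hp (-u) w hu' hw hqp hNp' h1)))
        rw [← hw', dist_comm]; exact h2 p hp
  rcases hP with ⟨t, ht⟩ | ⟨t, ht⟩ | h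
  · rcases hQ with ⟨t', ht'⟩ | ⟨t', ht'⟩ | h
    · rw [← hw', ht, ht']
      apply hv
      rintro rfl
      rw [ht, ht', dist_self] at hw'
      linarith
    · have h1 := key q hq p hp (-u) w hu' hw hqp hNp' ⟨_, hv.vertex_mem hκ t', ht'⟩
      have h2 := hv.dist_vertex_le_two hq t
      rw [← ht, dist_comm] at h2
      linarith
    · exact h
  · have h1 := key p hp q hq u w hu hw hpq hNq ⟨_, hv.vertex_mem hκ t, ht⟩
    rcases hQ with ⟨t', ht'⟩ | ⟨t', ht'⟩ | h
    · have h2 := hv.dist_vertex_le_two hp t'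
      rw [← ht'] at h2
      linarith
    -- Both ends are on caps: going back by 2 from each of them along the double normal leads to the
    -- two vertices.
    · have h2 : v t - v t' = (w - 4) • u := by
        have : v t - v t' = (p - q) - (p - v t) + (q - v t') := by abel
        rw [this, hpq, ht, ht']; module
      have h3 : dist (v t) (v t') = |w - 4| := by
        rw [dist_eq_norm, h2, norm_smul, hu, Real.norm_eq_abs, mul_one]
      have h4 := dist_triangle p (v t) q
      have h5 := hv.dist_vertex_le_two hp t
      have h6 := hv.dist_vertex_le_two hq t
      rw [dist_comm] at h6
      rcases eq_or_ne t t' with rfl | hne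
      -- With a common vertex, `p` and `q` are antipodal on its sphere. The parallelogram law with
      -- another vertex `r` gives squared distances of sum 16, but each is at most 4.
      · exfalso
        obtain ⟨r, hr⟩ : ∃ r, t ≠ r := by clear * -; revert t; decide
        have a1 := hv.dist_vertex_le_two hp r
        have a2 := hv.dist_vertex_le_two hq r
        have a3 := hv t r hr
        rw [dist_eq_norm] at a1 a2 a3
        have b1 : p - v r = (v t - v r) + (2 : ℝ) • u := by rw [← ht]; abel
        have b2 : q - v r = (v t - v r) - (2 : ℝ) • u := by
          have : (2 : ℝ) • u = -(q - v t) := by rw [ht', smul_neg, neg_neg]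
          rw [this]; abel
        have c1 : ‖p - v r‖ ^ 2 + ‖q - v r‖ ^ 2 = 16 := by
          rw [b1, b2, norm_add_sq_real, norm_sub_sq_real (v t - v r), a3, norm_smul, hu]
          norm_num
          ring
        nlinarith [norm_nonneg (p - v r), norm_nonneg (q - v r)]
      · rw [hv t t' hne] at h3
        rw [abs_of_nonpos (by linarith)] at h3
        linarith
    · exact h
  · exact h

/-- The three boundary curves on the sphere about the vertex `i`. -/
def gammaSet (v : Fin 4 → E3) (κ : Fin 4 → Fin 4 → ℝ) (i : Fin 4) : Set E3 :=
  {p | ∃ j l m ξ s, Quad i j l m ∧ OnArc (κ l m) ξ s ∧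
    p = tip (arcPt v l m i j ξ s) (v i) (κ l m * s)}

/-- A vertex is a pea of radius 0 at the end of an arc, so these curves are the borders of wedge
surfaces, and the focal property puts them at distance 2 from the vertex. -/
lemma Regular.gammaSet_subset (hv : Regular v) (hκ : Weights κ) (i : Fin 4) :
    gammaSet v κ i ⊆ sphere (v i) 2 ∩ peaBody v κ := by
  rintro p ⟨j, l, m, ξ, s, hq, ha, rfl⟩
  have hk := hκ.pos i j hq.1
  have hk' := hκ.pos l m hq.opp.1
  have h1 := hv.tip_mem hκ hq.opp ha (onArc_one (κ i j))
  have h2 := hv.arcPt_ne hκ hq.opp ha (onArc_one (κ i j))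
  have h3 := hv.dist_arcPt_opp hq.opp hk' hk (hκ.prod _ _ _ _ hq.opp) ha (onArc_one (κ i j))
  rw [arcPt_one] at h1 h2 h3
  refine ⟨?_, h1⟩
  rw [mem_sphere, dist_tip' h2 (mul_nonneg hk'.le ha.1), h3]
  ring

lemma vertex_mem_gammaSet (h : i ≠ l) : v l ∈ gammaSet v κ i := by
  obtain ⟨j, m, hq⟩ := exists_quad h
  refine ⟨j, l, m, 1, 0, by unfold Quad at *; tauto, onArc_one _, ?_⟩
  rw [arcPt_one, mul_zero, tip, zero_div, zero_smul, add_zero]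

/-- On the sphere about a vertex, the wedges of the edges at that vertex are outside the body. -/
lemma Regular.notMem_of_inWedge (hv : Regular v) (hκ : Weights κ) (hij : i ≠ j) {p : E3}
    (hS : quadForm v p = 2 * bary v i p) (hw : InWedge v κ p i j) : p ∉ peaBody v κ := by
  intro hp
  have hT := hv.inReuleaux_of_mem hp j
  obtain ⟨ξ, s, ha, hg⟩ := exists_gap_pos_of_wedge (hκ.pos i j hij) hS (by linarith) hw
  exact not_le.2 hg (hv.mem_peaBody.1 hp i j hij ξ s ha)

/-- Only the wedges of edges at `i` matter. In the wedge of another edge a b two coordinates are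
negative, and on the sphere the coordinate of `i` is at most that of `a`; three negative coordinates
are impossible. -/
lemma Regular.mem_peaBody_of_sphere (hv : Regular v) (hκ : Weights κ) {p : E3}
    (hS : quadForm v p = 2 * bary v i p) (hT : InReuleaux v p)
    (hw : ∀ j, i ≠ j → ¬ InWedge v κ p i j) : p ∈ peaBody v κ := by
  rw [hv.mem_peaBody]
  intro a b hab
  by_cases ha : i = a
  · subst ha
    exact arcOK_of_not_inWedge hκ hab hT (hw b hab)
  by_cases hb : i = b
  · subst hb
    exact (arcOK_of_not_inWedge hκ hab.symm hT (hw a hab.symm)).symm hκ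
  apply arcOK_of_not_inWedge hκ hab hT
  intro h
  obtain ⟨h1, h2⟩ := h.neg hκ hab
  have h3 := hT a
  obtain ⟨m, hm⟩ : ∃ m, Quad a b i m := by
    clear * - hab ha hb; revert a b i; decide
  exact hv.ne_vertex_of_neg h1 m
    (hv.eq_vertex_of_three_nonpos hm hT h1.le h2.le (by linarith))

/-- On the border of the wedge the tangency equation holds at the end ξ = 1, s = 0 of the arc, that
is, with the vertex itself as the active pea. -/
lemma Regular.mem_gammaSet (hv : Regular v) (hκ : Weights κ) (hij : i ≠ j) {p : E3}
    (hp : p ∈ peaBody v κ) (hS : quadForm v p = 2 * bary v i p)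
    (hw : (2 + κ i j) * |bary v i p - bary v j p| = -(2 * (bary v i p + bary v j p))) :
    p ∈ gammaSet v κ i := by
  obtain ⟨l, m, hq⟩ := exists_quad hij
  have hT := hv.inReuleaux_of_mem hp j
  have hk := hκ.pos i j hij
  have habs := abs_nonneg (bary v i p - bary v j p)
  have h0 : 0 ≤ (2 + κ i j) * |bary v i p - bary v j p| := by positivity
  rw [abs_of_nonpos (by linarith)] at hw h0
  obtain ⟨ξ, s, ha, h⟩ := hv.eq_tip_of_tangent hκ hq (p := p) (onArc_one (κ i j)) (by linarith)
    (by unfold gap; linarith) (by linarith)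
  rw [arcPt_one] at h
  exact ⟨j, l, m, ξ, s, hq, ha, h⟩

lemma continuous_quadForm (v : Fin 4 → E3) : Continuous (quadForm v) := by
  unfold quadForm
  exact (continuous_finsetSum _ fun i _ => (continuous_bary v i).pow 2).sub continuous_const

/-- Away from the boundary curves, the part of the sphere in the body is open in the sphere. -/
lemma Regular.eventually_mem_of_sphere (hv : Regular v) (hκ : Weights κ) {p : E3}
    (hp : p ∈ peaBody v κ) (hpS : p ∈ sphere (v i) 2) (hpΓ : p ∉ gammaSet v κ i) :
    ∀ᶠ z in 𝓝 p, z ∈ sphere (v i) 2 → z ∈ peaBody v κ := by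
  have hS : quadForm v p = 2 * bary v i p := (hv.dist_vertex_eq p i).1 hpS
  have hpv : p ∉ range v := by
    rintro ⟨t, rfl⟩
    rcases eq_or_ne i t with rfl | h
    · rw [mem_sphere, dist_self] at hpS; norm_num at hpS
    · exact hpΓ (vertex_mem_gammaSet h)
  have hT := hv.inReuleaux_of_mem hp
  have hlt : ∀ t, i ≠ t → quadForm v p < 2 * bary v t p := by
    intro t hit
    refine lt_of_le_of_ne (hT t) fun h => ?_
    obtain ⟨l, m, hq⟩ := exists_quad hit
    exact hv.not_two_vertices_active hκ hq hp hpv hS h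
  have hwlt : ∀ t, i ≠ t →
      -(2 * (bary v i p + bary v t p)) < (2 + κ i t) * |bary v i p - bary v t p| := by
    intro t hit
    refine lt_of_le_of_ne (not_lt.1 fun h => hv.notMem_of_inWedge hκ hit hS h hp) fun h => ?_
    exact hpΓ (hv.mem_gammaSet hκ hit hp hS h.symm)
  have hc := continuous_bary v
  have hQ := continuous_quadForm v
  have e1 : ∀ᶠ z in 𝓝 p, ∀ t, i ≠ t → quadForm v z < 2 * bary v t z := by
    rw [eventually_all]
    intro t
    by_cases hit : i = t
    · exact Eventually.of_forall fun z h => absurd hit h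
    · have := hQ.continuousAt.eventually_lt (continuous_const.mul (hc t)).continuousAt (hlt t hit)
      filter_upwards [this] with z hz _ using hz
  have e2 : ∀ᶠ z in 𝓝 p, ∀ t, i ≠ t → ¬ InWedge v κ z i t := by
    rw [eventually_all]
    intro t
    by_cases hit : i = t
    · exact Eventually.of_forall fun z h => absurd hit h
    · have c1 : Continuous fun z => -(2 * (bary v i z + bary v t z)) :=
        (continuous_const.mul ((hc i).add (hc t))).neg
      have c2 : Continuous fun z => (2 + κ i t) * |bary v i z - bary v t z| :=
        continuous_const.mul ((hc i).sub (hc t)).abs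
      have := c1.continuousAt.eventually_lt c2.continuousAt (hwlt t hit)
      filter_upwards [this] with z hz _ using not_lt.2 hz.le
  filter_upwards [e1, e2] with z h1 h2 hz
  have hzS : quadForm v z = 2 * bary v i z := (hv.dist_vertex_eq z i).1 hz
  refine hv.mem_peaBody_of_sphere hκ hzS (fun t => ?_) h2
  rcases eq_or_ne i t with rfl | hit
  · exact hzS.le
  · exact (h1 t hit).le

/-- From a point of the sphere inside the wedge one can leave the Reuleaux tetrahedron inside the
wedge. -/
lemma Regular.exists_path (hv : Regular v) (hκ : Weights κ) (h : Quad i j l m) {p : E3}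
    (hS : quadForm v p = 2 * bary v i p) (hT : InReuleaux v p) (hw : InWedge v κ p i j) :
    ∃ P : Set E3, IsPreconnected P ∧ p ∈ P ∧
      (∀ z ∈ P, quadForm v z = 2 * bary v i z ∧ InWedge v κ z i j) ∧ ∃ z ∈ P, ¬ InReuleaux v z := by
  obtain ⟨hi, hj⟩ := hw.neg hκ h.1
  have hk := hκ.pos i j h.1
  have hS' := hS
  have hsum := sum_bary_quad (v := v) h p
  rw [quadForm_quad h] at hS'
  have hTj := hT j
  unfold InWedge at hw
  obtain ⟨H, hH⟩ : ∃ H, H = bary v i p + bary v j p := ⟨_, rfl⟩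
  obtain ⟨τ₀, hτ₀⟩ : ∃ τ₀, τ₀ = bary v i p - bary v j p := ⟨_, rfl⟩
  obtain ⟨δ, hδ⟩ : ∃ δ, δ = bary v l p - bary v m p := ⟨_, rfl⟩
  rw [← hH, ← hτ₀] at hw
  have hH0 : H < 0 := by linarith
  have hτ0 : τ₀ ≤ 0 := by linarith
  have f1 : bary v i p = (H + τ₀) / 2 := by linarith
  have f2 : bary v j p = (H - τ₀) / 2 := by linarith
  have f3 : bary v l p = (1 - H + δ) / 2 := by linarith
  have f4 : bary v m p = (1 - H - δ) / 2 := by linarith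
  have heq : 2 * (1 - H) ^ 2 = 3 + 2 * τ₀ - τ₀ ^ 2 - δ ^ 2 := by
    rw [f1, f2, f3, f4] at hS'
    linarith
  -- Any small positive value of α_i - α_j leaves the Reuleaux tetrahedron, because on the sphere
  -- about `v i` the inequality for `j` reads α_i ≤ α_j. With this choice (2 + κ) ε = -H < -2H, so
  -- the wedge is not left.
  set ε := -H / (2 + κ i j) with hε
  have hε0 : 0 < ε := div_pos (by linarith) (by linarith)
  have hεk : (2 + κ i j) * ε = -H := by rw [hε]; field_simp
  have hε1 : ε ≤ 1 := by
    have : -H ≤ 1 / 4 := by nlinarith [sq_nonneg τ₀, sq_nonneg δ, sq_nonneg H]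
    nlinarith
  -- The path keeps α_l - α_m = δ and varies τ = α_i - α_j. The equation of the sphere is solved for
  -- α_i + α_j = g τ, which does not exceed its initial value `H`.
  set g : ℝ → ℝ := fun τ => 1 - √((3 + 2 * τ - τ ^ 2 - δ ^ 2) / 2) with hg
  have hgc : Continuous g := by rw [hg]; fun_prop
  set γ : ℝ → E3 := fun τ => ((g τ + τ) / 2) • v i + ((g τ - τ) / 2) • v j +
    ((1 - g τ + δ) / 2) • v l + ((1 - g τ - δ) / 2) • v m with hγ
  have hγc : Continuous γ := by rw [hγ]; fun_prop
  have hb : ∀ τ, bary v i (γ τ) = (g τ + τ) / 2 ∧ bary v j (γ τ) = (g τ - τ) / 2 ∧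
      bary v l (γ τ) = (1 - g τ + δ) / 2 ∧ bary v m (γ τ) = (1 - g τ - δ) / 2 :=
    fun τ => hv.bary_comb_quad h (by ring)
  have hrad : ∀ τ ∈ Icc τ₀ ε, (1 - H) ^ 2 ≤ (3 + 2 * τ - τ ^ 2 - δ ^ 2) / 2 := by
    rintro τ ⟨h1, h2⟩
    nlinarith [mul_nonneg (sub_nonneg.2 h1) (show 0 ≤ 2 - τ - τ₀ by linarith)]
  have hgle : ∀ τ ∈ Icc τ₀ ε, g τ ≤ H := by
    intro τ hτ
    have := Real.le_sqrt_of_sq_le (hrad τ hτ)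
    simp only [hg]; linarith
  have hg0 : g τ₀ = H := by
    simp only [hg]
    rw [show (3 + 2 * τ₀ - τ₀ ^ 2 - δ ^ 2) / 2 = (1 - H) ^ 2 by linarith,
      Real.sqrt_sq (by linarith)]
    ring
  have hγS : ∀ τ ∈ Icc τ₀ ε, quadForm v (γ τ) = 2 * bary v i (γ τ) := by
    intro τ hτ
    obtain ⟨b1, b2, b3, b4⟩ := hb τ
    rw [quadForm_quad h, b1, b2, b3, b4]
    have h1 : (1 - g τ) ^ 2 = (3 + 2 * τ - τ ^ 2 - δ ^ 2) / 2 := by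
      simp only [hg, sub_sub_cancel]
      exact Real.sq_sqrt ((sq_nonneg _).trans (hrad τ hτ))
    linear_combination h1
  refine ⟨γ '' Icc τ₀ ε, isPreconnected_Icc.image _ hγc.continuousOn, ?_, ?_, ?_⟩
  · refine ⟨τ₀, ⟨le_rfl, by linarith⟩, ?_⟩
    apply hv.bary_ext
    intro t
    obtain ⟨b1, b2, b3, b4⟩ := hb τ₀
    rw [hg0] at b1 b2 b3 b4
    rcases h.cases t with rfl | rfl | rfl | rfl
    · rw [b1, f1]
    · rw [b2, f2]
    · rw [b3, f3]
    · rw [b4, f4]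
  · rintro _ ⟨τ, hτ, rfl⟩
    refine ⟨hγS τ hτ, ?_⟩
    obtain ⟨b1, b2, -, -⟩ := hb τ
    have h1 := hgle τ hτ
    unfold InWedge
    rw [b1, b2, show (g τ + τ) / 2 - (g τ - τ) / 2 = τ by ring,
      show (g τ + τ) / 2 + (g τ - τ) / 2 = g τ by ring]
    have h2 : (2 + κ i j) * |τ| < -(2 * H) := by
      rcases abs_cases τ with ⟨h3, _⟩ | ⟨h3, _⟩
      · rw [h3]
        have := mul_le_mul_of_nonneg_left hτ.2 (show 0 ≤ 2 + κ i j by linarith)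
        linarith
      · rw [abs_of_nonpos hτ0] at hw
        rw [h3]
        have := mul_le_mul_of_nonneg_left hτ.1 (show 0 ≤ 2 + κ i j by linarith)
        linarith
    linarith
  · refine ⟨γ ε, ⟨ε, ⟨by linarith, le_rfl⟩, rfl⟩, fun hcon => ?_⟩
    have h1 := hcon j
    rw [hγS ε ⟨by linarith, le_rfl⟩] at h1
    obtain ⟨b1, b2, -, -⟩ := hb ε
    rw [b1, b2] at h1
    linarith

/-- The spherical caps are the parts of the spheres about the vertices that lie in the body. -/
theorem Regular.cap_eq (hv : Regular v) (hκ : Weights κ) (i : Fin 4) {T : Set E3}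
    (hTdef : ∀ z, z ∈ T ↔ InReuleaux v z) :
    cap T (v i) (gammaSet v κ i) = sphere (v i) 2 ∩ peaBody v κ := by
  have hTcl : IsClosed T := by
    have : T = ⋂ t, {z | quadForm v z ≤ 2 * bary v t z} := by
      ext z; rw [hTdef]; simp [InReuleaux]
    rw [this]
    exact isClosed_iInter fun t =>
      isClosed_le (continuous_quadForm v) (continuous_const.mul (continuous_bary v t))
  have hΓ := hv.gammaSet_subset hκ i
  have hKcl : IsClosed (peaBody v κ) := isClosed_ballHull _
  apply Subset.antisymm
  · rintro x (hx | ⟨⟨hxS, hxΓ⟩, hcomp⟩)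
    · exact hΓ hx
    refine ⟨hxS, ?_⟩
    by_contra hxK
    have hxT : InReuleaux v x :=
      (hTdef x).1 (hTcl.frontier_subset (hcomp (mem_connectedComponentIn ⟨hxS, hxΓ⟩)))
    have hS : quadForm v x = 2 * bary v i x := (hv.dist_vertex_eq x i).1 hxS
    obtain ⟨j, hij, hw⟩ : ∃ j, i ≠ j ∧ InWedge v κ x i j := by
      by_contra! hcon
      exact hxK (hv.mem_peaBody_of_sphere hκ hS hxT hcon)
    obtain ⟨l, m, hq⟩ := exists_quad hij
    -- The path stays in the wedge, hence outside the body and off the curves. So it remains in the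
    -- component of `x`, although it leaves the Reuleaux tetrahedron.
    obtain ⟨P, hP, hxP, hPw, z, hzP, hz⟩ := hv.exists_path hκ hq hS hxT hw
    have hsub : P ⊆ sphere (v i) 2 \ gammaSet v κ i := by
      intro y hy
      obtain ⟨h1, h2⟩ := hPw y hy
      exact ⟨(hv.dist_vertex_eq y i).2 h1, fun h3 => hv.notMem_of_inWedge hκ hij h1 h2 (hΓ h3).2⟩
    exact hz ((hTdef z).1 (hTcl.frontier_subset
      (hcomp (hP.subset_connectedComponentIn hxP hsub hzP))))
  · rintro x ⟨hxS, hxK⟩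
    by_cases hxΓ : x ∈ gammaSet v κ i
    · exact Or.inl hxΓ
    refine Or.inr ⟨⟨hxS, hxΓ⟩, ?_⟩
    set A := sphere (v i) 2 \ gammaSet v κ i with hA
    -- Off the curves, the part of the sphere in the body is both open and closed, so it contains
    -- the whole component.
    have hsubK : connectedComponentIn A x ⊆ peaBody v κ := by
      intro y hy
      by_contra hyK
      obtain ⟨z, hz, hz1, hz2⟩ := isPreconnected_connectedComponentIn (F := A) (x := x)
        (interior {z | z ∈ sphere (v i) 2 → z ∈ peaBody v κ}) (peaBody v κ)ᶜ
        isOpen_interior hKcl.isOpen_compl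
        (fun z hz => by
          have hzA := connectedComponentIn_subset _ _ hz
          by_cases hzK : z ∈ peaBody v κ
          · left
            exact mem_interior_iff_mem_nhds.2
              (hv.eventually_mem_of_sphere hκ hzK hzA.1 hzA.2)
          · exact Or.inr hzK)
        ⟨x, mem_connectedComponentIn ⟨hxS, hxΓ⟩, mem_interior_iff_mem_nhds.2
          (hv.eventually_mem_of_sphere hκ hxK hxS hxΓ)⟩
        ⟨y, hy, hyK⟩
      exact hz2 (interior_subset hz1 (connectedComponentIn_subset _ _ hz).1)
    intro y hy
    have hyS := (connectedComponentIn_subset _ _ hy).1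
    refine ⟨subset_closure ((hTdef y).2 (hv.inReuleaux_of_mem (hsubK hy))), fun hyi => ?_⟩
    have hTb : T ⊆ closedBall (v i) 2 := fun z hz =>
      (hv.dist_vertex_le z i).2 ((hTdef z).1 hz i)
    have := interior_mono hTb hyi
    rw [interior_closedBall _ two_ne_zero, mem_ball, mem_sphere.1 hyS] at this
    exact lt_irrefl _ this

/-- The boundary of the body consists of the wedge surfaces and the caps. -/
theorem Regular.frontier_eq (hv : Regular v) (hκ : Weights κ) (p : E3) :
    p ∈ frontier (peaBody v κ) ↔
      (∃ i j l m ξ s ξ' s', Quad i j l m ∧ OnArc (κ i j) ξ s ∧ OnArc (κ l m) ξ' s' ∧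
        p = tip (arcPt v i j l m ξ s) (arcPt v l m i j ξ' s') (κ i j * s)) ∨
      ∃ i, p ∈ sphere (v i) 2 ∩ peaBody v κ := by
  rw [mem_frontier_peaBody hκ]
  constructor
  · rintro ⟨hp, c, hc, h⟩
    by_cases hpv : p ∈ range v
    · obtain ⟨t, rfl⟩ := hpv
      right
      obtain ⟨r, hr⟩ : ∃ r, t ≠ r := by clear * -; revert t; decide
      exact ⟨r, hv t r hr, hp⟩
    · rcases hv.active_cases hc h with ⟨t, rfl, ht⟩ | ⟨i, j, l, m, ξ, s, hq, ha, hs, rfl, hg⟩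
      · exact Or.inr ⟨t, (hv.dist_vertex_eq p t).2 ht, hp⟩
      · left
        obtain ⟨ξ', s', ha', hpt⟩ := hv.eq_tip_of_active hκ hq hp hpv ha hs hg
        exact ⟨l, m, i, j, ξ', s', ξ, s, hq.opp, ha', ha, hpt⟩
  · rintro (⟨i, j, l, m, ξ, s, ξ', s', hq, ha, ha', rfl⟩ | ⟨i, hpS, hp⟩)
    · have hk := hκ.pos i j hq.1
      have hk' := hκ.pos l m hq.opp.1
      have hc : ((arcPt v l m i j ξ' s', κ l m * s') : E3 × ℝ) ∈ peas v κ :=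
        ⟨l, m, i, j, ξ', s', hq.opp, ha', rfl⟩
      refine ⟨hv.tip_mem hκ hq ha ha', _, hc, ?_⟩
      simp only
      rw [dist_tip' (hv.arcPt_ne hκ hq ha ha') (mul_nonneg hk.le ha.1),
        hv.dist_arcPt_opp hq hk hk' (hκ.prod _ _ _ _ hq) ha ha']
      ring
    · obtain ⟨j, hj⟩ : ∃ j, i ≠ j := by clear * -; revert i; decide
      obtain ⟨l, m, hq⟩ := exists_quad hj
      have hc : ((arcPt v i j l m 1 0, κ i j * 0) : E3 × ℝ) ∈ peas v κ :=
        ⟨i, j, l, m, 1, 0, hq, onArc_one _, rfl⟩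
      refine ⟨hp, _, hc, ?_⟩
      simp only
      rw [arcPt_one, mul_zero, add_zero]
      exact hpS

/-- The vertices are vertex singularities. -/
theorem Regular.isVertexSingularity (hv : Regular v) (hκ : Weights κ) (t : Fin 4) :
    IsVertexSingularity (peaBody v κ) (v t) := by
  obtain ⟨r, hr⟩ : ∃ r, t ≠ r := by clear * -; revert t; decide
  refine ⟨(hv.frontier_eq hκ _).2 (Or.inr ⟨r, hv t r hr, hv.vertex_mem hκ t⟩), ?_⟩
  -- An open cone consisting of normals at `v t`: the body lies in the cone at `v t` where α_i - α_t
  -- + 1 ≥ 0 for all other `i`.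
  set N : Set E3 := {u | ∀ i, i ≠ t → inner ℝ u (v i - centroid4 v) < 0} with hN
  have hopen : IsOpen N := by
    have : N = ⋂ i, {u | i ≠ t → inner ℝ u (v i - centroid4 v) < 0} := by ext; simp [hN]
    rw [this]
    refine isOpen_iInter_of_finite fun i => ?_
    by_cases hi : i = t
    · simp [hi]
    · simp only [ne_eq, hi, not_false_eq_true, forall_true_left]
      exact isOpen_lt (by fun_prop) continuous_const
  refine ⟨v t - centroid4 v, mem_interior.2 ⟨N, ?_, hopen, fun i hi => ?_⟩⟩
  · intro u hu x hx
    have hT := hv.inReuleaux_of_mem hx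
    obtain ⟨l, m, hq⟩ := exists_quad hr
    have hQ := quadForm_quad (v := v) hq x
    have hle : ∀ i, i ≠ t → 0 ≤ bary v i x - bary v t x + 1 := by
      -- The hypotheses give (y - 1)² + z² ≤ 2, hence |(y - 1) - z| ≤ 2.
      have aux : ∀ y z Q : ℝ, y ^ 2 + z ^ 2 - 1 ≤ Q → Q ≤ 2 * y → 0 ≤ y - z + 1 := by
        intro y z Q h1 h2
        by_contra! h3
        rcases le_or_gt 0 (1 + y) with h4 | h4 <;> nlinarith
      have hsq := fun i => sq_nonneg (bary v i x)
      intro i hi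
      apply aux _ _ _ _ (hT i)
      rcases hq.cases i with rfl | rfl | rfl | rfl
      · exact absurd rfl hi
      · linarith [hsq l, hsq m]
      · linarith [hsq r, hsq m]
      · linarith [hsq r, hsq l]
    have hzero : inner ℝ u (v t - centroid4 v) + inner ℝ u (v r - centroid4 v) +
        inner ℝ u (v l - centroid4 v) + inner ℝ u (v m - centroid4 v) = (0 : ℝ) := by
      rw [← hq.sum (fun i => inner ℝ u (v i - centroid4 v)), ← inner_sum, sum_sub_centroid,
        inner_zero_right]
    have hw : ∀ i, inner ℝ (x - v t) (v i - centroid4 v) = 2 * (bary v i x - bary v i (v t)) := by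
      intro i; rw [bary_sub]; ring
    obtain ⟨n1, n2, n3, -⟩ := id hq
    rw [hv.inner_eq, hq.sum]
    simp only [hw, hv.bary_vertex, n1.symm, n2.symm, n3.symm, if_true, if_false]
    rw [show inner ℝ u (v t - centroid4 v) = -(inner ℝ u (v r - centroid4 v) +
      inner ℝ u (v l - centroid4 v) + inner ℝ u (v m - centroid4 v)) by linarith]
    nlinarith [mul_nonneg (neg_nonneg.2 (hu r n1.symm).le) (hle r n1.symm),
      mul_nonneg (neg_nonneg.2 (hu l n2.symm).le) (hle l n2.symm),
      mul_nonneg (neg_nonneg.2 (hu m n3.symm).le) (hle m n3.symm)]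
  · rw [hv.inner_sub_centroid, if_neg hi.symm]; norm_num

end Boundary

/-! ### Algebra of confocal pairs: the products and signs of the slopes. -/

section ConfocalAlgebra

/-- Two quadratic polynomials with two common roots are proportional. -/
lemma quadratics_proportional {A B C A' B' C' X Y : ℝ} (hXY : X ≠ Y)
    (h1 : A * X ^ 2 + B * X + C = 0) (h2 : A * Y ^ 2 + B * Y + C = 0)
    (h3 : A' * X ^ 2 + B' * X + C' = 0) (h4 : A' * Y ^ 2 + B' * Y + C' = 0) :
    B = -(A * (X + Y)) ∧ C = A * (X * Y) ∧ B' = -(A' * (X + Y)) ∧ C' = A' * (X * Y) := by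
  have hd : X - Y ≠ 0 := sub_ne_zero.2 hXY
  have e1 : B = -(A * (X + Y)) := by
    apply mul_left_cancel₀ hd; linear_combination h1 - h2
  have e2 : B' = -(A' * (X + Y)) := by
    apply mul_left_cancel₀ hd; linear_combination h3 - h4
  refine ⟨e1, ?_, e2, ?_⟩
  · rw [e1] at h1; linear_combination h1
  · rw [e2] at h3; linear_combination h3

/-- Algebra of a pair of confocal central conics. -/
lemma confocal_central {k k' P P' Q Q' r r' : ℝ} (hr : 0 < r)
    (hr2 : r ^ 2 = 1 + 8 * P ^ 2) (hr2' : r' ^ 2 = 1 + 8 * P' ^ 2)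
    (hkP : k * P ≤ 0) (hPQ : P ≠ Q) (hPQ' : P' ≠ Q')
    (hQ : (r * k - 8 * P + 8 * Q) ^ 2 = k ^ 2 * (1 + 8 * Q ^ 2))
    (hQ' : (r' * k' - 8 * P' + 8 * Q') ^ 2 = k' ^ 2 * (1 + 8 * Q' ^ 2))
    (s1 : 8 * (-1 / 2 - P - P') ^ 2 = (r' - k' * (-1 / 2 - P)) ^ 2)
    (s2 : 8 * (-1 / 2 - Q - P') ^ 2 = (r' - k' * (-1 / 2 - Q)) ^ 2)
    (s3 : 8 * (-1 / 2 - P' - P) ^ 2 = (r - k * (-1 / 2 - P')) ^ 2)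
    (s4 : 8 * (-1 / 2 - Q' - P) ^ 2 = (r - k * (-1 / 2 - Q')) ^ 2) :
    (r * k - 8 * P - 4) ^ 2 = 4 * k ^ 2 ∧ (k * k') ^ 2 = 64 ∧
      (r' * k' - 8 * P' - 4) * k ^ 2 = 8 * (r * k - 8 * P - 4) := by
  obtain ⟨L, hL⟩ : ∃ L, L = r * k - 8 * P := ⟨_, rfl⟩
  obtain ⟨L', hL'⟩ : ∃ L', L' = r' * k' - 8 * P' := ⟨_, rfl⟩
  rw [← hL] at hQ ⊢
  rw [← hL'] at hQ' ⊢
  have hP : (L + 8 * P) ^ 2 = k ^ 2 * (1 + 8 * P ^ 2) := by rw [← hr2, hL]; ring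
  have hP' : (L' + 8 * P') ^ 2 = k' ^ 2 * (1 + 8 * P' ^ 2) := by rw [← hr2', hL']; ring
  obtain ⟨a, ha⟩ : ∃ a, a = k ^ 2 - 8 := ⟨_, rfl⟩
  obtain ⟨a', ha'⟩ : ∃ a', a' = k' ^ 2 - 8 := ⟨_, rfl⟩
  have hk2 : k ^ 2 = a + 8 := by linarith
  have hk2' : k' ^ 2 = a' + 8 := by linarith
  have aux : ∀ {h r' k' P' L' a' : ℝ}, r' ^ 2 = 1 + 8 * P' ^ 2 → L' = r' * k' - 8 * P' →
      a' = k' ^ 2 - 8 → 8 * (h - P') ^ 2 = (r' - k' * h) ^ 2 → 1 - 2 * L' * h + a' * h ^ 2 = 0 := by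
    intro h r' k' P' L' a' h1 h2 h3 h4
    rw [h2, h3]; linear_combination (-1) * h4 - h1
  have t1 := aux hr2' hL' ha' s1
  have t2 := aux hr2' hL' ha' s2
  have t3 := aux hr2 hL ha s3
  have t4 := aux hr2 hL ha s4
  -- `P` and `Q` are roots of two quadratics: the focus equation (L + 8X)² = k² (1 + 8X²) of their
  -- own conic, and the equation saying that the point at height -1/2 - X is on the other conic.
  obtain ⟨u1, u2, u3, u4⟩ := quadratics_proportional (A := -(8 * a)) (B := 16 * L)
    (C := L ^ 2 - k ^ 2) (A' := a') (B' := 2 * L' + a') (C' := 1 + L' + a' / 4) hPQ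
    (by rw [ha]; linear_combination hP) (by rw [ha]; linear_combination hQ)
    (by linear_combination t1) (by linear_combination t2)
  obtain ⟨w1, w2, w3, w4⟩ := quadratics_proportional (A := -(8 * a')) (B := 16 * L')
    (C := L' ^ 2 - k' ^ 2) (A' := a) (B' := 2 * L + a) (C' := 1 + L + a / 4) hPQ'
    (by rw [ha']; linear_combination hP') (by rw [ha']; linear_combination hQ')
    (by linear_combination t3) (by linear_combination t4)
  have ha0 : a ≠ 0 := by
    intro h
    rw [h] at w3 w4
    have : L = 0 := by linarith
    rw [this] at w4; norm_num at w4
  have hdisc : L ^ 2 - a ≠ 0 := by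
    have : L ^ 2 - a = 8 * (P * k - r) ^ 2 := by
      rw [hL, ha]; linear_combination (k ^ 2 - 8) * hr2
    rw [this]
    have : P * k - r ≠ 0 := by
      rw [mul_comm] at hkP; exact (by linarith : P * k - r < 0).ne
    positivity
  obtain ⟨c, hc⟩ : ∃ c, a' = -(8 * a) * c := ⟨a' / (-(8 * a)), by field_simp⟩
  have e1 : 2 * L' + a' = 16 * c * L := by rw [u3, hc]; linear_combination (-c) * u1
  have e2 : 1 + L' + a' / 4 = c * (L ^ 2 - k ^ 2) := by rw [u4, hc]; linear_combination (-c) * u2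
  have hL'eq : L' = 4 * c * (2 * L + a) := by rw [hc] at e1; linear_combination (1 / 2) * e1
  have e3 : c * ((L - 4) ^ 2 - 3 * k ^ 2) = 1 := by
    rw [hL'eq, hc] at e2; rw [hk2] at e2 ⊢; linear_combination (-1) * e2
  have hc0 : c ≠ 0 := by rintro rfl; norm_num at e3
  have e4 : 64 * c * (1 + L + a / 4) = L' ^ 2 - k' ^ 2 := by
    rw [w4, w2, hc]; ring
  have e5 : L ^ 2 - 2 * a = 2 * c * (2 * L + a) ^ 2 := by
    apply mul_left_cancel₀ hc0
    rw [hk2', hL'eq, hc] at e4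
    rw [hk2] at e3
    linear_combination (1 / 8) * e4 + e3
  -- Eliminating the factor `c` between `e3` and `e5`. The first factor equals 8 (P k - r)², which
  -- is nonzero because k P ≤ 0 < r.
  have e6 : (L ^ 2 - a) * ((L - 4) ^ 2 - 4 * k ^ 2) = 0 := by
    have : (L ^ 2 - 2 * a) * ((L - 4) ^ 2 - 3 * k ^ 2) = 2 * (2 * L + a) ^ 2 := by
      rw [e5]; linear_combination 2 * (2 * L + a) ^ 2 * e3
    rw [hk2] at this ⊢
    linear_combination this
  have e7 : (L - 4) ^ 2 - 4 * k ^ 2 = 0 := (mul_eq_zero.1 e6).resolve_left hdisc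
  have e8 : c * k ^ 2 = 1 := by linear_combination e3 - c * e7
  refine ⟨by linarith, ?_, ?_⟩
  · rw [mul_pow, hk2', hc]
    rw [hk2] at e8 ⊢
    linear_combination (-8 * a) * e8
  · rw [hL'eq]
    rw [hk2] at e8 ⊢
    linear_combination (4 * (2 * L + a)) * e8

/-- Algebra of a pair of confocal parabolas. -/
lemma confocal_parabolic {k k' P P' r r' : ℝ}
    (hr2 : r ^ 2 = 1 + 8 * P ^ 2) (hr2' : r' ^ 2 = 1 + 8 * P' ^ 2)
    (hk : k ^ 2 = 8) (hk' : k' ^ 2 = 8)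
    (s1 : 8 * (-1 / 2 - P - P') ^ 2 = (r' - k' * (-1 / 2 - P)) ^ 2)
    (s3 : 8 * (-1 / 2 - P' - P) ^ 2 = (r - k * (-1 / 2 - P')) ^ 2) :
    (r * k - 8 * P - 4) ^ 2 = 4 * k ^ 2 ∧ (k * k') ^ 2 = 64 ∧
      (r' * k' - 8 * P' - 4) * k ^ 2 = 8 * (r * k - 8 * P - 4) := by
  obtain ⟨L, hL⟩ : ∃ L, L = r * k - 8 * P := ⟨_, rfl⟩
  obtain ⟨L', hL'⟩ : ∃ L', L' = r' * k' - 8 * P' := ⟨_, rfl⟩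
  have hP : 16 * L * P + L ^ 2 - 8 = 0 := by
    rw [hL]; linear_combination r ^ 2 * hk + 8 * hr2
  have hP' : 16 * L' * P' + L' ^ 2 - 8 = 0 := by
    rw [hL']; linear_combination r' ^ 2 * hk' + 8 * hr2'
  have t1 : 1 + L' + 2 * L' * P = 0 := by
    rw [hL']; linear_combination (-1) * s1 - hr2' - (1 / 2 + P) ^ 2 * hk'
  have t3 : 1 + L + 2 * L * P' = 0 := by
    rw [hL]; linear_combination (-1) * s3 - hr2 - (1 / 2 + P') ^ 2 * hk
  rw [← hL, ← hL']
  have h0 : L ≠ 0 := by rintro h; rw [h] at hP; norm_num at hP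
  have h0' : L' ≠ 0 := by rintro h; rw [h] at hP'; norm_num at hP'
  have e1 : 8 * L + 8 * L * L' + L' * (8 - L ^ 2) = 0 := by
    linear_combination 8 * L * t1 - L' * hP
  have e2 : 8 * L' + 8 * L * L' + L * (8 - L' ^ 2) = 0 := by
    linear_combination 8 * L' * t3 - L * hP'
  have e3 : (L * L') * (L - L') = 0 := by linear_combination e2 - e1
  have e4 : L' = L := by
    rcases mul_eq_zero.1 e3 with h | h
    · exact absurd h (mul_ne_zero h0 h0')
    · linarith
  rw [e4] at e1 ⊢
  have e5 : L ^ 2 = 8 * L + 16 := by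
    apply mul_left_cancel₀ h0; linear_combination (-1) * e1
  refine ⟨by rw [hk]; linear_combination e5, by rw [mul_pow, hk, hk']; norm_num, by rw [hk]; ring⟩

/-- The mixed sign pattern is impossible. -/
lemma sign_mixed_absurd {k k' P P' r r' : ℝ} (hr' : 0 < r')
    (hkP : k * P ≤ 0) (hkP' : k' * P' ≤ 0) (hkk : k * k' = -8)
    (h1 : r * k - 8 * P = 4 + 2 * k) (h2 : r' * k' - 8 * P' = 4 - 2 * k')
    (hb : 0 ≤ k' * (-1 / 2 - P) ∨ k * (-1 / 2 - P') ≤ r) : False := by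
  have hk0 : k ≠ 0 := by rintro rfl; norm_num at hkk
  -- For k > 0 the signs alone contradict `h2`. For k < 0 the first alternative of `hb` contradicts
  -- P ≥ 0; the second gives r' + 2 ≤ r, whereas `h1` forces r < 2.
  rcases lt_or_gt_of_ne hk0 with hk | hk
  · have hk' : 0 < k' := by nlinarith
    have hP : 0 ≤ P := by nlinarith
    rcases hb with hb | hb
    · nlinarith
    · have e1 : k * (-1 / 2 - P') = r' + 2 := by
        have : k * (8 * P' + 4) = k * (k' * (r' + 2)) := by rw [show 8 * P' + 4 = k' * (r' + 2) by linarith]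
        rw [← mul_assoc, hkk] at this
        linarith
      have e2 : k * (r - 2) = 4 + 8 * P := by linarith
      nlinarith
  · have hk' : k' < 0 := by nlinarith
    have hP' : 0 ≤ P' := by nlinarith
    nlinarith

lemma one_le_of_sq_eq {P r : ℝ} (hr : 0 < r) (hr2 : r ^ 2 = 1 + 8 * P ^ 2) : 1 ≤ r := by
  nlinarith [sq_nonneg P]

/-- Since r ≥ 1, (r - 1)² ≤ r² - 1 = 8 P². -/
lemma sub_one_le_of_sq_eq {P r w : ℝ} (hr : 0 < r) (hr2 : r ^ 2 = 1 + 8 * P ^ 2) (hw0 : 0 < w)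
    (hw : w ^ 2 = 8) (hP : 0 ≤ P) : r - 1 ≤ w * P := by
  have := one_le_of_sq_eq hr hr2
  apply (abs_le_of_sq_le_sq' _ (by positivity)).2
  rw [mul_pow, hw]; linarith

lemma neg_of_mul_pos_of_neg {x y : ℝ} (hx : x < 0) (h : 0 < x * y) : y < 0 := by nlinarith

lemma nonneg_of_mul_nonpos_of_neg {x y : ℝ} (hx : x < 0) (h : x * y ≤ 0) : 0 ≤ y := by nlinarith

lemma pos_of_mul_pos_of_pos {x y : ℝ} (hx : 0 < x) (h : 0 < x * y) : 0 < y := by nlinarith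

/-- The signs in a convex confocal pair. -/
lemma confocal_signs {k k' P P' r r' : ℝ} (hr : 0 < r) (hr' : 0 < r')
    (hr2 : r ^ 2 = 1 + 8 * P ^ 2) (hr2' : r' ^ 2 = 1 + 8 * P' ^ 2)
    (hkP : k * P ≤ 0) (hkP' : k' * P' ≤ 0)
    (h1 : (r * k - 8 * P - 4) ^ 2 = 4 * k ^ 2) (h2 : (k * k') ^ 2 = 64)
    (h3 : (r' * k' - 8 * P' - 4) * k ^ 2 = 8 * (r * k - 8 * P - 4))
    (s1 : 8 * (-1 / 2 - P - P') ^ 2 = (r' - k' * (-1 / 2 - P)) ^ 2)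
    (s3 : 8 * (-1 / 2 - P' - P) ^ 2 = (r - k * (-1 / 2 - P')) ^ 2)
    (hb : (0 ≤ k' * (-1 / 2 - P) ∧ k' * (-1 / 2 - P) ≤ r') ∨
      (0 ≤ k * (-1 / 2 - P') ∧ k * (-1 / 2 - P') ≤ r)) :
    0 < k ∧ 0 < k' ∧ k * k' = 8 ∧ r * k - 8 * P = 4 + 2 * k ∧ r' * k' - 8 * P' = 4 + 2 * k' := by
  have hk0 : k ≠ 0 := by rintro rfl; norm_num at h2
  have hkk : k * k' = 8 ∨ k * k' = -8 := by
    have : (k * k' - 8) * (k * k' + 8) = 0 := by linear_combination h2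
    rcases mul_eq_zero.1 this with h | h
    · left; linarith
    · right; linarith
  have hL : r * k - 8 * P = 4 + 2 * k ∨ r * k - 8 * P = 4 - 2 * k := by
    have : (r * k - 8 * P - 4 - 2 * k) * (r * k - 8 * P - 4 + 2 * k) = 0 := by linear_combination h1
    rcases mul_eq_zero.1 this with h | h
    · left; linarith
    · right; linarith
  obtain ⟨w, hw0, hw⟩ : ∃ w : ℝ, 0 < w ∧ w ^ 2 = 8 :=
    ⟨√8, by positivity, Real.sq_sqrt (by norm_num)⟩
  have hw4 : w < 4 := lt_of_pow_lt_pow_left₀ 2 (by norm_num) (by rw [hw]; norm_num)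
  have hrP : w * |P| < r := by
    apply lt_of_pow_lt_pow_left₀ 2 hr.le
    rw [mul_pow, sq_abs, hw]; linarith
  have hrP' : w * |P'| < r' := by
    apply lt_of_pow_lt_pow_left₀ 2 hr'.le
    rw [mul_pow, sq_abs, hw]; linarith
  have hk2 : k ^ 2 ≠ 0 := pow_ne_zero 2 hk0
  have hdiv : ∀ x y : ℝ, x * k ^ 2 = y * k ^ 2 → x = y := fun x y h => mul_right_cancel₀ hk2 h
  rcases hkk with hkk | hkk <;> rcases hL with hL | hL
  · have hL' : r' * k' - 8 * P' = 4 + 2 * k' := by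
      apply hdiv; rw [hL] at h3; linear_combination h3 - 2 * k * hkk
    rcases lt_or_gt_of_ne hk0 with hk | hk
    -- Both slopes negative: both heights P, P' are nonnegative, and `s1` would give 8 (1/2 + P +
    -- P')² = (r + r' - 2)² ≤ 8 (P + P')².
    · exfalso
      have hk' : k' < 0 := neg_of_mul_pos_of_neg hk (by linarith)
      have hP : 0 ≤ P := nonneg_of_mul_nonpos_of_neg hk hkP
      have hP' : 0 ≤ P' := nonneg_of_mul_nonpos_of_neg hk' hkP'
      have e1 := sub_one_le_of_sq_eq hr hr2 hw0 hw hP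
      have e2 := sub_one_le_of_sq_eq hr' hr2' hw0 hw hP'
      have e3 : r' - k' * (-1 / 2 - P) = r + r' - 2 := by
        have : k' * (4 + 8 * P) = k' * (k * (r - 2)) := by
          rw [show 4 + 8 * P = k * (r - 2) by linarith]
        rw [← mul_assoc, mul_comm k' k, hkk] at this
        linarith
      rw [e3] at s1
      have hr1 := one_le_of_sq_eq hr hr2
      have hr1' := one_le_of_sq_eq hr' hr2'
      have e4 : (r + r' - 2) ^ 2 ≤ (w * (P + P')) ^ 2 :=
        pow_le_pow_left₀ (by linarith) (by linarith) 2
      rw [mul_pow, hw] at e4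
      have e5 : 8 * (-1 / 2 - P - P') ^ 2 = 2 + 8 * (P + P') + 8 * (P + P') ^ 2 := by ring
      linarith
    · exact ⟨hk, pos_of_mul_pos_of_pos hk (by linarith), hkk, hL, hL'⟩
  -- Here `s1` gives w |1/2 + P + P'| = r + r' + 2, while w |P| < r, w |P'| < r' and w / 2 < 2.
  · exfalso
    have hL' : r' * k' - 8 * P' = 4 - 2 * k' := by
      apply hdiv; rw [hL] at h3; linear_combination h3 + 2 * k * hkk
    have e3 : r' - k' * (-1 / 2 - P) = r + r' + 2 := by
      have : k' * (4 + 8 * P) = k' * (k * (r + 2)) := by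
        rw [show 4 + 8 * P = k * (r + 2) by linarith]
      rw [← mul_assoc, mul_comm k' k, hkk] at this
      linarith
    rw [e3] at s1
    have e4 : |w * (-1 / 2 - P - P')| = r + r' + 2 := by
      rw [← abs_of_pos (show 0 < r + r' + 2 by linarith)]
      rw [← sq_eq_sq_iff_abs_eq_abs, mul_pow, hw, s1]
    have e5 : |-1 / 2 - P - P'| ≤ 1 / 2 + |P| + |P'| := by
      rw [abs_le]
      constructor <;> linarith [le_abs_self P, neg_le_abs P, le_abs_self P', neg_le_abs P']
    rw [abs_mul, abs_of_pos hw0] at e4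
    have := mul_le_mul_of_nonneg_left e5 hw0.le
    linarith
  · exfalso
    have hL' : r' * k' - 8 * P' = 4 - 2 * k' := by
      apply hdiv; rw [hL] at h3; linear_combination h3 + 2 * k * hkk
    -- Convexity of the pair, in the form of the bulb condition, is needed only to exclude k k' =
    -- -8. The last case is the same with the two frames exchanged.
    exact sign_mixed_absurd hr' hkP hkP' hkk hL hL' (hb.imp (·.1) (·.2))
  · exfalso
    have hL' : r' * k' - 8 * P' = 4 + 2 * k' := by
      apply hdiv; rw [hL] at h3; linear_combination h3 - 2 * k * hkk
    exact sign_mixed_absurd hr hkP' hkP (by linarith) hL' hL (hb.symm.imp (·.1) (·.2))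

/-- With the normalized parameters, the arc of the frame is the normalized arc. -/
lemma onArc_iff {k P r ξ s : ℝ} (hr : 0 < r) (hr2 : r ^ 2 = 1 + 8 * P ^ 2) (hk : 0 < k)
    (hkP : k * P ≤ 0) (hL : r * k - 8 * P = 4 + 2 * k) :
    (0 ≤ k * s ∧ k * s ≤ r ∧ ξ ^ 2 + 8 * (s - P) ^ 2 = (r - k * s) ^ 2) ↔ OnArc k ξ s := by
  have hP : P ≤ 0 := by nlinarith
  have hr1 : 1 ≤ r := by nlinarith
  constructor
  · rintro ⟨h1, h2, h3⟩
    have hs : 0 ≤ s := by nlinarith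
    refine ⟨hs, ?_, by linear_combination h3 + hr2 - 2 * s * hL⟩
    by_contra! h4
    nlinarith [sq_nonneg ξ, mul_nonneg hs (neg_nonneg.2 hP), sq_nonneg s]
  · intro h
    have h1 := h.eight_mul_le hk
    have h2 := h.1
    have h3 : 0 ≤ k * s := by positivity
    exact ⟨h3, by linarith, by linear_combination h.2.2 - hr2 + 2 * s * hL⟩

end ConfocalAlgebra

/-! ### Coordinates along the beam and the axis of a frame. -/

section FrameCoordinates

variable {a b c d n : E3}

lemma midpoint_eq_half (a b : E3) : midpoint ℝ a b = (1 / 2 : ℝ) • (a + b) := by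
  rw [midpoint_eq_smul_add]; norm_num

/-- The point with coordinates `ξ, s` in the plane through the beam `ab` and the direction `n`. -/
def framePt (a b n : E3) (ξ s : ℝ) : E3 := midpoint ℝ a b + ξ • ((1 / 2 : ℝ) • (a - b)) + s • n

lemma framePt_one (a b n : E3) : framePt a b n 1 0 = a := by
  rw [framePt, midpoint_eq_half]; module

lemma framePt_zero (a b n : E3) : framePt a b n 0 0 = midpoint ℝ a b := by
  rw [framePt]; module

lemma framePt_sub (ξ s ξ' s' : ℝ) :
    framePt a b n ξ s - framePt a b n ξ' s' = (ξ - ξ') • ((1 / 2 : ℝ) • (a - b)) + (s - s') • n := by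
  rw [framePt, framePt]; module

/-- The coordinates of a frame on a beam of length `2` are orthogonal. -/
structure Adapted (a b n : E3) : Prop where
  dist_eq : dist a b = 2
  sq_norm : ‖n‖ ^ 2 = 8
  perp : inner ℝ n (b - a) = 0

lemma Adapted.inner_half (h : Adapted a b n) : inner ℝ ((1 / 2 : ℝ) • (a - b)) n = 0 := by
  rw [inner_smul_left, ← neg_sub b a, inner_neg_left, real_inner_comm, h.perp]; simp

lemma Adapted.norm_half (h : Adapted a b n) : ‖(1 / 2 : ℝ) • (a - b)‖ ^ 2 = 1 := by
  rw [norm_smul, ← dist_eq_norm, h.dist_eq]; norm_num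

lemma Adapted.dist_sq (h : Adapted a b n) (ξ s ξ' s' : ℝ) :
    dist (framePt a b n ξ s) (framePt a b n ξ' s') ^ 2 = (ξ - ξ') ^ 2 + 8 * (s - s') ^ 2 := by
  rw [dist_eq_norm, framePt_sub, norm_add_sq_real, inner_smul_left, inner_smul_right,
    h.inner_half, norm_smul (ξ - ξ'), norm_smul (s - s'), mul_pow, mul_pow, h.norm_half, h.sq_norm,
    Real.norm_eq_abs, Real.norm_eq_abs, sq_abs, sq_abs]
  simp; ring

lemma Adapted.ne_zero (h : Adapted a b n) : n ≠ 0 := by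
  rintro rfl; have := h.sq_norm; norm_num at this

lemma Adapted.inner_framePt_sub (h : Adapted a b n) (ξ s ξ' s' : ℝ) :
    inner ℝ (framePt a b n ξ s - framePt a b n ξ' s') n = 8 * (s - s') := by
  rw [framePt_sub, inner_add_left, inner_smul_left _ _ (ξ - ξ'), h.inner_half, inner_smul_left,
    real_inner_self_eq_norm_sq, h.sq_norm]
  simp; ring

lemma mem_line_iff (x : E3) : x ∈ line[ℝ, a, b] ↔ ∃ τ, x = framePt a b n τ 0 := by
  rw [mem_affineSpan_pair_iff_exists_lineMap_eq]
  constructor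
  · rintro ⟨r, rfl⟩
    refine ⟨1 - 2 * r, ?_⟩
    rw [framePt, midpoint_eq_half, AffineMap.lineMap_apply, vsub_eq_sub, vadd_eq_add]; module
  · rintro ⟨τ, rfl⟩
    refine ⟨(1 - τ) / 2, ?_⟩
    rw [framePt, midpoint_eq_half, AffineMap.lineMap_apply, vsub_eq_sub, vadd_eq_add]; module

lemma Adapted.infDist_eq (h : Adapted a b n) {k : ℝ} (hk : k ^ 2 = 8) (ξ s t : ℝ) {T : Set E3}
    (hT : ∀ x, x ∈ T ↔ ∃ τ, x = framePt a b n τ t) :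
    infDist (framePt a b n ξ s) T = |k * (s - t)| := by
  have key : ∀ τ, dist (framePt a b n ξ s) (framePt a b n τ t) ^ 2
      = (ξ - τ) ^ 2 + |k * (s - t)| ^ 2 := by
    intro τ; rw [h.dist_sq, sq_abs, mul_pow, hk]
  apply le_antisymm
  · have := infDist_le_dist_of_mem (x := framePt a b n ξ s) ((hT _).2 ⟨ξ, rfl⟩)
    refine this.trans (le_of_eq ?_)
    apply (sq_eq_sq₀ dist_nonneg (abs_nonneg _)).1
    rw [key]; ring
  · rw [le_infDist ⟨_, (hT _).2 ⟨ξ, rfl⟩⟩]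
    intro y hy
    obtain ⟨τ, rfl⟩ := (hT _).1 hy
    apply (sq_le_sq₀ (abs_nonneg _) dist_nonneg).1
    rw [key]; linarith [sq_nonneg (ξ - τ)]

lemma Adapted.wOppSide_iff (h : Adapted a b n) {ξ s P : ℝ} (hP : P ≠ 0) :
    (line[ℝ, a, b]).WOppSide (framePt a b n ξ s) (framePt a b n 0 P) ↔ s * P ≤ 0 := by
  constructor
  · rintro ⟨p₁, h1, p₂, h2, hs⟩
    obtain ⟨τ₁, rfl⟩ := (mem_line_iff (n := n) _).1 h1
    obtain ⟨τ₂, rfl⟩ := (mem_line_iff (n := n) _).1 h2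
    obtain ⟨u, α, β, hα, hβ, -, e1, e2⟩ := hs.exists_eq_smul
    rw [vsub_eq_sub] at e1 e2
    have f1 := h.inner_framePt_sub ξ s τ₁ 0
    have f2 := h.inner_framePt_sub τ₂ 0 0 P
    rw [e1, inner_smul_left] at f1
    rw [e2, inner_smul_left] at f2
    simp only [conj_trivial] at f1 f2
    have : -64 * (s * P) = (α * β) * (inner ℝ u n) ^ 2 := by
      linear_combination (8 * P) * f1 - (α * inner ℝ u n) * f2
    have := mul_nonneg (mul_nonneg hα hβ) (sq_nonneg (inner ℝ u n))
    linarith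
  · intro hs
    refine ⟨_, (mem_line_iff (n := n) _).2 ⟨ξ, rfl⟩, _, (mem_line_iff (n := n) _).2 ⟨0, rfl⟩, ?_⟩
    rw [vsub_eq_sub, vsub_eq_sub, framePt_sub, framePt_sub]
    have : (ξ - ξ) • ((1 / 2 : ℝ) • (a - b)) + (s - 0) • n
        = (-(s * P) / P ^ 2) • ((0 - 0 : ℝ) • ((1 / 2 : ℝ) • (a - b)) + (0 - P) • n) := by
      match_scalars
      · ring
      · ring
      · field_simp; ring
    rw [this]
    exact SameRay.sameRay_nonneg_smul_left _ (div_nonneg (by linarith) (sq_nonneg _))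

lemma sbtw_framePt_iff (hn : n ≠ 0) {P Q : ℝ} :
    Sbtw ℝ (framePt a b n 0 P) (midpoint ℝ a b) (framePt a b n 0 Q) ↔ P * Q < 0 := by
  rw [← framePt_zero a b n]
  have inj : ∀ x y : ℝ, framePt a b n 0 x = framePt a b n 0 y ↔ x = y := by
    intro x y
    rw [← sub_eq_zero, framePt_sub, sub_self, zero_smul, zero_add, smul_eq_zero_iff_left hn,
      sub_eq_zero]
  have aff : ∀ x y t : ℝ, AffineMap.lineMap (framePt a b n 0 x) (framePt a b n 0 y) t
      = framePt a b n 0 (x + t * (y - x)) := by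
    intro x y t
    rw [AffineMap.lineMap_apply, vsub_eq_sub, vadd_eq_add, framePt, framePt, framePt]; module
  rw [Sbtw, Wbtw, affineSegment, mem_image, Ne, Ne, inj, inj]
  simp only [aff, inj]
  constructor
  · rintro ⟨⟨t, ⟨h0, h1⟩, ht⟩, hP, hQ⟩
    have hP2 : 0 < P ^ 2 := by have := Ne.symm hP; positivity
    have ht1 : t ≠ 0 := by rintro rfl; apply hP; linarith
    have : t * (P * Q) = -(1 - t) * P ^ 2 := by linear_combination P * ht
    have ht2 : t ≠ 1 := by rintro rfl; apply hQ; linarith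
    have h1' : t < 1 := lt_of_le_of_ne h1 ht2
    have h0' : 0 < t := lt_of_le_of_ne h0 ht1.symm
    by_contra! hc
    have := mul_nonneg h0 hc
    have := mul_pos (sub_pos.2 h1') hP2
    linarith
  · intro h
    have hPQ : 0 < (P - Q) ^ 2 := by nlinarith [sq_nonneg P, sq_nonneg Q]
    have hPQ0 : P - Q ≠ 0 := by rintro h; rw [h] at hPQ; norm_num at hPQ
    refine ⟨⟨P * (P - Q) / (P - Q) ^ 2, ⟨?_, ?_⟩, ?_⟩, ?_, ?_⟩
    · exact div_nonneg (by nlinarith [sq_nonneg P]) hPQ.le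
    · rw [div_le_one hPQ]; nlinarith [sq_nonneg Q]
    · field_simp; ring
    · rintro rfl; norm_num at h
    · rintro rfl; norm_num at h

namespace PeaPod

variable (S : PeaPod a b)

lemma exists_eq_of_mem_plane_direction (hn : n ∈ S.axis.direction) (hn0 : n ≠ 0) {u : E3}
    (hu : u ∈ S.plane.direction) : ∃ α β : ℝ, u = α • (b - a) + β • n := by
  have hba : b - a ≠ 0 := sub_ne_zero.2 S.ne.symm
  have hperp : inner ℝ n (b - a) = 0 := S.perp n hn
  have hli : LinearIndependent ℝ ![b - a, n] := by
    rw [LinearIndependent.pair_iff]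
    intro s t hst
    have h1 := congrArg (inner ℝ n) hst
    have h2 := congrArg (inner ℝ (b - a)) hst
    rw [inner_add_right, inner_smul_right, inner_smul_right, inner_zero_right] at h1 h2
    rw [hperp] at h1
    rw [real_inner_comm, real_inner_comm, real_inner_comm n, hperp] at h2
    have h3 : inner ℝ n n ≠ 0 := inner_self_ne_zero.2 hn0
    have h4 : inner ℝ (b - a) (b - a) ≠ 0 := inner_self_ne_zero.2 hba
    simp only [mul_zero, zero_add, add_zero, mul_eq_zero, h3, h4, or_false] at h1 h2
    exact ⟨h2, h1⟩
  have hle : Submodule.span ℝ (range ![b - a, n]) ≤ S.plane.direction := by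
    rw [Submodule.span_le]
    rintro _ ⟨i, rfl⟩
    fin_cases i
    · exact AffineSubspace.vsub_mem_direction S.right_mem S.left_mem
    · exact AffineSubspace.direction_le S.axis_le_plane hn
  have heq := Submodule.eq_of_le_of_finrank_eq hle
    (by rw [finrank_span_eq_card hli, S.finrank_plane]; rfl)
  rw [← heq, Matrix.range_cons_cons_empty, Submodule.mem_span_pair] at hu
  obtain ⟨α, β, h⟩ := hu
  exact ⟨α, β, h.symm⟩

lemma midpoint_mem_plane : midpoint ℝ a b ∈ S.plane :=
  AffineMap.lineMap_mem _ S.left_mem S.right_mem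

/-- The principal centre is equidistant from the ends of the beam, so its offset from the midpoint
has no component along the beam and is parallel to the axis. -/
lemma midpoint_mem_axis : midpoint ℝ a b ∈ S.axis := by
  obtain ⟨⟨n, hn⟩, hn0, -⟩ := finrank_eq_one_iff'.1 S.finrank_axis
  have hn0 : n ≠ 0 := fun h => hn0 (by simpa using h)
  obtain ⟨α, β, h⟩ := S.exists_eq_of_mem_plane_direction hn hn0
    (AffineSubspace.vsub_mem_direction (S.axis_le_plane S.center_mem) S.midpoint_mem_plane)
  rw [vsub_eq_sub] at h
  have hc : S.center = midpoint ℝ a b + (α • (b - a) + β • n) := by rw [← h]; abel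
  have hd : inner ℝ (S.center - midpoint ℝ a b) (b - a) = 0 := by
    have h1 : dist S.center a ^ 2 = dist S.center b ^ 2 := by rw [S.dist_center]
    rw [dist_eq_norm, dist_eq_norm,
      show S.center - a = (S.center - midpoint ℝ a b) + (1 / 2 : ℝ) • (b - a) by
        rw [midpoint_eq_half]; module,
      show S.center - b = (S.center - midpoint ℝ a b) - (1 / 2 : ℝ) • (b - a) by
        rw [midpoint_eq_half]; module,
      norm_add_sq_real, norm_sub_sq_real _ ((1 / 2 : ℝ) • (b - a)), inner_smul_right] at h1
    linarith
  rw [h, inner_add_left, inner_smul_left, inner_smul_left, S.perp n hn, mul_zero, add_zero] at hd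
  have hα : α = 0 := by
    have := inner_self_ne_zero (𝕜 := ℝ).2 (sub_ne_zero.2 S.ne.symm)
    simpa [this, sub_eq_zero, S.ne.symm] using hd
  have : midpoint ℝ a b = (-β • n) +ᵥ S.center := by
    rw [hc, hα, vadd_eq_add]; module
  rw [this]
  exact AffineSubspace.vadd_mem_of_mem_direction (Submodule.smul_mem _ _ hn) S.center_mem

variable {S}

lemma mem_plane_iff (hn : n ∈ S.axis.direction) (hn0 : n ≠ 0) {x : E3} :
    x ∈ S.plane ↔ ∃ ξ s, x = framePt a b n ξ s := by
  constructor
  · intro hx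
    obtain ⟨α, β, h⟩ := S.exists_eq_of_mem_plane_direction hn hn0
      (AffineSubspace.vsub_mem_direction hx S.midpoint_mem_plane)
    rw [vsub_eq_sub] at h
    refine ⟨-2 * α, β, ?_⟩
    rw [framePt, ← sub_eq_zero, ← sub_sub, ← sub_sub, h]; module
  · rintro ⟨ξ, s, rfl⟩
    have : framePt a b n ξ s = ((-ξ / 2) • (b - a) + s • n) +ᵥ midpoint ℝ a b := by
      rw [framePt, vadd_eq_add]; module
    rw [this]
    exact AffineSubspace.vadd_mem_of_mem_direction (Submodule.add_mem _
      (Submodule.smul_mem _ _ (AffineSubspace.vsub_mem_direction S.right_mem S.left_mem))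
      (Submodule.smul_mem _ _ (AffineSubspace.direction_le S.axis_le_plane hn)))
      S.midpoint_mem_plane

lemma exists_of_mem_axis (hn : n ∈ S.axis.direction) (hn0 : n ≠ 0) {x : E3} (hx : x ∈ S.axis) :
    ∃ s, x = framePt a b n 0 s := by
  have h1 := AffineSubspace.vsub_mem_direction hx S.midpoint_mem_axis
  obtain ⟨s, hs⟩ := (finrank_eq_one_iff_of_nonzero' (⟨n, hn⟩ : S.axis.direction)
    (fun h => hn0 (by simpa using h))).1 S.finrank_axis ⟨_, h1⟩
  have hs' : s • n = x - midpoint ℝ a b := congrArg Subtype.val hs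
  refine ⟨s, ?_⟩
  rw [framePt, hs']; module

end PeaPod

end FrameCoordinates

/-! ### Reduction of the three types of frames to the normalized arc. -/

section NormalForms

variable {a b c d n : E3}

namespace PeaPod

/-- The frame `S` in adapted coordinates: the principal centre is at height `P` on the axis, the
principal radius is `r`, and a pea with centre at height `s` has radius `k * s`. -/
structure NormalForm (S : PeaPod a b) (n : E3) (k P r : ℝ) : Prop where
  adapted : Adapted a b n
  r_pos : 0 < r
  r_sq : r ^ 2 = 1 + 8 * P ^ 2
  mul_nonpos : k * P ≤ 0
  center_eq : S.center = framePt a b n 0 P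
  radius_eq : S.radius = r
  mem_arc : ∀ x, x ∈ S.arc ↔ ∃ ξ s, x = framePt a b n ξ s ∧
    0 ≤ k * s ∧ k * s ≤ r ∧ ξ ^ 2 + 8 * (s - P) ^ 2 = (r - k * s) ^ 2
  of_mem_string : ∀ h, framePt a b n 0 h ∈ S.string → 8 * (h - P) ^ 2 = (r - k * h) ^ 2
  center_mem_foci : S.center ∈ S.foci
  second_focus : k ^ 2 = 8 ∨ ∃ Q, P ≠ Q ∧ framePt a b n 0 Q ∈ S.foci ∧
    (r * k - 8 * P + 8 * Q) ^ 2 = k ^ 2 * (1 + 8 * Q ^ 2)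

/-- In each type the radius of a pea is a linear function k s of its height. The later algebra needs
only `k`, `P`, `r` and, for central conics, the second focus. -/
lemma exists_normalForm (S : PeaPod a b) (hA : Adapted a b n) (hn : n ∈ S.axis.direction) :
    ∃ k P r, S.NormalForm n k P r := by
  have hn0 := hA.ne_zero
  obtain ⟨P, hP⟩ := exists_of_mem_axis hn hn0 S.center_mem
  have dist_a : ∀ X, dist (framePt a b n 0 X) a ^ 2 = 1 + 8 * X ^ 2 := by
    intro X
    have := hA.dist_sq 0 X 1 0
    rw [framePt_one] at this; rw [this]; ring
  have dist_m : ∀ X, dist (framePt a b n 0 X) (midpoint ℝ a b) ^ 2 = 8 * X ^ 2 := by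
    intro X
    have := hA.dist_sq 0 X 0 0
    rw [framePt_zero] at this; rw [this]; ring
  obtain ⟨r, hr⟩ : ∃ r, r = dist (framePt a b n 0 P) a := ⟨_, rfl⟩
  have hrad : S.radius = r := by rw [radius, hP, hr]
  have hr2 : r ^ 2 = 1 + 8 * P ^ 2 := by rw [hr, dist_a]
  have hr0 : 0 < r := lt_of_le_of_ne (hr ▸ dist_nonneg) (by
    rintro rfl; linarith [sq_nonneg P])
  have hspec := S.second_spec
  have hplane : ∀ ξ s, framePt a b n ξ s ∈ S.plane := fun ξ s =>
    (mem_plane_iff hn hn0).2 ⟨ξ, s, rfl⟩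
  rcases hsec : S.second with c' | c' | _
  · rw [hsec] at hspec
    obtain ⟨h1, -, h3, h4⟩ := hspec
    obtain ⟨Q, rfl⟩ := exists_of_mem_axis hn hn0 h1
    rw [hP] at h3 h4
    rw [sbtw_framePt_iff hn0, not_lt] at h3
    have h5 : P ^ 2 < Q ^ 2 := by
      have := pow_lt_pow_left₀ h4 dist_nonneg two_ne_zero
      rw [dist_m, dist_m] at this; linarith
    obtain ⟨R, hR⟩ : ∃ R, R = dist (framePt a b n 0 Q) a := ⟨_, rfl⟩
    have hR2 : R ^ 2 = 1 + 8 * Q ^ 2 := by rw [hR, dist_a]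
    have hR0 : 0 ≤ R := hR ▸ dist_nonneg
    have hPP : P ^ 2 ≤ P * Q := by
      have h6 := (sq_lt_sq.1 h5).le
      rw [← sq_abs, ← abs_of_nonneg h3, abs_mul, sq]
      exact mul_le_mul_of_nonneg_left h6 (abs_nonneg _)
    have hrR : 0 < r + R := by linarith
    -- Subtracting the squares of the two tangency conditions removes the quadratic terms and leaves
    -- ρ (r + R) = 8 (P - Q) s.
    obtain ⟨k, hk⟩ : ∃ k, k * (r + R) = 8 * (P - Q) := ⟨8 * (P - Q) / (r + R), by field_simp⟩
    refine ⟨k, P, r, hA, hr0, hr2, ?_, hP, hrad, ?_, ?_, ?_, Or.inr ⟨Q, ?_, ?_, ?_⟩⟩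
    · by_contra! hc
      have := mul_pos hc hrR
      have : k * P * (r + R) = 8 * (P ^ 2 - P * Q) := by linear_combination P * hk
      linarith
    · intro x
      constructor
      · rintro ⟨ρ, hx, hρ, e1, e2⟩
        obtain ⟨ξ, s, rfl⟩ := (mem_plane_iff hn hn0).1 hx
        rw [hsec] at e2
        simp only at e2
        rw [hP, hrad] at e1
        rw [← hR] at e2
        have d1 := hA.dist_sq ξ s 0 P
        have d2 := hA.dist_sq ξ s 0 Q
        rw [show dist (framePt a b n ξ s) (framePt a b n 0 P) = r - ρ by linarith] at d1
        rw [e2] at d2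
        have : ρ = k * s := by
          apply mul_right_cancel₀ hrR.ne'
          linear_combination (1 / 2) * (d2 - d1 + hr2 - hR2) - s * hk
        subst this
        refine ⟨ξ, s, rfl, hρ, ?_, by rw [d1]; ring⟩
        linarith [dist_nonneg (x := framePt a b n ξ s) (y := framePt a b n 0 P)]
      · rintro ⟨ξ, s, rfl, g1, g2, g3⟩
        refine ⟨k * s, hplane _ _, g1, ?_, ?_⟩
        · rw [hP, hrad]
          have : dist (framePt a b n ξ s) (framePt a b n 0 P) = r - k * s := by
            apply (sq_eq_sq₀ dist_nonneg (by linarith)).1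
            rw [hA.dist_sq, ← g3]; ring
          linarith
        · rw [hsec]
          simp only
          rw [← hR]
          apply (sq_eq_sq₀ dist_nonneg (by linarith)).1
          rw [hA.dist_sq]
          linear_combination g3 - 2 * s * hk + hr2 - hR2
    · intro h hh
      obtain ⟨-, e⟩ := hh
      rw [hsec] at e
      simp only at e
      rw [hP, hrad, ← hR] at e
      have d1 := hA.dist_sq 0 h 0 P
      have d2 := hA.dist_sq 0 h 0 Q
      obtain ⟨D, hD⟩ : ∃ D, D = dist (framePt a b n 0 h) (framePt a b n 0 P) := ⟨_, rfl⟩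
      rw [← hD] at d1 e
      rw [show dist (framePt a b n 0 h) (framePt a b n 0 Q) = r + R - D by linarith] at d2
      have : D = r - k * h := by
        apply mul_right_cancel₀ hrR.ne'
        linear_combination (1 / 2) * (d1 - d2 + hR2 - hr2) + h * hk
      rw [← this, d1]; ring
    · rw [foci, hsec]; exact Or.inl rfl
    · rintro rfl; exact lt_irrefl _ h5
    · rw [foci, hsec]; exact Or.inr rfl
    · rw [← hR2, show r * k - 8 * P + 8 * Q = -(k * R) by linarith]; ring
  · rw [hsec] at hspec
    obtain ⟨h1, -, h3, h4⟩ := hspec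
    obtain ⟨Q, rfl⟩ := exists_of_mem_axis hn hn0 h1
    rw [hP] at h3 h4
    rw [sbtw_framePt_iff hn0] at h3
    obtain ⟨R, hR⟩ : ∃ R, R = dist (framePt a b n 0 Q) a := ⟨_, rfl⟩
    have hR2 : R ^ 2 = 1 + 8 * Q ^ 2 := by rw [hR, dist_a]
    rw [← hr, ← hR] at h4
    have hrR : 0 < R - r := by linarith
    -- The same elimination with internal tangency to both circles gives ρ (R - r) = 8 (Q - P) s.
    obtain ⟨k, hk⟩ : ∃ k, k * (R - r) = 8 * (Q - P) := ⟨8 * (Q - P) / (R - r), by field_simp⟩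
    refine ⟨k, P, r, hA, hr0, hr2, ?_, hP, hrad, ?_, ?_, ?_, Or.inr ⟨Q, ?_, ?_, ?_⟩⟩
    · by_contra! hc
      have := mul_pos hc hrR
      have : k * P * (R - r) = 8 * (P * Q - P ^ 2) := by linear_combination P * hk
      linarith [sq_nonneg P]
    · intro x
      constructor
      · rintro ⟨ρ, hx, hρ, e1, e2⟩
        obtain ⟨ξ, s, rfl⟩ := (mem_plane_iff hn hn0).1 hx
        rw [hsec] at e2
        simp only at e2
        rw [hP, hrad] at e1
        rw [← hR] at e2
        have d1 := hA.dist_sq ξ s 0 P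
        have d2 := hA.dist_sq ξ s 0 Q
        rw [show dist (framePt a b n ξ s) (framePt a b n 0 P) = r - ρ by linarith] at d1
        rw [show dist (framePt a b n ξ s) (framePt a b n 0 Q) = R - ρ by linarith] at d2
        have : ρ = k * s := by
          apply mul_right_cancel₀ hrR.ne'
          linear_combination (-1 / 2) * (d2 - d1 + hr2 - hR2) - s * hk
        subst this
        refine ⟨ξ, s, rfl, hρ, ?_, by rw [d1]; ring⟩
        linarith [dist_nonneg (x := framePt a b n ξ s) (y := framePt a b n 0 P)]
      · rintro ⟨ξ, s, rfl, g1, g2, g3⟩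
        refine ⟨k * s, hplane _ _, g1, ?_, ?_⟩
        · rw [hP, hrad]
          have : dist (framePt a b n ξ s) (framePt a b n 0 P) = r - k * s := by
            apply (sq_eq_sq₀ dist_nonneg (by linarith)).1
            rw [hA.dist_sq, ← g3]; ring
          linarith
        · rw [hsec]
          simp only
          rw [← hR]
          have : dist (framePt a b n ξ s) (framePt a b n 0 Q) = R - k * s := by
            apply (sq_eq_sq₀ dist_nonneg (by linarith)).1
            rw [hA.dist_sq]
            linear_combination g3 + 2 * s * hk + hr2 - hR2
          linarith
    · intro h hh
      obtain ⟨-, e⟩ := hh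
      rw [hsec] at e
      simp only at e
      rw [hP, hrad, ← hR] at e
      have d1 := hA.dist_sq 0 h 0 P
      have d2 := hA.dist_sq 0 h 0 Q
      obtain ⟨D, hD⟩ : ∃ D, D = dist (framePt a b n 0 h) (framePt a b n 0 P) := ⟨_, rfl⟩
      obtain ⟨D', hD'⟩ : ∃ D', D' = dist (framePt a b n 0 h) (framePt a b n 0 Q) := ⟨_, rfl⟩
      rw [← hD] at d1 e
      rw [← hD'] at d2 e
      have : D ^ 2 = (r - k * h) ^ 2 := by
        -- The two branches of the hyperbola give D = ±(r - k h), which agree after squaring.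
        rcases (abs_eq hrR.le).1 e with e | e
        · have : D = r - k * h := by
            apply mul_right_cancel₀ hrR.ne'
            rw [show D' = D + (R - r) by linarith] at d2
            linear_combination (1 / 2) * (d2 - d1 - hR2 + hr2) + h * hk
          rw [this]
        · have : D = -(r - k * h) := by
            apply mul_right_cancel₀ hrR.ne'
            rw [show D' = D - (R - r) by linarith] at d2
            linear_combination (-1 / 2) * (d2 - d1 - hR2 + hr2) - h * hk
          rw [this]; ring
      rw [← this, d1]; ring
    · rw [foci, hsec]; exact Or.inl rfl
    · rintro rfl; linarith [mul_self_nonneg P]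
    · rw [foci, hsec]; exact Or.inr rfl
    · rw [← hR2, show r * k - 8 * P + 8 * Q = k * R by linarith]; ring
  · rw [hsec] at hspec
    have hP0 : P ≠ 0 := by
      rintro rfl; exact hspec (by rw [hP]; exact (mem_line_iff _).2 ⟨0, rfl⟩)
    -- The distance to the beam is √8 |s|, since |n|² = 8. The sign of `k` selects the side opposite
    -- to the principal centre.
    obtain ⟨k, hk2, hkP⟩ : ∃ k : ℝ, k ^ 2 = 8 ∧ k * P < 0 := by
      have h8 : √8 ^ 2 = (8 : ℝ) := Real.sq_sqrt (by norm_num)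
      have h80 : 0 < √(8 : ℝ) := by positivity
      rcases lt_or_gt_of_ne hP0 with h | h
      · exact ⟨√8, h8, mul_neg_of_pos_of_neg h80 h⟩
      · exact ⟨-√8, by rw [neg_sq, h8], mul_neg_of_neg_of_pos (by linarith) h⟩
    have hk0 : k ≠ 0 := by rintro rfl; norm_num at hk2
    have hside : ∀ s, s * P ≤ 0 ↔ 0 ≤ k * s := by
      intro s
      have : (k * s) * (k * P) = 8 * (s * P) := by linear_combination s * P * hk2
      constructor
      · intro h
        by_contra! hc
        have := mul_pos_of_neg_of_neg hc hkP
        linarith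
      · intro h
        have := mul_nonpos_of_nonneg_of_nonpos h hkP.le
        linarith
    have hdist : ∀ ξ s, infDist (framePt a b n ξ s) (line[ℝ, a, b] : Set E3) = |k * s| := by
      intro ξ s
      rw [hA.infDist_eq hk2 ξ s 0 (fun x => mem_line_iff x), sub_zero]
    refine ⟨k, P, r, hA, hr0, hr2, hkP.le, hP, hrad, ?_, ?_, ?_, Or.inl hk2⟩
    · intro x
      constructor
      · rintro ⟨ρ, hx, hρ, e1, e2⟩
        obtain ⟨ξ, s, rfl⟩ := (mem_plane_iff hn hn0).1 hx
        rw [hsec] at e2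
        simp only at e2
        rw [hP, hrad] at e1
        rw [hP, hA.wOppSide_iff hP0, hside, hdist] at e2
        obtain ⟨e2, e3⟩ := e2
        rw [abs_of_nonneg e3] at e2
        subst e2
        have d1 := hA.dist_sq ξ s 0 P
        rw [show dist (framePt a b n ξ s) (framePt a b n 0 P) = r - k * s by linarith] at d1
        refine ⟨ξ, s, rfl, hρ, ?_, by rw [d1]; ring⟩
        linarith [dist_nonneg (x := framePt a b n ξ s) (y := framePt a b n 0 P)]
      · rintro ⟨ξ, s, rfl, g1, g2, g3⟩
        refine ⟨k * s, hplane _ _, g1, ?_, ?_⟩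
        · rw [hP, hrad]
          have : dist (framePt a b n ξ s) (framePt a b n 0 P) = r - k * s := by
            apply (sq_eq_sq₀ dist_nonneg (by linarith)).1
            rw [hA.dist_sq, ← g3]; ring
          linarith
        · rw [hsec]
          simp only
          rw [hP, hA.wOppSide_iff hP0, hside, hdist, abs_of_nonneg g1]
          exact ⟨rfl, g1⟩
    · intro h hh
      obtain ⟨-, e⟩ := hh
      rw [hsec] at e
      simp only at e
      have hdm : dist (midpoint ℝ a b) (framePt a b n 0 P) = -(k * P) := by
        apply (sq_eq_sq₀ dist_nonneg (by linarith)).1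
        rw [dist_comm, dist_m]; linear_combination (-P ^ 2) * hk2
      have hdir : ∀ x, x ∈ (S.directrix : Set E3) ↔ ∃ τ, x = framePt a b n τ (r / k) := by
        intro x
        have hbase : midpoint ℝ a b + (S.radius / dist (midpoint ℝ a b) S.center) •
            (midpoint ℝ a b - S.center) = framePt a b n 0 (r / k) := by
          rw [hrad, hP, hdm, framePt, framePt]
          match_scalars
          · ring
          · ring
          · ring
          · field_simp
        rw [SetLike.mem_coe, directrix, hbase, AffineSubspace.mem_mk', vsub_eq_sub,
          Submodule.mem_span_singleton]
        constructor
        · rintro ⟨τ, hτ⟩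
          refine ⟨-2 * τ, ?_⟩
          rw [← sub_eq_zero, show x - framePt a b n (-2 * τ) (r / k) =
            (x - framePt a b n 0 (r / k)) -
              (framePt a b n (-2 * τ) (r / k) - framePt a b n 0 (r / k)) by abel, ← hτ, framePt_sub]
          module
        · rintro ⟨τ, rfl⟩
          refine ⟨-τ / 2, ?_⟩
          rw [framePt_sub]; module
      rw [hP, hA.infDist_eq hk2 0 h _ hdir] at e
      have d1 := hA.dist_sq 0 h 0 P
      rw [e, sq_abs] at d1
      have : k * (h - r / k) = -(r - k * h) := by field_simp; ring
      rw [this] at d1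
      linarith
    · rw [foci, hsec]; exact rfl

lemma NormalForm.peaRadius_eq {S : PeaPod a b} {k P r : ℝ} (h : S.NormalForm n k P r) {ξ s : ℝ}
    (h1 : k * s ≤ r) (h2 : ξ ^ 2 + 8 * (s - P) ^ 2 = (r - k * s) ^ 2) :
    S.peaRadius (framePt a b n ξ s) = k * s := by
  have : dist (framePt a b n ξ s) (framePt a b n 0 P) = r - k * s := by
    apply (sq_eq_sq₀ dist_nonneg (by linarith)).1
    rw [h.adapted.dist_sq, ← h2]; ring
  rw [peaRadius, h.radius_eq, h.center_eq, this]; ring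

end PeaPod

/-- The midpoints of the two beams differ by half of the axis vector a + b - c - d, and the two
frames measure height in opposite directions. -/
lemma framePt_opposite (a b c d : E3) (X : ℝ) :
    framePt a b (a + b - c - d) 0 X = framePt c d (c + d - a - b) 0 (-1 / 2 - X) := by
  rw [framePt, framePt, midpoint_eq_half, midpoint_eq_half]; module

/-- For k² = 8 the equation for the points on the axis becomes linear: a parabola meets its axis
once, so it cannot contain two foci of the other conic. -/
lemma parabola_single_root {k P P' Q r : ℝ} (hr2 : r ^ 2 = 1 + 8 * P ^ 2) (hk : k ^ 2 = 8)
    (h1 : 8 * (-1 / 2 - P' - P) ^ 2 = (r - k * (-1 / 2 - P')) ^ 2)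
    (h2 : 8 * (-1 / 2 - Q - P) ^ 2 = (r - k * (-1 / 2 - Q)) ^ 2) : P' = Q := by
  obtain ⟨L, hL⟩ : ∃ L, L = r * k - 8 * P := ⟨_, rfl⟩
  have t1 : 1 + L + 2 * L * P' = 0 := by
    rw [hL]; linear_combination (-1) * h1 - hr2 - (1 / 2 + P') ^ 2 * hk
  have t2 : 1 + L + 2 * L * Q = 0 := by
    rw [hL]; linear_combination (-1) * h2 - hr2 - (1 / 2 + Q) ^ 2 * hk
  have hL0 : L ≠ 0 := by rintro rfl; norm_num at t1
  apply mul_left_cancel₀ hL0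
  linarith

/-- The arcs and radii of a convex confocal pair are normalized arcs with `k * k' = 8`. -/
lemma exists_weights_of_convexConfocal (h4 : IsRegularTetrahedron 2 a b c d) {S : PeaPod a b}
    {S' : PeaPod c d} (hS : S.ConvexConfocal S') :
    ∃ k k' : ℝ, 0 < k ∧ 0 < k' ∧ k * k' = 8 ∧
      (∀ x, x ∈ S.arc ↔ ∃ ξ s, OnArc k ξ s ∧ x = framePt a b (a + b - c - d) ξ s) ∧
      (∀ ξ s, OnArc k ξ s → S.peaRadius (framePt a b (a + b - c - d) ξ s) = k * s) ∧
      (∀ x, x ∈ S'.arc ↔ ∃ ξ s, OnArc k' ξ s ∧ x = framePt c d (c + d - a - b) ξ s) ∧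
      (∀ ξ s, OnArc k' ξ s → S'.peaRadius (framePt c d (c + d - a - b) ξ s) = k' * s) := by
  -- The common axis passes through the midpoints of both beams.
  have hmem : a + b - c - d ∈ S.axis.direction := by
    have h1 := AffineSubspace.vsub_mem_direction S.midpoint_mem_axis
      (hS.axis_eq ▸ S'.midpoint_mem_axis)
    have : a + b - c - d = (2 : ℝ) • (midpoint ℝ a b -ᵥ midpoint ℝ c d) := by
      rw [vsub_eq_sub, midpoint_eq_half, midpoint_eq_half]; module
    rw [this]; exact Submodule.smul_mem _ _ h1
  have hneg : c + d - a - b = -(a + b - c - d) := by abel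
  have hmem' : c + d - a - b ∈ S'.axis.direction := by
    rw [hneg, ← hS.axis_eq]; exact Submodule.neg_mem _ hmem
  obtain ⟨hab, hac, had, hbc, hbd, hcd⟩ := h4
  have hnorm : ‖a + b - c - d‖ ^ 2 = 8 := by
    have sq : ∀ {x y : E3}, dist x y = 2 → ‖x‖ ^ 2 - 2 * inner ℝ x y + ‖y‖ ^ 2 = 4 := by
      intro x y h
      rw [← norm_sub_sq_real, ← dist_eq_norm, h]; norm_num
    rw [← real_inner_self_eq_norm_sq]
    simp only [inner_sub_left, inner_sub_right, inner_add_left, inner_add_right]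
    rw [real_inner_comm a b, real_inner_comm a c, real_inner_comm a d, real_inner_comm b c,
      real_inner_comm b d, real_inner_comm c d]
    simp only [real_inner_self_eq_norm_sq]
    linear_combination (-1) * sq hab - sq hcd + sq hac + sq had + sq hbc + sq hbd
  have hA : Adapted a b (a + b - c - d) := ⟨hab, hnorm, S.perp _ hmem⟩
  have hA' : Adapted c d (c + d - a - b) := ⟨hcd, by rw [hneg, norm_neg, hnorm], S'.perp _ hmem'⟩
  obtain ⟨k, P, r, N⟩ := S.exists_normalForm hA hmem
  obtain ⟨k', P', r', N'⟩ := S'.exists_normalForm hA' hmem'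
  have str : ∀ X, framePt a b (a + b - c - d) 0 X ∈ S.foci →
      8 * (-1 / 2 - X - P') ^ 2 = (r' - k' * (-1 / 2 - X)) ^ 2 := by
    intro X hX
    have := hS.foci_left hX
    rw [framePt_opposite] at this
    exact N'.of_mem_string _ this
  have str' : ∀ X, framePt c d (c + d - a - b) 0 X ∈ S'.foci →
      8 * (-1 / 2 - X - P) ^ 2 = (r - k * (-1 / 2 - X)) ^ 2 := by
    intro X hX
    have := hS.foci_right hX
    rw [framePt_opposite] at this
    exact N.of_mem_string _ this
  have s1 := str P (N.center_eq ▸ N.center_mem_foci)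
  have s3 := str' P' (N'.center_eq ▸ N'.center_mem_foci)
  have key : (r * k - 8 * P - 4) ^ 2 = 4 * k ^ 2 ∧ (k * k') ^ 2 = 64 ∧
      (r' * k' - 8 * P' - 4) * k ^ 2 = 8 * (r * k - 8 * P - 4) := by
    -- A parabola paired with a central conic is impossible, because both foci of the latter would
    -- lie on the parabola and on its axis.
    rcases N.second_focus with hk | ⟨Q, hPQ, hQ, hQ2⟩ <;>
      rcases N'.second_focus with hk' | ⟨Q', hPQ', hQ', hQ2'⟩
    · exact confocal_parabolic N.r_sq N'.r_sq hk hk' s1 s3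
    · exact absurd (parabola_single_root N.r_sq hk s3 (str' Q' hQ')) hPQ'
    · exact absurd (parabola_single_root N'.r_sq hk' s1 (str Q hQ)) hPQ
    · exact confocal_central N.r_pos N.r_sq N'.r_sq N.mul_nonpos hPQ hPQ' hQ2 hQ2'
        s1 (str Q hQ) s3 (str' Q' hQ')
  have bulb : (0 ≤ k' * (-1 / 2 - P) ∧ k' * (-1 / 2 - P) ≤ r') ∨
      (0 ≤ k * (-1 / 2 - P') ∧ k * (-1 / 2 - P') ≤ r) := by
    rcases hS.bulb with h | h
    · left
      obtain ⟨ξ, s, e, e1, e2, -⟩ := (N'.mem_arc _).1 h.1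
      rw [N.center_eq, framePt_opposite] at e
      have hs : -1 / 2 - P = s := by
        have := hA'.inner_framePt_sub 0 (-1 / 2 - P) ξ s
        rw [e, sub_self, inner_zero_left] at this
        linarith
      rw [hs]; exact ⟨e1, e2⟩
    · right
      obtain ⟨ξ, s, e, e1, e2, -⟩ := (N.mem_arc _).1 h.1
      rw [N'.center_eq, framePt_opposite] at e
      have hs : -1 / 2 - P' = s := by
        have := hA.inner_framePt_sub 0 (-1 / 2 - P') ξ s
        rw [e, sub_self, inner_zero_left] at this
        linarith
      rw [hs]; exact ⟨e1, e2⟩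
  obtain ⟨hk, hk', hkk, hL, hL'⟩ := confocal_signs N.r_pos N'.r_pos N.r_sq N'.r_sq N.mul_nonpos
    N'.mul_nonpos key.1 key.2.1 key.2.2 s1 s3 bulb
  refine ⟨k, k', hk, hk', hkk, ?_, ?_, ?_, ?_⟩
  · intro x
    rw [N.mem_arc]
    simp only [onArc_iff N.r_pos N.r_sq hk N.mul_nonpos hL, and_comm]
  · intro ξ s h
    obtain ⟨-, h1, h2⟩ := (onArc_iff N.r_pos N.r_sq hk N.mul_nonpos hL).2 h
    exact N.peaRadius_eq h1 h2
  · intro x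
    rw [N'.mem_arc]
    simp only [onArc_iff N'.r_pos N'.r_sq hk' N'.mul_nonpos hL', and_comm]
  · intro ξ s h
    obtain ⟨-, h1, h2⟩ := (onArc_iff N'.r_pos N'.r_sq hk' N'.mul_nonpos hL').2 h
    exact N'.peaRadius_eq h1 h2

end NormalForms

/-! ### Gluing: one system of weights for the six pea pods. -/

section Gluing

variable {v : Fin 4 → E3} {κ : Fin 4 → Fin 4 → ℝ} {i j l m : Fin 4}

/-- The six base cases are the orders with i < j and l < m; exchanges within the two pairs reach all
the others. -/
lemma Quad.induction {f : Fin 4 → Fin 4 → Fin 4 → Fin 4 → Prop} (h : Quad i j l m)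
    (hl : ∀ i j l m, f i j l m → f j i l m) (hr : ∀ i j l m, f i j l m → f i j m l)
    (h01 : f 0 1 2 3) (h23 : f 2 3 0 1) (h02 : f 0 2 1 3) (h13 : f 1 3 0 2) (h03 : f 0 3 1 2)
    (h12 : f 1 2 0 3) : f i j l m := by
  have key : ∀ i j l m : Fin 4, Quad i j l m → i < j → l < m → f i j l m := by
    intro i j l m h hij hlm
    have : (i, j, l, m) = (0, 1, 2, 3) ∨ (i, j, l, m) = (2, 3, 0, 1) ∨ (i, j, l, m) = (0, 2, 1, 3) ∨
        (i, j, l, m) = (1, 3, 0, 2) ∨ (i, j, l, m) = (0, 3, 1, 2) ∨ (i, j, l, m) = (1, 2, 0, 3) := by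
      clear * - h hij hlm; revert i j l m; decide
    simp only [Prod.mk.injEq] at this
    obtain ⟨rfl, rfl, rfl, rfl⟩ | ⟨rfl, rfl, rfl, rfl⟩ | ⟨rfl, rfl, rfl, rfl⟩ |
      ⟨rfl, rfl, rfl, rfl⟩ | ⟨rfl, rfl, rfl, rfl⟩ | ⟨rfl, rfl, rfl, rfl⟩ := this <;> assumption
  have key' : ∀ i j l m : Fin 4, Quad i j l m → i < j → f i j l m := by
    intro i j l m h hij
    rcases lt_or_gt_of_ne h.2.2.2.2.2 with hlm | hlm
    · exact key _ _ _ _ h hij hlm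
    · exact hr _ _ _ _ (key _ _ _ _ h.opp.swap.opp hij hlm)
  rcases lt_or_gt_of_ne h.1 with hij | hij
  · exact key' _ _ _ _ h hij
  · exact hl _ _ _ _ (key' _ _ _ _ h.swap hij)

/-- The wedge surface of the arc on `i, j` relative to the arc on `l, m`. -/
def wedgeSet (v : Fin 4 → E3) (κ : Fin 4 → Fin 4 → ℝ) (i j l m : Fin 4) : Set E3 :=
  {p | ∃ ξ s ξ' s', OnArc (κ i j) ξ s ∧ OnArc (κ l m) ξ' s' ∧
    p = tip (arcPt v i j l m ξ s) (arcPt v l m i j ξ' s') (κ i j * s)}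

/-- The boundary curve of the wedge surface of the arc on `i, j` seen from the vertex `t`. -/
def curveSet (v : Fin 4 → E3) (κ : Fin 4 → Fin 4 → ℝ) (i j l m t : Fin 4) : Set E3 :=
  {p | ∃ ξ s, OnArc (κ i j) ξ s ∧ p = tip (arcPt v i j l m ξ s) (v t) (κ i j * s)}

lemma OnArc.neg_left {k ξ s : ℝ} (h : OnArc k ξ s) : OnArc k (-ξ) s :=
  ⟨h.1, h.2.1, by rw [neg_sq]; exact h.2.2⟩

lemma wedgeSet_swap_left (hκ : Weights κ) : wedgeSet v κ i j l m ⊆ wedgeSet v κ j i l m := by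
  rintro p ⟨ξ, s, ξ', s', h, h', rfl⟩
  refine ⟨-ξ, s, ξ', s', ?_, h', ?_⟩
  · rw [hκ.symm]; exact h.neg_left
  · rw [arcPt_comm_left, arcPt_comm_right v l m i j, hκ.symm i j]

lemma wedgeSet_swap_right (hκ : Weights κ) : wedgeSet v κ i j l m ⊆ wedgeSet v κ i j m l := by
  rintro p ⟨ξ, s, ξ', s', h, h', rfl⟩
  refine ⟨ξ, s, -ξ', s', h, ?_, ?_⟩
  · rw [hκ.symm]; exact h'.neg_left
  · rw [arcPt_comm_left v l m, neg_neg, arcPt_comm_right v i j]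

lemma curveSet_swap_left (hκ : Weights κ) (t : Fin 4) :
    curveSet v κ j i l m t = curveSet v κ i j l m t := by
  have : ∀ i j, curveSet v κ j i l m t ⊆ curveSet v κ i j l m t := by
    rintro i j p ⟨ξ, s, h, rfl⟩
    refine ⟨-ξ, s, ?_, ?_⟩
    · rw [hκ.symm]; exact h.neg_left
    · rw [arcPt_comm_left v i j, hκ.symm j i]
  exact (this i j).antisymm (this j i)

lemma curveSet_swap_right (t : Fin 4) : curveSet v κ i j m l t = curveSet v κ i j l m t := by
  simp only [curveSet, arcPt_comm_right v i j l m]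

/-- The arc and the radii of the pea pod are those of the normalized arc on `i, j`. -/
structure Realizes (κ : Fin 4 → Fin 4 → ℝ) (l m : Fin 4) (S : PeaPod (v i) (v j)) : Prop where
  mem_arc : ∀ x, x ∈ S.arc ↔ ∃ ξ s, OnArc (κ i j) ξ s ∧ x = arcPt v i j l m ξ s
  peaRadius_eq : ∀ ξ s, OnArc (κ i j) ξ s → S.peaRadius (arcPt v i j l m ξ s) = κ i j * s

lemma Realizes.wedge_eq {S : PeaPod (v i) (v j)} {S' : PeaPod (v l) (v m)}
    (h : Realizes κ l m S) (h' : Realizes κ i j S') : S.wedge S' = wedgeSet v κ i j l m := by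
  ext p
  constructor
  · rintro ⟨x, hx, y, hy, rfl⟩
    obtain ⟨ξ, s, ha, rfl⟩ := (h.mem_arc x).1 hx
    obtain ⟨ξ', s', ha', rfl⟩ := (h'.mem_arc y).1 hy
    exact ⟨ξ, s, ξ', s', ha, ha', by rw [PeaPod.phi, h.peaRadius_eq ξ s ha, tip]⟩
  · rintro ⟨ξ, s, ξ', s', ha, ha', rfl⟩
    exact ⟨_, (h.mem_arc _).2 ⟨ξ, s, ha, rfl⟩, _, (h'.mem_arc _).2 ⟨ξ', s', ha', rfl⟩,
      by rw [PeaPod.phi, h.peaRadius_eq ξ s ha, tip]⟩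

lemma Realizes.edgeCurve_eq {S : PeaPod (v i) (v j)} (h : Realizes κ l m S) (t : Fin 4) :
    S.edgeCurve (v t) = curveSet v κ i j l m t := by
  ext p
  constructor
  · rintro ⟨x, hx, rfl⟩
    obtain ⟨ξ, s, ha, rfl⟩ := (h.mem_arc x).1 hx
    exact ⟨ξ, s, ha, by rw [PeaPod.phi, h.peaRadius_eq ξ s ha, tip]⟩
  · rintro ⟨ξ, s, ha, rfl⟩
    exact ⟨_, (h.mem_arc _).2 ⟨ξ, s, ha, rfl⟩, by rw [PeaPod.phi, h.peaRadius_eq ξ s ha, tip]⟩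

lemma framePt_eq_arcPt (ξ s : ℝ) :
    framePt (v i) (v j) (v i + v j - v l - v m) ξ s = arcPt v i j l m ξ s := by
  rw [framePt, midpoint_eq_half, arcPt]; module

/-- The weights are quantified after `k` and `k'`, so that the three pairs of opposite edges can
afterwards share one matrix. -/
lemma Regular.exists_realizes (hv : Regular v) (h : Quad i j l m) {S : PeaPod (v i) (v j)}
    {S' : PeaPod (v l) (v m)} (hS : S.ConvexConfocal S') :
    ∃ k k' : ℝ, 0 < k ∧ 0 < k' ∧ k * k' = 8 ∧ ∀ κ : Fin 4 → Fin 4 → ℝ, κ i j = k → κ l m = k' →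
      Realizes κ l m S ∧ Realizes κ i j S' := by
  have ht : IsRegularTetrahedron 2 (v i) (v j) (v l) (v m) :=
    ⟨hv _ _ h.1, hv _ _ h.2.1, hv _ _ h.2.2.1, hv _ _ h.2.2.2.1, hv _ _ h.2.2.2.2.1,
      hv _ _ h.2.2.2.2.2⟩
  obtain ⟨k, k', hk, hk', hkk, h1, h2, h3, h4⟩ := exists_weights_of_convexConfocal ht hS
  simp only [framePt_eq_arcPt] at h1 h2 h3 h4
  refine ⟨k, k', hk, hk', hkk, ?_⟩
  rintro κ rfl rfl
  exact ⟨⟨h1, h2⟩, ⟨h3, h4⟩⟩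

/-- The three pairs of opposite edges constrain disjoint entries of a symmetric matrix, so their
parameters can be chosen independently. -/
lemma exists_weights {k k' q q' r r' : ℝ} (hk : 0 < k) (hk' : 0 < k') (hq : 0 < q) (hq' : 0 < q')
    (hr : 0 < r) (hr' : 0 < r') (h1 : k * k' = 8) (h2 : q * q' = 8) (h3 : r * r' = 8) :
    ∃ κ, Weights κ ∧ κ 0 1 = k ∧ κ 2 3 = k' ∧ κ 0 2 = q ∧ κ 1 3 = q' ∧ κ 0 3 = r ∧ κ 1 2 = r' := by
  have symm : ∀ i j, !![0, k, q, r; k, 0, r', q'; q, r', 0, k'; r, q', k', 0] i j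
      = !![0, k, q, r; k, 0, r', q'; q, r', 0, k'; r, q', k', 0] j i := by
    intro i j
    fin_cases i <;> fin_cases j <;> rfl
  refine ⟨!![0, k, q, r; k, 0, r', q'; q, r', 0, k'; r, q', k', 0], ⟨symm, ?_, ?_⟩,
    rfl, rfl, rfl, rfl, rfl, rfl⟩
  · intro i j hij
    obtain ⟨l, m, h⟩ := exists_quad hij
    refine h.induction
      (f := fun i j _ _ => 0 < !![0, k, q, r; k, 0, r', q'; q, r', 0, k'; r, q', k', 0] i j)
      (fun i j _ _ h => ?_) (fun _ _ _ _ h => h) hk hk' hq hq' hr hr'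
    rw [symm]; exact h
  · intro i j l m h
    refine h.induction
      (f := fun i j l m => !![0, k, q, r; k, 0, r', q'; q, r', 0, k'; r, q', k', 0] i j *
        !![0, k, q, r; k, 0, r', q'; q, r', 0, k'; r, q', k', 0] l m = 8)
      (fun i j l m h => ?_) (fun i j l m h => ?_) h1 ((mul_comm _ _).trans h1) h2
      ((mul_comm _ _).trans h2) h3 ((mul_comm _ _).trans h3)
    · rw [symm j i]; exact h
    · rw [symm m l]; exact h

lemma gammaSet_eq (hκ : Weights κ) (h : Quad i j l m) :
    gammaSet v κ i = curveSet v κ l m i j i ∪ curveSet v κ j m i l i ∪ curveSet v κ j l i m i := by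
  apply Subset.antisymm
  · rintro p ⟨j', l', m', ξ, s, h', ha, rfl⟩
    have hp : tip (arcPt v l' m' i j' ξ s) (v i) (κ l' m' * s) ∈ curveSet v κ l' m' i j' i :=
      ⟨ξ, s, ha, rfl⟩
    have hj := h.cases j'
    have hl := h.cases l'
    have hm := h.cases m'
    have hperm : (l' = l ∧ m' = m ∧ j' = j) ∨ (l' = m ∧ m' = l ∧ j' = j) ∨
        (l' = j ∧ m' = m ∧ j' = l) ∨ (l' = m ∧ m' = j ∧ j' = l) ∨
        (l' = j ∧ m' = l ∧ j' = m) ∨ (l' = l ∧ m' = j ∧ j' = m) := by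
      clear * - h' hj hl hm
      unfold Quad at h'
      grind
    obtain ⟨rfl, rfl, rfl⟩ | ⟨rfl, rfl, rfl⟩ | ⟨rfl, rfl, rfl⟩ | ⟨rfl, rfl, rfl⟩ |
      ⟨rfl, rfl, rfl⟩ | ⟨rfl, rfl, rfl⟩ := hperm
    · exact Or.inl (Or.inl hp)
    · exact Or.inl (Or.inl (curveSet_swap_left hκ i ▸ hp))
    · exact Or.inl (Or.inr hp)
    · exact Or.inl (Or.inr (curveSet_swap_left hκ i ▸ hp))
    · exact Or.inr hp
    · exact Or.inr (curveSet_swap_left hκ i ▸ hp)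
  · have q1 : Quad i l j m := by unfold Quad at *; tauto
    have q2 : Quad i m j l := by unfold Quad at *; tauto
    rintro p ((⟨ξ, s, ha, rfl⟩ | ⟨ξ, s, ha, rfl⟩) | ⟨ξ, s, ha, rfl⟩)
    · exact ⟨j, l, m, ξ, s, h, ha, rfl⟩
    · exact ⟨l, j, m, ξ, s, q1, ha, rfl⟩
    · exact ⟨m, j, l, ξ, s, q2, ha, rfl⟩

lemma Regular.mem_reuleaux (hv : Regular v) (z : E3) :
    z ∈ reuleaux (v 0) (v 1) (v 2) (v 3) ↔ InReuleaux v z := by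
  simp only [reuleaux, InReuleaux, mem_inter_iff, mem_closedBall, hv.dist_vertex_le,
    Fin.forall_fin_succ, Fin.isValue]
  simp [and_assoc]

/-- The surface glued from the wedges and caps is the boundary of the pea body. -/
lemma Regular.frontier_peaBody_eq_surface (hv : Regular v) (hκ : Weights κ)
    {AB : PeaPod (v 0) (v 1)} {CD : PeaPod (v 2) (v 3)} {AC : PeaPod (v 0) (v 2)}
    {BD : PeaPod (v 1) (v 3)} {AD : PeaPod (v 0) (v 3)} {BC : PeaPod (v 1) (v 2)}
    (hAB : Realizes κ 2 3 AB) (hCD : Realizes κ 0 1 CD) (hAC : Realizes κ 1 3 AC)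
    (hBD : Realizes κ 0 2 BD) (hAD : Realizes κ 1 2 AD) (hBC : Realizes κ 0 3 BC) :
    frontier (peaBody v κ) = surface AB CD AC BD AD BC := by
  have ha : BC.edgeCurve (v 0) ∪ CD.edgeCurve (v 0) ∪ BD.edgeCurve (v 0) = gammaSet v κ 0 := by
    rw [gammaSet_eq hκ (show Quad 0 1 2 3 by decide), hBC.edgeCurve_eq, hCD.edgeCurve_eq,
      hBD.edgeCurve_eq, union_comm (curveSet v κ 1 2 0 3 0), union_right_comm]
  have hb : CD.edgeCurve (v 1) ∪ AD.edgeCurve (v 1) ∪ AC.edgeCurve (v 1) = gammaSet v κ 1 := by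
    rw [gammaSet_eq hκ (show Quad 1 0 2 3 by decide), hCD.edgeCurve_eq, hAD.edgeCurve_eq,
      hAC.edgeCurve_eq, curveSet_swap_right (l := 0)]
  have hc : AB.edgeCurve (v 2) ∪ BD.edgeCurve (v 2) ∪ AD.edgeCurve (v 2) = gammaSet v κ 2 := by
    rw [gammaSet_eq hκ (show Quad 2 0 1 3 by decide), hAB.edgeCurve_eq, hBD.edgeCurve_eq,
      hAD.edgeCurve_eq, curveSet_swap_right (l := 0), curveSet_swap_right (l := 1),
      union_comm (curveSet v κ 0 1 2 3 2), union_right_comm]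
  have hd : AB.edgeCurve (v 3) ∪ BC.edgeCurve (v 3) ∪ AC.edgeCurve (v 3) = gammaSet v κ 3 := by
    rw [gammaSet_eq hκ (show Quad 3 0 1 2 by decide), hAB.edgeCurve_eq, hBC.edgeCurve_eq,
      hAC.edgeCurve_eq, curveSet_swap_right (l := 0), curveSet_swap_right (l := 1) (m := 3),
      curveSet_swap_right (l := 2) (m := 3),
      union_comm (curveSet v κ 0 1 2 3 3), union_right_comm]
  rw [surface, ha, hb, hc, hd, hv.cap_eq hκ 0 hv.mem_reuleaux, hv.cap_eq hκ 1 hv.mem_reuleaux,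
    hv.cap_eq hκ 2 hv.mem_reuleaux, hv.cap_eq hκ 3 hv.mem_reuleaux, hAB.wedge_eq hCD,
    hCD.wedge_eq hAB, hAC.wedge_eq hBD, hBD.wedge_eq hAC, hAD.wedge_eq hBC, hBC.wedge_eq hAD]
  ext p
  rw [hv.frontier_eq hκ]
  refine or_congr ⟨?_, ?_⟩ ⟨?_, ?_⟩
  · rintro ⟨i, j, l, m, ξ, s, ξ', s', h, h1, h2, h3⟩
    revert h1 h2 h3
    suffices p ∈ wedgeSet v κ i j l m → p ∈ wedgeSet v κ 0 1 2 3 ∪ wedgeSet v κ 2 3 0 1 ∪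
        wedgeSet v κ 0 2 1 3 ∪ wedgeSet v κ 1 3 0 2 ∪ wedgeSet v κ 0 3 1 2 ∪ wedgeSet v κ 1 2 0 3 from
      fun h1 h2 h3 => this ⟨ξ, s, ξ', s', h1, h2, h3⟩
    refine h.induction (f := fun i j l m => p ∈ wedgeSet v κ i j l m → _)
      (fun i j l m hf hp => hf (wedgeSet_swap_left hκ hp))
      (fun i j l m hf hp => hf (wedgeSet_swap_right hκ hp)) ?_ ?_ ?_ ?_ ?_ ?_ <;>
    · simp only [mem_union]; tauto
  · rintro (((((h | h) | h) | h) | h) | h) <;>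
    · obtain ⟨ξ, s, ξ', s', h⟩ := h
      exact ⟨_, _, _, _, ξ, s, ξ', s', by decide, h⟩
  · rintro ⟨t, ht⟩
    fin_cases t
    exacts [.inl (.inl (.inl ht)), .inl (.inl (.inr ht)), .inl (.inr ht), .inr ht]
  · rintro (((h | h) | h) | h)
    exacts [⟨0, h⟩, ⟨1, h⟩, ⟨2, h⟩, ⟨3, h⟩]

end Gluing

end Peabody

end

theorem mainTheorem1 (a b c d : Peabody.E3) (habcd : Peabody.IsRegularTetrahedron 2 a b c d)
    (AB : Peabody.PeaPod a b) (CD : Peabody.PeaPod c d)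
    (AC : Peabody.PeaPod a c) (BD : Peabody.PeaPod b d)
    (AD : Peabody.PeaPod a d) (BC : Peabody.PeaPod b c)
    (h₁ : AB.ConvexConfocal CD) (h₂ : AC.ConvexConfocal BD) (h₃ : AD.ConvexConfocal BC) :
    ∃ K : ConvexBody Peabody.E3,
      (interior (K : Set Peabody.E3)).Nonempty ∧
      Peabody.HasConstantWidth K 2 ∧
      frontier (K : Set Peabody.E3) = Peabody.surface AB CD AC BD AD BC ∧
      (∀ p ∈ Peabody.surface AB CD AC BD AD BC, p ∉ ({a, b, c, d} : Set Peabody.E3) →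
        Peabody.HasUniqueSupportPlane K p ∧
        Peabody.IsRegularSurfaceAt (Peabody.surface AB CD AC BD AD BC) p) ∧
      (∀ p ∈ ({a, b, c, d} : Set Peabody.E3), Peabody.IsVertexSingularity K p) := by
  obtain ⟨v, rfl, rfl, rfl, rfl⟩ : ∃ v : Fin 4 → Peabody.E3, v 0 = a ∧ v 1 = b ∧ v 2 = c ∧ v 3 = d :=
    ⟨![a, b, c, d], rfl, rfl, rfl, rfl⟩
  have hv : Peabody.Regular v := by
    obtain ⟨hab, hac, had, hbc, hbd, hcd⟩ := habcd
    intro i j hij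
    fin_cases i <;> fin_cases j <;> first | exact absurd rfl hij | assumption |
      (rw [dist_comm]; assumption)
  have hV : ({v 0, v 1, v 2, v 3} : Set Peabody.E3) = Set.range v := by
    ext x
    simp [Fin.exists_fin_succ, eq_comm]
  obtain ⟨k, k', hk, hk', hkk, H₁⟩ := hv.exists_realizes (by decide) h₁
  obtain ⟨q, q', hq, hq', hqq, H₂⟩ := hv.exists_realizes (by decide) h₂
  obtain ⟨r, r', hr, hr', hrr, H₃⟩ := hv.exists_realizes (by decide) h₃
  obtain ⟨κ, hκ, e1, e1', e2, e2', e3, e3'⟩ :=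
    Peabody.exists_weights hk hk' hq hq' hr hr' hkk hqq hrr
  obtain ⟨hAB, hCD⟩ := H₁ κ e1 e1'
  obtain ⟨hAC, hBD⟩ := H₂ κ e2 e2'
  obtain ⟨hAD, hBC⟩ := H₃ κ e3 e3'
  rw [hV, ← hv.frontier_peaBody_eq_surface hκ hAB hCD hAC hBD hAD hBC]
  have hcomp : IsCompact (Peabody.peaBody v κ) := hv.isCompact_peaBody
  have hconv : Convex ℝ (Peabody.peaBody v κ) := Peabody.convex_ballHull _
  have hnon := hv.interior_peaBody_nonempty hκ
  refine ⟨⟨Peabody.peaBody v κ, hconv, hcomp, hnon.mono interior_subset⟩, hnon,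
    hv.hasConstantWidth hκ, rfl, fun p hp hpv => ⟨hv.hasUniqueSupportPlane hκ hp hpv, ?_⟩, ?_⟩
  · exact Peabody.isRegularSurfaceAt_frontier hcomp hconv hnon (Set.finite_range v).isClosed
      (fun _ => hv.hasUniqueSupportPlane hκ) hp hpv
  · rintro _ ⟨t, rfl⟩
    exact hv.isVertexSingularity hκ t
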